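/- Consider independent nearest-neighbour bond percolation, or independent nearest-neighbour site percolation, on $\mathbb{Z}^d$ at its critical density $p_c=\inf\{p:\ \mathbb{P}_p(0\text{ lies in an infinite cluster})>0\}$. Write $\mathbb{P}=\mathbb{P}_{p_c}$ and $\tau(x,y)=\mathbb{P}(x\text{ and }y\text{ are connected})$, where connecting paths may run anywhere in $\mathbb{Z}^d$. For $L\in\mathbb{N}$ let $\Lambda_L=[-L,L]^d$, let $\partial\Lambda_\pm=\{x\in\Lambda_L: x_1=\pm L\}$, and for real $W$ let $B_W=[-W,W]^d$. A cluster is spanning if it intersects both $\partial\Lambda_-$ and $\partial\Lambda_+$. Let $N_L$ be the number of spanning clusters and $N_{L,W}$ the number of those that intersect $B_W$. Suppose $d>6$ and that there are constants $0<C'\le C<\infty$ with $$\frac{C'}{|x-y|^{d-2}}\ \le\ \tau(x,y)\ \le\ \frac{C}{|x-y|^{d-2}}\qquad\text{for all } x\ne y .$$ Then: 1. $\mathbb{P}(\text{there is a spanning cluster})\to 1$ as $L\to\infty$. 2. If $W=W(L)$ satisfies $W/L^{2/(d-4)}\to\infty$ as $L\to\infty$, then $\mathbb{P}(\text{some spanning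 cluster intersects }B_W)\to1$ as $L\to\infty$. 3. (a) For every function $\varepsilon(L)$ with $\varepsilon(L)\to0$ as $L\to\infty$, $\mathbb{P}\bigl(N_L\ge\varepsilon(L)\,L^{d-6}\bigr)\to1$ as $L\to\infty$. (b) For all sequences $L_n\in\mathbb{N}$, $W_n\in\mathbb{R}$ and $\varepsilon_n\in\mathbb{R}$ with $L_n\to\infty$, $W_n\le L_n$, $W_n/L_n^{2/(d-4)}\to\infty$ and $\varepsilon_n\to0$, $\mathbb{P}\bigl(N_{L_n,W_n}\ge\varepsilon_n\,W_n^{d-4}/L_n^2\bigr)\to1$ as $n\to\infty$. -/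

import Mathlib

open MeasureTheory ProbabilityTheory Filter Topology

noncomputable section

namespace Percolation

/-- The sites of the lattice `ℤ^d`. -/
abbrev Site (d : ℕ) : Type := Fin d → ℤ

/-- Euclidean distance between two sites. -/
def eDist {d : ℕ} (x y : Site d) : ℝ :=
  Real.sqrt (∑ i, ((x i : ℝ) - (y i : ℝ)) ^ 2)

/-- The nearest-neighbour graph on `ℤ^d`. -/
def lattice (d : ℕ) : SimpleGraph (Site d) where
  Adj x y := ∑ i, |x i - y i| = 1
  symm := ⟨fun x y h => by simpa only [abs_sub_comm] using h⟩
  loopless := ⟨fun x h => by simp at h⟩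

/-- The two kinds of nearest-neighbour percolation: the random elements are either the bonds or
the sites. -/
inductive Model : Type
  | bond : Model
  | site : Model

/-- The index set of the independent random variables. -/
def Model.Element (m : Model) (d : ℕ) : Type :=
  match m with
  | .bond => (lattice d).edgeSet
  | .site => Site d

/-- A configuration tells which elements are open (`true`) and which are closed (`false`). -/
abbrev Config (m : Model) (d : ℕ) : Type := m.Element d → Bool

/-- Independent percolation with density `p`: each element is open with probability `p`,
independently of all the others. -/
def law (m : Model) (d : ℕ) (p : unitInterval) : Measure (Config m d) :=
  Measure.infinitePi fun _ => bernoulliMeasure true false p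

/-- The sites that belong to clusters: all of them in bond percolation, the open ones in site
percolation. -/
def occupied {d : ℕ} : (m : Model) → Config m d → Set (Site d)
  | .bond, _ => Set.univ
  | .site, ω => {x | ω x = true}

/-- The random graph: the open bonds in bond percolation, the bonds between two open sites in site
percolation. -/
def openGraph {d : ℕ} : (m : Model) → Config m d → SimpleGraph (Site d)
  | .bond, ω => SimpleGraph.fromEdgeSet {e | ∃ h : e ∈ (lattice d).edgeSet, ω ⟨e, h⟩ = true}
  | .site, ω =>
    { Adj := fun x y => (lattice d).Adj x y ∧ ω x = true ∧ ω y = true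
      symm := ⟨fun _ _ h => ⟨h.1.symm, h.2.2, h.2.1⟩⟩
      loopless := ⟨fun x h => (lattice d).loopless.irrefl x h.1⟩ }

/-- Two sites are connected, by a path anywhere in `ℤ^d` (bulk boundary conditions). -/
def Connected {m : Model} {d : ℕ} (ω : Config m d) (x y : Site d) : Prop :=
  x ∈ occupied m ω ∧ y ∈ occupied m ω ∧ (openGraph m ω).Reachable x y

/-- The cluster of a site: all the sites connected to it. -/
def cluster {m : Model} {d : ℕ} (ω : Config m d) (x : Site d) : Set (Site d) :=
  {y | Connected ω x y}

/-- The connected clusters of a configuration. -/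
def clusters {m : Model} {d : ℕ} (ω : Config m d) : Set (Set (Site d)) :=
  {C | ∃ x ∈ occupied m ω, C = cluster ω x}

/-- Percolation density: the probability that the origin belongs to an infinite cluster. -/
def density (m : Model) (d : ℕ) (p : unitInterval) : ℝ :=
  (law m d p).real {ω | (cluster ω 0).Infinite}

/-- The critical density `p_c`. -/
def criticalDensity (m : Model) (d : ℕ) : unitInterval :=
  sInf {p | 0 < density m d p}

/-- The law of critical percolation. -/
def criticalLaw (m : Model) (d : ℕ) : Measure (Config m d) :=
  law m d (criticalDensity m d)

/-- The critical two-point function `τ(x, y)`. -/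
def twoPoint (m : Model) (d : ℕ) (x y : Site d) : ℝ :=
  (criticalLaw m d).real {ω | Connected ω x y}

/-- The cube `[-R, R]^d`, as a set of sites. -/
def box (d : ℕ) (R : ℝ) : Set (Site d) := {x | ∀ i, |(x i : ℝ)| ≤ R}

/-- The left face `{x₁ = -L}` of the cube `[-L, L]^d`. -/
def leftFace (d : ℕ) [NeZero d] (L : ℕ) : Set (Site d) := {x ∈ box d L | x 0 = -(L : ℤ)}

/-- The right face `{x₁ = L}` of the cube `[-L, L]^d`. -/
def rightFace (d : ℕ) [NeZero d] (L : ℕ) : Set (Site d) := {x ∈ box d L | x 0 = (L : ℤ)}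

/-- The clusters that span `[-L, L]^d` from left to right. -/
def spanningClusters {m : Model} {d : ℕ} [NeZero d] (L : ℕ) (ω : Config m d) :
    Set (Set (Site d)) :=
  {C ∈ clusters ω | (C ∩ leftFace d L).Nonempty ∧ (C ∩ rightFace d L).Nonempty}

/-- The clusters that span `[-L, L]^d` and are seen in the window `[-W, W]^d`. -/
def spanningClustersSeen {m : Model} {d : ℕ} [NeZero d] (L : ℕ) (W : ℝ) (ω : Config m d) :
    Set (Set (Site d)) :=
  {C ∈ spanningClusters L ω | (C ∩ box d W).Nonempty}

/-- `N_L`, the number of spanning clusters (a finite number, see `finite_spanningClusters`). -/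
def numSpanning {m : Model} {d : ℕ} [NeZero d] (L : ℕ) (ω : Config m d) : ℕ :=
  (spanningClusters L ω).ncard

/-- `N_{L,W}`, the number of spanning clusters seen in the window `[-W, W]^d`. -/
def numSpanningSeen {m : Model} {d : ℕ} [NeZero d] (L : ℕ) (W : ℝ) (ω : Config m d) : ℕ :=
  (spanningClustersSeen L W ω).ncard

theorem finite_box (d : ℕ) (R : ℝ) : (box d R).Finite := by
  have h : box d R ⊆ Set.pi Set.univ fun _ : Fin d => Set.Icc (-⌈R⌉) ⌈R⌉ := by
    intro x hx i _
    have h1 := abs_le.1 (hx i)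
    have h2 := Int.le_ceil R
    constructor
    · have : ((-⌈R⌉ : ℤ) : ℝ) ≤ x i := by push_cast; linarith
      exact_mod_cast this
    · have : (x i : ℝ) ≤ (⌈R⌉ : ℤ) := by linarith
      exact_mod_cast this
  exact (Set.Finite.pi' fun _ => Set.finite_Icc _ _).subset fun x hx i => h hx i (Set.mem_univ i)

theorem finite_spanningClusters {m : Model} {d : ℕ} [NeZero d] (L : ℕ) (ω : Config m d) :
    (spanningClusters L ω).Finite := by
  refine ((finite_box d L).image (cluster ω)).subset ?_
  rintro C ⟨⟨x, hx, rfl⟩, ⟨y, hy, hyL⟩, -⟩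
  refine ⟨y, hyL.1, ?_⟩
  ext z
  exact ⟨fun h => ⟨hx, h.2.1, hy.2.2.trans h.2.2⟩,
    fun h => ⟨hy.2.1, h.2.1, hy.2.2.symm.trans h.2.2⟩⟩

end Percolation

end

/-! Let `T` be the number of triples (x, y, z), with x in a cube of radius R ≤ L/2, y in the left
face and z in the right face, such that x is connected to y and to z. Let `Q` be the number of pairs
of such triples that lie in a single cluster. Grouping triples by their cluster, Cauchy–Schwarz
gives T² ≤ N · Q, where N counts the spanning clusters seen in the window (`sq_sum_spans_le`). It
remains to see that `T` is of the order of its mean and that `Q` is not too large.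

The mean of `T` is at least of order R^d L^4, because P(x ↔ y, x ↔ z) ≥ c L^{-(2d-6)}
(`exists_le_law_conn_conn`). This is what the sum over a branch point w of τ(w,x) τ(w,y) τ(w,z)
predicts. For a rigorous lower bound, three connections are started at points K or 2K apart and
their clusters are explored one after the other (`tau_mul_tau_mul_tau_le`). Meetings have relative
probability O(1/K), since convolving three kernels |·|^{2-d} yields |·|^{6-d}, which decays as d > 6
(`exists_meet_le`). For K large, half of the product is left for three different clusters, and
opening a ball of radius K joins them at a bounded price (`LinkSystem.pow_mul_prob_separated_le`).
Two such branching balls for the same x, y, z cannot be disjoint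
(`LinkSystem.Branching.not_disjoint`), so summing over w counts each connection a bounded number of
times.

The mean of `Q` is at most of order R^{d+4} L^{10}. A tree of connections splits disjointly at its
first branch point, so the van den Berg–Kesten inequality gives a recursion for joint moments
(`LinkSystem.prob_reach_all_le`, `LinkSystem.moment_le`), which is solved with kernel estimates in
`exists_moment_le`. Different clusters use disjoint elements, so the same inequality bounds the
variance of `T` by the mean of `Q` (`LinkSystem.prob_conn_and_conn_le`).

With n = R^{d-4}/L^2, the relative variance is O(1/n), and Chebyshev and Markov give P(N < εn) ≤ C/n
+ Cε (`exists_law_numSpanningSeen_lt_le`). All the claims follow with R = ⌊W/2⌋: n tends to infinity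
when W is much larger than L^{2/(d-4)}, and W = L is allowed because d > 6.

Probabilities are handled for finite sets of elements and passed to the limit (`tendsto_prob`).
Bonds and sites are treated at once through `LinkSystem`. There `Reach` does not ask the starting
site to be open, so two pieces of a path that are glued at a site can use disjoint elements in both
models. -/

noncomputable section

namespace Percolation

open scoped Classical

/-- The indicator of a proposition, as a real number. -/
def ind (P : Prop) : ℝ := if P then 1 else 0

theorem ind_true {P : Prop} (h : P) : ind P = 1 := if_pos h

theorem ind_false {P : Prop} (h : ¬P) : ind P = 0 := if_neg h

theorem ind_nonneg (P : Prop) : 0 ≤ ind P := by unfold ind; split_ifs <;> norm_num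

theorem ind_le_one (P : Prop) : ind P ≤ 1 := by unfold ind; split_ifs <;> norm_num

theorem ind_mono {P Q : Prop} (h : P → Q) : ind P ≤ ind Q := by
  unfold ind; split_ifs <;> first | (exfalso; tauto) | norm_num

theorem ind_and (P Q : Prop) : ind (P ∧ Q) = ind P * ind Q := by
  unfold ind; split_ifs <;> first | (exfalso; tauto) | norm_num

theorem ind_or_le (P Q : Prop) : ind (P ∨ Q) ≤ ind P + ind Q := by
  unfold ind; split_ifs <;> first | (exfalso; tauto) | norm_num

theorem ind_le_of_imp {P : Prop} {r : ℝ} (h0 : 0 ≤ r) (h : P → 1 ≤ r) : ind P ≤ r := by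
  by_cases hP : P
  · rw [ind_true hP]; exact h hP
  · rw [ind_false hP]; exact h0

/-! ### Finite product measures: independence, the van den Berg–Kesten inequality, exploration. -/

section FiniteProbability

variable {E : Type*} [DecidableEq E]

/-- The probability that `S` is the set of open elements of `F`. -/
def weight (p : ℝ) (F S : Finset E) : ℝ := ∏ e ∈ F, if e ∈ S then p else 1 - p

/-- The expectation of a function of the set of open elements of the finite set `F`. -/
def expect (p : ℝ) (F : Finset E) (f : Finset E → ℝ) : ℝ :=
  ∑ S ∈ F.powerset, weight p F S * f S

/-- The probability of an event that depends on the set of open elements of `F`. -/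
def prob (p : ℝ) (F : Finset E) (A : Finset E → Prop) : ℝ := expect p F fun S => ind (A S)

variable {p : ℝ} {F : Finset E} {f g : Finset E → ℝ}

theorem weight_nonneg (h0 : 0 ≤ p) (h1 : p ≤ 1) (F S : Finset E) : 0 ≤ weight p F S :=
  Finset.prod_nonneg fun e _ => by split_ifs <;> linarith

theorem expect_empty : expect p ∅ f = f ∅ := by simp [expect, weight]

/-- Conditioning on the state of one element. The inductions on `F` below run on this formula. -/
theorem expect_insert {a : E} (ha : a ∉ F) (f : Finset E → ℝ) :
    expect p (insert a F) f =
      (1 - p) * expect p F f + p * expect p F fun S => f (insert a S) := by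
  unfold expect
  rw [Finset.sum_powerset_insert ha, Finset.mul_sum, Finset.mul_sum]
  congr 1
  · refine Finset.sum_congr rfl fun S hS => ?_
    have haS : a ∉ S := fun h => ha (Finset.mem_powerset.1 hS h)
    rw [weight, Finset.prod_insert ha, if_neg haS, weight, mul_assoc]
  · refine Finset.sum_congr rfl fun S hS => ?_
    rw [weight, Finset.prod_insert ha, if_pos (Finset.mem_insert_self _ _), weight, mul_assoc]
    congr 2
    refine Finset.prod_congr rfl fun e he => ?_
    have : e ≠ a := fun h => ha (h ▸ he)
    simp [this]

theorem expect_congr (h : ∀ S ⊆ F, f S = g S) : expect p F f = expect p F g :=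
  Finset.sum_congr rfl fun S hS => by rw [h S (Finset.mem_powerset.1 hS)]

theorem expect_mono (h0 : 0 ≤ p) (h1 : p ≤ 1) (h : ∀ S ⊆ F, f S ≤ g S) :
    expect p F f ≤ expect p F g :=
  Finset.sum_le_sum fun S hS =>
    mul_le_mul_of_nonneg_left (h S (Finset.mem_powerset.1 hS)) (weight_nonneg h0 h1 _ _)

theorem expect_nonneg (h0 : 0 ≤ p) (h1 : p ≤ 1) (h : ∀ S ⊆ F, 0 ≤ f S) : 0 ≤ expect p F f :=
  Finset.sum_nonneg fun S hS =>
    mul_nonneg (weight_nonneg h0 h1 _ _) (h S (Finset.mem_powerset.1 hS))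

theorem expect_const (c : ℝ) : expect p F (fun _ => c) = c := by
  induction F using Finset.induction_on with
  | empty => exact expect_empty
  | insert a F ha ih => rw [expect_insert ha, ih]; ring

theorem expect_add : expect p F (fun S => f S + g S) = expect p F f + expect p F g := by
  simp only [expect, mul_add, Finset.sum_add_distrib]

theorem expect_mul_left (c : ℝ) : expect p F (fun S => c * f S) = c * expect p F f := by
  simp only [expect, Finset.mul_sum]
  exact Finset.sum_congr rfl fun S _ => by ring

theorem expect_mul_right (c : ℝ) : expect p F (fun S => f S * c) = expect p F f * c := by
  simp only [expect, Finset.sum_mul, mul_assoc]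

theorem expect_sum {α : Type*} (s : Finset α) (f : α → Finset E → ℝ) :
    expect p F (fun S => ∑ a ∈ s, f a S) = ∑ a ∈ s, expect p F (f a) := by
  simp only [expect, Finset.mul_sum]
  exact Finset.sum_comm

theorem prob_nonneg (h0 : 0 ≤ p) (h1 : p ≤ 1) (A : Finset E → Prop) : 0 ≤ prob p F A :=
  expect_nonneg h0 h1 fun _ _ => ind_nonneg _

theorem prob_mono (h0 : 0 ≤ p) (h1 : p ≤ 1) {A B : Finset E → Prop}
    (h : ∀ S ⊆ F, A S → B S) : prob p F A ≤ prob p F B :=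
  expect_mono h0 h1 fun S hS => ind_mono (h S hS)

theorem prob_le_one (h0 : 0 ≤ p) (h1 : p ≤ 1) (A : Finset E → Prop) : prob p F A ≤ 1 :=
  (expect_mono h0 h1 fun _ _ => ind_le_one _).trans_eq (expect_const 1)

theorem prob_or_le (h0 : 0 ≤ p) (h1 : p ≤ 1) {A B : Finset E → Prop} :
    prob p F (fun S => A S ∨ B S) ≤ prob p F A + prob p F B :=
  (expect_mono h0 h1 fun _ _ => ind_or_le _ _).trans_eq expect_add

/-- Functions of disjoint sets of elements are independent. -/
theorem expect_mul_of_disjoint (O : Set E) (f g : Finset E → ℝ) :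
    expect p F (fun S => f (S.filter (· ∈ O)) * g (S.filter (· ∉ O))) =
      expect p F (fun S => f (S.filter (· ∈ O))) *
        expect p F (fun S => g (S.filter (· ∉ O))) := by
  induction F using Finset.induction_on generalizing f g with
  | empty => simp [expect_empty]
  | insert a F ha ih =>
    simp only [expect_insert ha, Finset.filter_insert]
    by_cases haO : a ∈ O
    · simp only [haO, if_true, not_true_eq_false, if_false]
      rw [ih f g, ih (fun S => f (insert a S)) g]
      ring
    · simp only [haO, if_false, not_false_eq_true, if_true]
      rw [ih f g, ih f (fun S => g (insert a S))]
      ring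

/-- The disjoint occurrence of a family of pairs of witnesses. -/
def DisjointlyOccur (H : Finset E → Finset E → Prop) (S : Finset E) : Prop :=
  ∃ S₁ ⊆ S, ∃ S₂ ⊆ S, Disjoint S₁ S₂ ∧ H S₁ S₂

/-- The van den Berg–Kesten inequality for increasing events, in its two-configuration form. -/
theorem prob_disjointlyOccur_le (h0 : 0 ≤ p) (h1 : p ≤ 1) (H : Finset E → Finset E → Prop)
    (hH : ∀ S S' T T', S ⊆ S' → T ⊆ T' → H S T → H S' T') :
    prob p F (DisjointlyOccur H) ≤ expect p F fun S => prob p F fun T => H S T := by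
  induction F using Finset.induction_on generalizing H with
  | empty =>
    simp only [prob, expect_empty]
    refine ind_mono ?_
    rintro ⟨S₁, hS₁, S₂, hS₂, -, h⟩
    exact hH _ _ _ _ hS₁ hS₂ h
  | insert a F ha ih =>
    have mono : ∀ {S T : Finset E}, S ⊆ T → insert a S ⊆ insert a T :=
      fun h => Finset.insert_subset_insert a h
    -- The single element `a` is replaced by two independent copies, one for each witness; the
    -- indices tell which copies are open. Since `H` is arbitrary, the induction hypothesis applies
    -- to the three modified relations as well.
    set H10 : Finset E → Finset E → Prop := fun X Y => H (insert a X) Y with hH10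
    set H01 : Finset E → Finset E → Prop := fun X Y => H X (insert a Y) with hH01
    set H11 : Finset E → Finset E → Prop := fun X Y => H (insert a X) (insert a Y) with hH11
    have m10 : ∀ S S' T T', S ⊆ S' → T ⊆ T' → H10 S T → H10 S' T' :=
      fun S S' T T' h h' => hH _ _ _ _ (mono h) h'
    have m01 : ∀ S S' T T', S ⊆ S' → T ⊆ T' → H01 S T → H01 S' T' :=
      fun S S' T T' h h' => hH _ _ _ _ h (mono h')
    have m11 : ∀ S S' T T', S ⊆ S' → T ⊆ T' → H11 S T → H11 S' T' :=
      fun S S' T T' h h' => hH _ _ _ _ (mono h) (mono h')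
    -- One copy of `a` on the left, two copies on the right, for a fixed state of the other
    -- elements. If `a` is useful to both witnesses, this reads p ≤ 2p(1 - p) + p²; if to one only,
    -- p ≤ p(1 - p) + p².
    have key : ∀ S : Finset E, (1 - p) * ind (DisjointlyOccur H S) +
        p * ind (DisjointlyOccur H (insert a S)) ≤
        (1 - p) ^ 2 * ind (DisjointlyOccur H S) +
        p * (1 - p) * (ind (DisjointlyOccur H10 S) + ind (DisjointlyOccur H01 S)) +
        p ^ 2 * ind (DisjointlyOccur H11 S) := by
      intro S
      have i1 : DisjointlyOccur H S → DisjointlyOccur H10 S := fun ⟨A, hA, B, hB, d, h⟩ =>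
        ⟨A, hA, B, hB, d, hH _ _ _ _ (Finset.subset_insert _ _) subset_rfl h⟩
      have i2 : DisjointlyOccur H S → DisjointlyOccur H01 S := fun ⟨A, hA, B, hB, d, h⟩ =>
        ⟨A, hA, B, hB, d, hH _ _ _ _ subset_rfl (Finset.subset_insert _ _) h⟩
      have i3 : DisjointlyOccur H10 S → DisjointlyOccur H11 S := fun ⟨A, hA, B, hB, d, h⟩ =>
        ⟨A, hA, B, hB, d, hH _ _ _ _ subset_rfl (Finset.subset_insert _ _) h⟩
      have i4 : DisjointlyOccur H01 S → DisjointlyOccur H11 S := fun ⟨A, hA, B, hB, d, h⟩ =>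
        ⟨A, hA, B, hB, d, hH _ _ _ _ (Finset.subset_insert _ _) subset_rfl h⟩
      -- At most one of two disjoint witnesses contains `a`.
      have i5 : DisjointlyOccur H (insert a S) →
          DisjointlyOccur H10 S ∨ DisjointlyOccur H01 S := by
        rintro ⟨A, hA, B, hB, d, h⟩
        have hA' : A.erase a ⊆ S := fun x hx =>
          (Finset.mem_insert.1 (hA (Finset.mem_of_mem_erase hx))).resolve_left
            (Finset.ne_of_mem_erase hx)
        have hB' : B.erase a ⊆ S := fun x hx =>
          (Finset.mem_insert.1 (hB (Finset.mem_of_mem_erase hx))).resolve_left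
            (Finset.ne_of_mem_erase hx)
        have d' : Disjoint (A.erase a) (B.erase a) :=
          d.mono (Finset.erase_subset _ _) (Finset.erase_subset _ _)
        by_cases haA : a ∈ A
        · have haB : a ∉ B := Finset.disjoint_left.1 d haA
          refine Or.inl ⟨_, hA', _, hB', d', hH _ _ _ _ ?_ ?_ h⟩
          · exact Finset.insert_erase_subset _ _
          · rw [Finset.erase_eq_of_notMem haB]
        · refine Or.inr ⟨_, hA', _, hB', d', hH _ _ _ _ ?_ ?_ h⟩
          · rw [Finset.erase_eq_of_notMem haA]
          · exact Finset.insert_erase_subset _ _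
      by_cases c00 : DisjointlyOccur H S
      · rw [ind_true c00, ind_true (i1 c00), ind_true (i2 c00), ind_true (i3 (i1 c00))]
        have := ind_le_one (DisjointlyOccur H (insert a S))
        nlinarith
      · rw [ind_false c00]
        by_cases c10 : DisjointlyOccur H10 S
        · rw [ind_true c10, ind_true (i3 c10)]
          have := ind_le_one (DisjointlyOccur H (insert a S))
          have := ind_nonneg (DisjointlyOccur H01 S)
          nlinarith [mul_nonneg (mul_nonneg h0 (sub_nonneg.2 h1)) this]
        · by_cases c01 : DisjointlyOccur H01 S
          · rw [ind_true c01, ind_true (i4 c01), ind_false c10]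
            have := ind_le_one (DisjointlyOccur H (insert a S))
            nlinarith
          · rw [ind_false c10, ind_false c01, ind_false fun h => (i5 h).elim c10 c01]
            have := ind_nonneg (DisjointlyOccur H11 S)
            nlinarith [mul_nonneg (sq_nonneg p) this]
    have lhs : prob p (insert a F) (DisjointlyOccur H) ≤
        (1 - p) ^ 2 * prob p F (DisjointlyOccur H) +
        p * (1 - p) * (prob p F (DisjointlyOccur H10) + prob p F (DisjointlyOccur H01)) +
        p ^ 2 * prob p F (DisjointlyOccur H11) := by
      rw [prob, expect_insert ha]
      simp only [prob]
      simp only [← expect_mul_left, ← expect_add]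
      exact expect_mono h0 h1 fun S _ => key S
    have q0 : 0 ≤ 1 - p := sub_nonneg.2 h1
    refine lhs.trans ?_
    have r00 := mul_le_mul_of_nonneg_left (ih H hH) (sq_nonneg (1 - p))
    have r10 := mul_le_mul_of_nonneg_left (ih H10 m10) (mul_nonneg h0 q0)
    have r01 := mul_le_mul_of_nonneg_left (ih H01 m01) (mul_nonneg h0 q0)
    have r11 := mul_le_mul_of_nonneg_left (ih H11 m11) (sq_nonneg p)
    have rhs : (expect p (insert a F) fun S => prob p (insert a F) fun T => H S T) =
        (1 - p) ^ 2 * (expect p F fun S => prob p F fun T => H S T) +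
        p * (1 - p) * ((expect p F fun S => prob p F fun T => H10 S T) +
          expect p F fun S => prob p F fun T => H01 S T) +
        p ^ 2 * expect p F fun S => prob p F fun T => H11 S T := by
      simp only [prob, expect_insert ha, expect_add, expect_mul_left]
      ring
    rw [rhs]
    linarith

/-- The van den Berg–Kesten inequality for two increasing events. -/
theorem prob_disjointlyOccur_and_le (h0 : 0 ≤ p) (h1 : p ≤ 1) {A B : Finset E → Prop}
    (hA : ∀ S S', S ⊆ S' → A S → A S') (hB : ∀ S S', S ⊆ S' → B S → B S') :
    prob p F (DisjointlyOccur fun S T => A S ∧ B T) ≤ prob p F A * prob p F B := by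
  refine (prob_disjointlyOccur_le h0 h1 _ fun S S' T T' h h' hAB =>
    ⟨hA _ _ h hAB.1, hB _ _ h' hAB.2⟩).trans_eq ?_
  simp only [prob, ind_and, expect_mul_left, expect_mul_right]

/-- A random set `R`, explored together with an event `G`, leaves the unexplored elements `O R`ᶜ
fresh. -/
theorem expect_explore {V : Type*} (G : Finset E → Prop) (R : Finset E → Finset V)
    (O : Finset V → Set E)
    (hG : ∀ S ⊆ F, ∀ S' ⊆ F, S.filter (· ∈ O (R S)) = S'.filter (· ∈ O (R S)) → G S →
      R S' = R S ∧ G S')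
    (h : Finset V → Finset E → ℝ) :
    expect p F (fun S => ind (G S) * h (R S) (S.filter (· ∉ O (R S)))) =
      expect p F fun S => ind (G S) *
        expect p F fun T => h (R S) (T.filter (· ∉ O (R S))) := by
  set 𝒜 : Finset (Finset V) := F.powerset.image R with h𝒜
  have idem : ∀ (A : Finset V) (S : Finset E),
      (S.filter (· ∈ O A)).filter (· ∈ O A) = S.filter (· ∈ O A) := by
    intro A S; ext e; simp
  -- By `hG`, the event that `A` is the explored set is decided by the elements of `O A` alone,
  -- hence is independent of the others. The proof sums over the values `A`.
  have loc : ∀ (A : Finset V) (S : Finset E), S ⊆ F →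
      ind (G S ∧ R S = A) = ind (G (S.filter (· ∈ O A)) ∧ R (S.filter (· ∈ O A)) = A) := by
    intro A S hSF
    have hSF' : S.filter (· ∈ O A) ⊆ F := (Finset.filter_subset _ _).trans hSF
    have : (G S ∧ R S = A) ↔ (G (S.filter (· ∈ O A)) ∧ R (S.filter (· ∈ O A)) = A) := by
      constructor
      · rintro ⟨hS, rfl⟩
        obtain ⟨h1, h2⟩ := hG S hSF (S.filter (· ∈ O (R S))) hSF' (idem _ _).symm hS
        exact ⟨h2, h1⟩
      · rintro ⟨hS, hR⟩
        have := hG (S.filter (· ∈ O A)) hSF' S hSF (by rw [hR, idem]) hS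
        exact ⟨this.2, this.1.trans hR⟩
    rw [this]
  have split : ∀ (k : Finset V → Finset E → ℝ) (S : Finset E), S ⊆ F →
      ind (G S) * k (R S) S = ∑ A ∈ 𝒜, ind (G S ∧ R S = A) * k A S := by
    intro k S hS
    rw [Finset.sum_eq_single (R S)]
    · simp
    · intro A _ hA
      rw [ind_false fun hh => hA hh.2.symm, zero_mul]
    · intro hn
      exact absurd (Finset.mem_image_of_mem R (Finset.mem_powerset.2 hS)) hn
  rw [expect_congr fun S hS => split (fun A S => h A (S.filter (· ∉ O A))) S hS,
    expect_congr fun S hS =>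
      split (fun A _ => expect p F fun T => h A (T.filter (· ∉ O A))) S hS,
    expect_sum, expect_sum]
  refine Finset.sum_congr rfl fun A _ => ?_
  rw [expect_mul_right]
  rw [expect_congr fun S hS => congrArg (· * h A (S.filter (· ∉ O A))) (loc A S hS),
    expect_congr (loc A)]
  exact expect_mul_of_disjoint (O A) (fun S => ind (G S ∧ R S = A)) (h A)

/-- Opening a set of elements costs a constant factor. -/
theorem expect_union_mul_pow {D : Finset E} (hD : D ⊆ F) (f : Finset E → ℝ) :
    p ^ D.card * expect p F (fun S => f (S ∪ D)) =
      expect p F fun S => ind (D ⊆ S) * f S := by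
  induction F using Finset.induction_on generalizing D f with
  | empty =>
    rw [Finset.subset_empty.1 hD]
    simp [expect_empty, ind_true]
  | insert a F ha ih =>
    rw [expect_insert ha, expect_insert ha]
    by_cases haD : a ∈ D
    · have hD' : D.erase a ⊆ F := fun x hx =>
        (Finset.mem_insert.1 (hD (Finset.mem_of_mem_erase hx))).resolve_left
          (Finset.ne_of_mem_erase hx)
      have e1 : (expect p F fun S => ind (D ⊆ S) * f S) = 0 := by
        rw [expect_congr (g := fun _ => 0), expect_const]
        intro S hS
        rw [ind_false fun h => ha (hS (h haD)), zero_mul]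
      have e2 : (fun S : Finset E => ind (D ⊆ insert a S) * f (insert a S)) =
          fun S => ind (D.erase a ⊆ S) * f (insert a S) := by
        funext S
        congr 2
        rw [Finset.subset_insert_iff]
      have e3 : (fun S : Finset E => f (S ∪ D)) = fun S => f (insert a (S ∪ D.erase a)) := by
        funext S
        congr 1
        ext x
        by_cases hx : x = a <;> simp [hx, haD]
      have e4 : (fun S : Finset E => f (insert a S ∪ D)) =
          fun S => f (insert a (S ∪ D.erase a)) := by
        funext S
        congr 1
        ext x
        by_cases hx : x = a <;> simp [hx]
      rw [e1, e2, e3, e4, ← ih hD' fun S => f (insert a S), ← Finset.card_erase_add_one haD]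
      ring
    · have hD' : D ⊆ F := fun x hx =>
        (Finset.mem_insert.1 (hD hx)).resolve_left fun h => haD (h ▸ hx)
      have e2 : (fun S : Finset E => ind (D ⊆ insert a S) * f (insert a S)) =
          fun S => ind (D ⊆ S) * f (insert a S) := by
        funext S
        congr 2
        rw [Finset.subset_insert_iff, Finset.erase_eq_of_notMem haD]
      rw [e2, ← ih hD' f, ← ih hD' fun S => f (insert a S)]
      simp only [Finset.insert_union]
      ring

end FiniteProbability

/-! ### Abstract percolation: reachability and the splitting of paths. -/

/-- A common frame for bond and site percolation: `link u e v` says that one steps from `u` to `v`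
through the random element `e`, and `root v` is the set of elements that have to be open for `v` to
belong to a cluster. -/
structure LinkSystem (V E : Type*) where
  link : V → E → V → Prop
  root : V → Set E
  -- A bond leads to either of its ends, a site only to itself.
  head_eq : ∀ {u e u' v v'}, link u e u' → link v e v' → v' = u ∨ v' = u'
  root_link : ∀ {x e u v}, e ∈ root x → link u e v → v = x
  -- One goes back through the same bond, or through the site that was left.
  reverse : ∀ {u e v}, link u e v → ∃ e', link v e' u ∧ (e' = e ∨ e' ∈ root u)
  root_head : ∀ {u e v}, link u e v → root v ⊆ {e}
  -- The first alternative holds for bonds, the second one for sites.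
  symm_or_unique : ∀ {u e v}, link u e v → link v e u ∨ ∀ a f, link a f v → f = e
  link_unique : ∀ {u e e' v}, link u e v → link u e' v → e = e'
  root_inj : ∀ {x y e}, e ∈ root x → e ∈ root y → x = y

namespace LinkSystem

variable {V E : Type*} (P : LinkSystem V E)

/-- One site can be reached from another one through elements of `S`. -/
def Reach (S : Set E) : V → V → Prop :=
  Relation.ReflTransGen fun u v => ∃ e ∈ S, P.link u e v

/-- Two sites lie in the same cluster of the configuration `S`. -/
def Conn (S : Set E) (x y : V) : Prop := P.root x ⊆ S ∧ P.Reach S x y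

/-- The elements that have to be inspected to see where one can step from `A`. -/
def out (A : Set V) : Set E := {e | ∃ a ∈ A, ∃ b, P.link a e b}

/-- The elements through which one can step within `B`. -/
def inner (B : Set V) : Set E := {e | ∃ u ∈ B, ∃ v ∈ B, P.link u e v}

/-- Two sites are equal, or one step away from each other. -/
def Near (a b : V) : Prop := b = a ∨ ∃ e, P.link a e b

variable {P} {S T : Set E} {u v w x y z : V}

theorem Reach.mono (h : S ⊆ T) (hr : P.Reach S x y) : P.Reach T x y :=
  Relation.ReflTransGen.mono (fun _ _ ⟨e, he, hl⟩ => ⟨e, h he, hl⟩) _ _ hr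

theorem Reach.refl (S : Set E) (x : V) : P.Reach S x x := Relation.ReflTransGen.refl

theorem Reach.trans (h : P.Reach S x y) (h' : P.Reach S y z) : P.Reach S x z :=
  Relation.ReflTransGen.trans h h'

theorem Reach.step {e : E} (h : P.Reach S x y) (he : e ∈ S) (hl : P.link y e z) :
    P.Reach S x z := Relation.ReflTransGen.tail h ⟨e, he, hl⟩

theorem Reach.single {e : E} (he : e ∈ S) (hl : P.link y e z) : P.Reach S y z :=
  (Reach.refl S y).step he hl

/-- The last step of a path. -/
theorem Reach.eq_or_last (h : P.Reach S x y) :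
    x = y ∨ ∃ u, P.Reach S x u ∧ ∃ e ∈ S, P.link u e y := by
  rcases Relation.ReflTransGen.cases_tail h with h | ⟨u, hu, e, he, hl⟩
  · exact Or.inl h.symm
  · exact Or.inr ⟨u, hu, e, he, hl⟩

/-- The first step of a path. -/
theorem Reach.eq_or_first (h : P.Reach S x y) :
    x = y ∨ ∃ u, ∃ e ∈ S, P.link x e u ∧ P.Reach S u y := by
  rcases Relation.ReflTransGen.cases_head h with h | ⟨u, ⟨e, he, hl⟩, hu⟩
  · exact Or.inl h
  · exact Or.inr ⟨u, e, he, hl, hu⟩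

/-- A set that is closed under open steps contains everything that can be reached from it. -/
theorem Reach.mem_of_closed {C : Set V} (hC : ∀ u ∈ C, ∀ e ∈ S, ∀ v, P.link u e v → v ∈ C)
    (hx : x ∈ C) (h : P.Reach S x y) : y ∈ C := by
  induction h with
  | refl => exact hx
  | tail _ hs ih => obtain ⟨e, he, hl⟩ := hs; exact hC _ ih e he _ hl

/-- The root of the starting point is not needed along a path. -/
theorem Reach.diff_root (h : P.Reach S x y) : P.Reach (S \ P.root x) x y := by
  induction h with
  | refl => exact Reach.refl _ _
  | @tail u v _ hs ih =>
    obtain ⟨e, he, hl⟩ := hs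
    by_cases hx : e ∈ P.root x
    · rw [P.root_link hx hl]; exact Reach.refl _ _
    · exact ih.step ⟨he, hx⟩ hl

/-- The last step of a path opens the root of its endpoint; only the empty path needs the
hypothesis. -/
theorem Reach.root_subset (h : P.Reach S x y) (hx : x = y → P.root x ⊆ S) : P.root y ⊆ S := by
  rcases h.eq_or_last with rfl | ⟨u, -, e, he, hl⟩
  · exact hx rfl
  · exact (P.root_head hl).trans (Set.singleton_subset_iff.2 he)

/-- Each step is undone through its own element or through the root of the site that it left. These
roots are open along the path, except perhaps at the start, which is why `hx` is assumed. -/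
theorem Reach.symm (h : P.Reach S x y) (hx : P.root x ⊆ S) : P.Reach S y x := by
  induction h with
  | refl => exact Reach.refl _ _
  | @tail u v hu hs ih =>
    obtain ⟨e, he, hl⟩ := hs
    obtain ⟨e', hl', h'⟩ := P.reverse hl
    have he' : e' ∈ S := by
      rcases h' with rfl | h'
      · exact he
      · exact Reach.root_subset hu (fun hxu => hxu ▸ hx) h'
    exact (Reach.single he' hl').trans ih

theorem Conn.symm (h : P.Conn S x y) : P.Conn S y x :=
  ⟨h.2.root_subset fun _ => h.1, h.2.symm h.1⟩

theorem Conn.trans (h : P.Conn S x y) (h' : P.Conn S y z) : P.Conn S x z :=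
  ⟨h.1, h.2.trans h'.2⟩

theorem Conn.mono (h : S ⊆ T) (hc : P.Conn S x y) : P.Conn T x y :=
  ⟨hc.1.trans h, hc.2.mono h⟩

/-- Reachability is witnessed by finitely many elements. -/
theorem Reach.exists_finite (h : P.Reach S x y) : ∃ F : Finset E, ↑F ⊆ S ∧ P.Reach ↑F x y := by
  induction h with
  | refl => exact ⟨∅, by simp, Reach.refl _ _⟩
  | @tail u v _ hs ih =>
    obtain ⟨e, he, hl⟩ := hs
    obtain ⟨F, hF, hr⟩ := ih
    refine ⟨insert e F, ?_, (hr.mono ?_).step (by simp) hl⟩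
    · rw [Finset.coe_insert]; exact Set.insert_subset he hF
    · rw [Finset.coe_insert]; exact Set.subset_insert _ _

/-- A path that needs the element `e` splits at `e` into two disjoint pieces. -/
theorem Reach.cut {e : E} (h : P.Reach T w z) {A : Set V}
    (hA : A = {v | P.Reach (T \ {e}) w v}) (hz : z ∉ A) :
    ∃ w₀ ∈ A, ∃ u' ∉ A, P.link w₀ e u' ∧
      P.Reach {f ∈ T | f ≠ e ∧ ∃ u ∉ A, ∃ v ∉ A, P.link u f v} u' z := by
  have main : ∀ v, P.Reach T w v → v ∈ A ∨ (v ∉ A ∧ ∃ w₀ ∈ A, ∃ u' ∉ A, P.link w₀ e u' ∧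
      P.Reach {f ∈ T | f ≠ e ∧ ∃ u ∉ A, ∃ v ∉ A, P.link u f v} u' v) := by
    intro v hv
    induction hv with
    | refl => left; rw [hA]; exact Reach.refl _ _
    | @tail v v' _ hs ih =>
      obtain ⟨f, hf, hl⟩ := hs
      by_cases hv' : v' ∈ A
      · exact Or.inl hv'
      refine Or.inr ⟨hv', ?_⟩
      rcases ih with hv | ⟨hv, w₀, hw₀, u', hu', hlu, hr⟩
      · by_cases hfe : f = e
        · exact ⟨v, hv, v', hv', hfe ▸ hl, Reach.refl _ _⟩
        · refine absurd ?_ hv'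
          rw [hA] at hv ⊢
          exact Reach.step hv ⟨hf, hfe⟩ hl
      -- The only possible heads of `e` are `w₀` and `u'`. When the path uses `e` again to reach a
      -- site off `A`, that site is `u'`, and the outer piece restarts there.
      · by_cases hfe : f = e
        · subst hfe
          rcases P.head_eq hlu hl with h1 | h1
          · exact absurd (h1 ▸ hw₀) hv'
          · exact ⟨w₀, hw₀, u', hu', hlu, h1 ▸ Reach.refl _ _⟩
        · exact ⟨w₀, hw₀, u', hu', hlu, hr.step ⟨hf, hfe, v, hv, v', hv', hl⟩ hl⟩
  rcases main z h with h | ⟨-, h⟩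
  · exact absurd h hz
  · exact h

theorem Reach.within {e : E} {A : Set V} (hA : A = {v | P.Reach (T \ {e}) w v}) (hv : v ∈ A) :
    P.Reach {f ∈ T | f ≠ e ∧ ∃ u ∈ A, ∃ v ∈ A, P.link u f v} w v := by
  have hv' : P.Reach (T \ {e}) w v := by rw [hA] at hv; exact hv
  induction hv' with
  | refl => exact Reach.refl _ _
  | @tail u v hu hs ih =>
    obtain ⟨f, hf, hl⟩ := hs
    have huA : u ∈ A := by rw [hA]; exact hu
    exact (ih huA).step ⟨hf.1, hf.2, u, huA, v, hv, hl⟩ hl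

/-- By `head_eq`, the head of any step through `f` is an end of every other step through `f`, so
steps inside `A` and steps off `A` never share an element. -/
theorem disjoint_within (P : LinkSystem V E) (A : Set V) :
    Disjoint {f : E | ∃ u ∈ A, ∃ v ∈ A, P.link u f v}
      {f : E | ∃ u ∉ A, ∃ v ∉ A, P.link u f v} := by
  rw [Set.disjoint_left]
  rintro f ⟨u, hu, v, hv, hl⟩ ⟨u', hu', v', hv', hl'⟩
  rcases P.head_eq hl hl' with h | h
  · exact hv' (h ▸ hu)
  · exact hv' (h ▸ hv)

variable [DecidableEq E]

/-- A tree of open paths from `x` to the sites `y i` has a first branch point `w`. -/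
theorem exists_branch {ι : Type*} [DecidableEq ι] (I : Finset ι) (hI : 1 < I.card) (y : ι → V)
    (S : Finset E) (h : ∀ i ∈ I, P.Reach ↑S x (y i)) :
    ∃ w, ∃ J ⊆ I, J.Nonempty ∧ J ≠ I ∧ ∃ S₀ ⊆ S, ∃ S₁ ⊆ S, Disjoint S₀ S₁ ∧ P.Reach ↑S₀ x w ∧
      DisjointlyOccur (fun A B => (∀ i ∈ J, P.Reach ↑A w (y i)) ∧
        ∀ i ∈ I \ J, P.Reach ↑B w (y i)) S₁ := by
  -- `S₀` is the trunk already walked from `x` to `w`; the elements of `T` are not yet spent and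
  -- still lead from `w` to all the targets. The induction consumes `T`.
  have main : ∀ n, ∀ (S₀ T : Finset E) (w : V), T.card = n → S₀ ⊆ S → T ⊆ S → Disjoint S₀ T →
      P.Reach ↑S₀ x w → (∀ i ∈ I, P.Reach ↑T w (y i)) →
      ∃ w, ∃ J ⊆ I, J.Nonempty ∧ J ≠ I ∧ ∃ S₀ ⊆ S, ∃ S₁ ⊆ S, Disjoint S₀ S₁ ∧ P.Reach ↑S₀ x w ∧
      DisjointlyOccur (fun A B => (∀ i ∈ J, P.Reach ↑A w (y i)) ∧
        ∀ i ∈ I \ J, P.Reach ↑B w (y i)) S₁ := by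
    intro n
    induction n using Nat.strong_induction_on with
    | _ n ih =>
      intro S₀ T w hn hS₀ hT hd hw hr
      by_cases hall : ∀ i ∈ I, y i = w
      · obtain ⟨i₀, hi₀⟩ : I.Nonempty := Finset.card_pos.1 (by omega)
        refine ⟨w, {i₀}, by simpa using hi₀, by simp, fun h => by simp [← h] at hI, S₀, hS₀, T, hT,
          hd, hw, ∅, by simp, ∅, by simp, by simp, ?_, ?_⟩
        · intro i hi
          rw [hall i (by simp only [Finset.mem_singleton] at hi; rw [hi]; exact hi₀)]
          exact Reach.refl _ _
        · intro i hi
          rw [hall i (Finset.mem_sdiff.1 hi).1]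
          exact Reach.refl _ _
      push Not at hall
      obtain ⟨i₀, hi₀, hy₀⟩ := hall
      obtain ⟨w₁, e, heT, hl, -⟩ := (hr i₀ hi₀).eq_or_first.resolve_left (Ne.symm hy₀)
      have heT' : e ∈ T := heT
      have hcard : (T.erase e).card < n := by rw [← hn]; exact Finset.card_erase_lt_of_mem heT'
      have hcoe : ((T.erase e : Finset E) : Set E) = ↑T \ {e} := by simp
      set A : Set V := {v | P.Reach (↑T \ {e}) w v} with hA
      -- The targets that cannot be reached from `w` without `e`. If there are none, `e` is
      -- discarded; if they are all of `I`, the trunk is extended across `e`; otherwise the tree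
      -- branches at `w`, and `cut` and `within` provide disjoint witnesses for the two groups.
      set J := I.filter fun i => y i ∉ A with hJ
      by_cases hJ0 : J = ∅
      · refine ih _ hcard S₀ (T.erase e) w rfl hS₀ ((Finset.erase_subset _ _).trans hT)
          (hd.mono_right (Finset.erase_subset _ _)) hw fun i hi => ?_
        have : i ∉ J := by rw [hJ0]; simp
        rw [hJ, Finset.mem_filter] at this
        push Not at this
        rw [hcoe]
        exact this hi
      have hcut : ∀ i ∈ J, w₁ ∉ A ∧
          P.Reach {f ∈ (T : Set E) | f ≠ e ∧ ∃ u ∉ A, ∃ v ∉ A, P.link u f v} w₁ (y i) := by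
        intro i hi
        rw [hJ, Finset.mem_filter] at hi
        obtain ⟨w₀, hw₀, u', hu', hlu, hru⟩ := (hr i hi.1).cut hA hi.2
        have : u' = w₁ := by
          rcases P.head_eq hl hlu with h | h
          · exact absurd (h ▸ (Reach.refl _ _ : P.Reach (↑T \ {e}) w w)) hu'
          · exact h
        exact this ▸ ⟨hu', hru⟩
      by_cases hJI : J = I
      · refine ih _ hcard (insert e S₀) (T.erase e) w₁ rfl ?_ ((Finset.erase_subset _ _).trans hT)
          ?_ ?_ fun i hi => ?_
        · exact Finset.insert_subset (hT heT') hS₀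
        · rw [Finset.disjoint_insert_left]
          exact ⟨by simp, hd.mono_right (Finset.erase_subset _ _)⟩
        · rw [Finset.coe_insert]
          exact (hw.mono (Set.subset_insert _ _)).step (Set.mem_insert _ _) hl
        · rw [hcoe]
          exact (hcut i (hJI ▸ hi)).2.mono fun f hf => ⟨hf.1, hf.2.1⟩
      refine ⟨w, J, Finset.filter_subset _ _, Finset.nonempty_iff_ne_empty.2 hJ0, hJI, S₀, hS₀, T,
        hT, hd, hw, insert e (T.filter fun f => f ≠ e ∧ ∃ u ∉ A, ∃ v ∉ A, P.link u f v),
        Finset.insert_subset heT' (Finset.filter_subset _ _),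
        T.filter fun f => f ≠ e ∧ ∃ u ∈ A, ∃ v ∈ A, P.link u f v, Finset.filter_subset _ _,
        ?_, ?_, ?_⟩
      · rw [Finset.disjoint_insert_left]
        refine ⟨by simp, ?_⟩
        rw [Finset.disjoint_left]
        intro f hf hf'
        exact Set.disjoint_left.1 (disjoint_within P A) (Finset.mem_filter.1 hf').2.2
          (Finset.mem_filter.1 hf).2.2
      · intro i hi
        refine (Reach.single (e := e) (by simp) hl).trans ((hcut i hi).2.mono ?_)
        intro f hf
        simp only [Finset.coe_insert, Finset.coe_filter]
        exact Set.mem_insert_of_mem _ hf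
      · intro i hi
        rw [Finset.mem_sdiff, hJ, Finset.mem_filter] at hi
        have hiA : y i ∈ A := by
          by_contra h
          exact hi.2 ⟨hi.1, h⟩
        refine (Reach.within hA hiA).mono ?_
        intro f hf
        simpa using hf
  exact main _ ∅ S x rfl (by simp) subset_rfl (by simp) (Reach.refl _ _) h

/-- A path that cannot avoid `O` splits into two disjoint pieces at the head of an element
of `O`. -/
theorem Reach.exists_split {O : Set E} (T : Finset E) (h : P.Reach ↑T w z)
    (hO : ¬P.Reach (↑T \ O) w z) :
    ∃ e ∈ O, ∃ u u', P.link u e u' ∧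
      DisjointlyOccur (fun A B => P.Reach ↑A w u' ∧ P.Reach ↑B u' z) T := by
  induction hn : T.card using Nat.strong_induction_on generalizing T with
  | _ n ih =>
    have : ∃ e ∈ T, e ∈ O := by
      by_contra hne
      push Not at hne
      exact hO (h.mono fun e he => ⟨he, hne e he⟩)
    obtain ⟨e, heT, heO⟩ := this
    have hcoe : ((T.erase e : Finset E) : Set E) = ↑T \ {e} := by simp
    -- Elements of `O` are removed as long as the connection survives; the first one that cannot be
    -- spared is where the path splits.
    by_cases hz : P.Reach (↑T \ {e}) w z
    · obtain ⟨e', he', u, u', hl, A, hA, B, hB, hd, hAB⟩ := ih _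
        (by rw [← hn]; exact Finset.card_erase_lt_of_mem heT) (T.erase e) (by rwa [hcoe])
        (fun hh => hO (hh.mono (Set.sdiff_subset_sdiff_left (by simp)))) rfl
      exact ⟨e', he', u, u', hl, A, hA.trans (Finset.erase_subset _ _), B,
        hB.trans (Finset.erase_subset _ _), hd, hAB⟩
    · set A : Set V := {v | P.Reach (↑T \ {e}) w v} with hA
      obtain ⟨w₀, hw₀, u', hu', hl, hr⟩ := h.cut hA hz
      refine ⟨e, heO, w₀, u', hl,
        insert e (T.filter fun f => f ≠ e ∧ ∃ u ∈ A, ∃ v ∈ A, P.link u f v),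
        Finset.insert_subset heT (Finset.filter_subset _ _),
        T.filter fun f => f ≠ e ∧ ∃ u ∉ A, ∃ v ∉ A, P.link u f v, Finset.filter_subset _ _,
        ?_, ?_, ?_⟩
      · rw [Finset.disjoint_insert_left]
        refine ⟨by simp, ?_⟩
        rw [Finset.disjoint_left]
        intro f hf hf'
        exact Set.disjoint_left.1 (disjoint_within P A) (Finset.mem_filter.1 hf).2.2
          (Finset.mem_filter.1 hf').2.2
      · refine ((Reach.within hA hw₀).mono ?_).step (e := e) (by simp) hl
        intro f hf
        simp only [Finset.coe_insert, Finset.coe_filter]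
        exact Set.mem_insert_of_mem _ hf
      · refine hr.mono fun f hf => ?_
        simpa using hf

end LinkSystem

/-! ### Finite systems: exploration of clusters, tree bounds, connections in different clusters. -/

namespace LinkSystem

variable {V E : Type*} (P : LinkSystem V E)

/-- The sites of `U` that can be reached from `W`. -/
def reachSet (U W : Finset V) (S : Finset E) : Finset V :=
  U.filter fun v => ∃ s ∈ W, P.Reach ↑S s v

/-- `U` contains all the sites to which one can step through `F`. -/
def Heads (F : Finset E) (U : Finset V) : Prop := ∀ u, ∀ e ∈ F, ∀ v, P.link u e v → v ∈ U

variable {P} {p : ℝ} {F : Finset E} {U W : Finset V} {u v w x y z : V}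

theorem Reach.mem_heads {S : Set E} (h : P.Reach S x y) (hS : S ⊆ ↑F) (hU : P.Heads F U)
    (hx : x ∈ U) : y ∈ U :=
  h.mem_of_closed (C := ↑U) (fun u _ e he v hl => hU u e (hS he) v hl) hx

theorem mem_reachSet {S : Finset E} :
    v ∈ P.reachSet U W S ↔ v ∈ U ∧ ∃ s ∈ W, P.Reach ↑S s v := by
  simp [reachSet]

theorem reachSet_closed {S : Finset E} (hS : S ⊆ F) (hU : P.Heads F U) :
    ∀ u ∈ (P.reachSet U W S : Set V), ∀ e ∈ (S : Set E), ∀ v, P.link u e v →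
      v ∈ (P.reachSet U W S : Set V) := by
  intro u hu e he v hl
  obtain ⟨-, s, hs, hr⟩ := mem_reachSet.1 (Finset.mem_coe.1 hu)
  exact mem_reachSet.2 ⟨hU u e (hS he) v hl, s, hs, hr.step he hl⟩

/-- Paths that start in a closed set `C` see only the elements of `out C`. -/
theorem Reach.transfer {S T : Set E} {C : Set V}
    (hC : ∀ u ∈ C, ∀ e ∈ S, ∀ v, P.link u e v → v ∈ C) (hx : x ∈ C)
    (hST : ∀ e ∈ S, e ∈ P.out C → e ∈ T) (h : P.Reach S x y) : P.Reach T x y := by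
  have : y ∈ C ∧ P.Reach T x y := by
    induction h with
    | refl => exact ⟨hx, Reach.refl _ _⟩
    | @tail u v _ hs ih =>
      obtain ⟨e, he, hl⟩ := hs
      exact ⟨hC u ih.1 e he v hl, ih.2.step (hST e he ⟨u, ih.1, v, hl⟩) hl⟩
  exact this.2

/-- Paths from `W` never leave the explored set and so see only the elements that lead out of its
sites. The set `O` is free because a second path is looked for off a cluster that was explored
before. -/
theorem reach_iff_of_agree {S T : Finset E} (hS : S ⊆ F) (hU : P.Heads F U) (hW : W ⊆ U)
    (hST : S.filter (· ∈ P.out ↑(P.reachSet U W S)) = T.filter (· ∈ P.out ↑(P.reachSet U W S)))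
    (O : Set E) {s : V} (hs : s ∈ W) (v : V) :
    P.Reach (↑S \ O) s v ↔ P.Reach (↑T \ O) s v := by
  have hsC : s ∈ (P.reachSet U W S : Set V) := mem_reachSet.2 ⟨hW hs, s, hs, Reach.refl _ _⟩
  have hcl := reachSet_closed (W := W) hS hU
  have mem : ∀ e, e ∈ P.out ↑(P.reachSet U W S) → (e ∈ S ↔ e ∈ T) := by
    intro e he
    have := Finset.ext_iff.1 hST e
    simpa [he] using this
  constructor
  · exact Reach.transfer (fun u hu e he v hl => hcl u hu e he.1 v hl) hsC
      fun e he ho => ⟨(mem e ho).1 he.1, he.2⟩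
  · refine Reach.transfer (C := ↑(P.reachSet U W S)) (fun u hu e he v hl => ?_) hsC
      fun e he ho => ⟨(mem e ho).2 he.1, he.2⟩
    exact hcl u hu e ((mem e ⟨u, hu, v, hl⟩).2 he.1) v hl

/-- The smaller set `W'` is there because the cluster of one starting point has to be recognised
again after the clusters of two of them have been explored. -/
theorem reachSet_eq_of_agree {S T : Finset E} (hS : S ⊆ F) (hU : P.Heads F U) (hW : W ⊆ U)
    (hST : S.filter (· ∈ P.out ↑(P.reachSet U W S)) = T.filter (· ∈ P.out ↑(P.reachSet U W S)))
    {W' : Finset V} (hW' : W' ⊆ W) : P.reachSet U W' T = P.reachSet U W' S := by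
  ext v
  rw [mem_reachSet, mem_reachSet]
  have := fun s (hs : s ∈ W') => reach_iff_of_agree hS hU hW hST ∅ (hW' hs) v
  simp only [Set.sdiff_empty] at this
  exact and_congr_right fun _ => exists_congr fun s => and_congr_right fun hs => (this s hs).symm

/-- A site reached by avoiding an explored set does not belong to it. -/
theorem Reach.notMem_reachSet {S : Finset E} (hS : S ⊆ F) (hU : P.Heads F U) (hW : W ⊆ U)
    (h : P.Reach (↑S \ P.out ↑(P.reachSet U W S)) w z) (hzw : w ≠ z) (hz : z ∉ W) :
    z ∉ P.reachSet U W S := by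
  intro hzC
  obtain ⟨-, s, hs, hr⟩ := mem_reachSet.1 hzC
  rcases hr.eq_or_last with rfl | ⟨u, hu, f, hf, hlf⟩
  · exact hz hs
  obtain ⟨a, -, e, he, hle⟩ := h.eq_or_last.resolve_left hzw
  have huC : u ∈ P.reachSet U W S := mem_reachSet.2 ⟨hu.mem_heads hS hU (hW hs), s, hs, hu⟩
  -- The last element `e` of the avoiding path would lead out of the explored set: a bond because it
  -- can be crossed back from `z`, a site because the cluster enters `z` through the same element.
  rcases P.symm_or_unique hle with hl | hl
  · exact he.2 ⟨z, hzC, a, hl⟩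
  · exact he.2 ⟨u, huC, z, hl _ _ hlf ▸ hlf⟩

variable [DecidableEq E]

variable (P) in
/-- The connection probability in the finite system `F`. -/
def tau (p : ℝ) (F : Finset E) (x y : V) : ℝ := prob p F fun S => P.Reach ↑S x y

theorem tau_nonneg (h0 : 0 ≤ p) (h1 : p ≤ 1) (x y : V) : 0 ≤ P.tau p F x y := prob_nonneg h0 h1 _

theorem tau_le_one (h0 : 0 ≤ p) (h1 : p ≤ 1) (x y : V) : P.tau p F x y ≤ 1 := prob_le_one h0 h1 _

/-- Tree decomposition of the probability that `x` is connected to several sites. -/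
theorem prob_reach_all_le (h0 : 0 ≤ p) (h1 : p ≤ 1) (hU : P.Heads F U) (hx : x ∈ U)
    {ι : Type*} [DecidableEq ι] (I : Finset ι) (hI : 1 < I.card) (y : ι → V) :
    prob p F (fun S => ∀ i ∈ I, P.Reach ↑S x (y i)) ≤
      ∑ w ∈ U, ∑ J ∈ I.powerset.filter fun J => J.Nonempty ∧ J ≠ I,
        P.tau p F x w * (prob p F (fun S => ∀ i ∈ J, P.Reach ↑S w (y i)) *
          prob p F (fun S => ∀ i ∈ I \ J, P.Reach ↑S w (y i))) := by
  set D : V → Finset ι → Finset E → Prop := fun w J => DisjointlyOccur fun A B =>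
    (∀ i ∈ J, P.Reach ↑A w (y i)) ∧ ∀ i ∈ I \ J, P.Reach ↑B w (y i) with hD
  have mono : ∀ (w : V) (J : Finset ι) (S S' : Finset E), S ⊆ S' →
      (∀ i ∈ J, P.Reach ↑S w (y i)) → ∀ i ∈ J, P.Reach ↑S' w (y i) :=
    fun w J S S' hS h i hi => (h i hi).mono (Finset.coe_subset.2 hS)
  have step1 : ∀ S ⊆ F, ind (∀ i ∈ I, P.Reach ↑S x (y i)) ≤
      ∑ w ∈ U, ∑ J ∈ I.powerset.filter fun J => J.Nonempty ∧ J ≠ I,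
        ind (DisjointlyOccur (fun A B => P.Reach ↑A x w ∧ D w J B) S) := by
    intro S hS
    refine ind_le_of_imp (Finset.sum_nonneg fun _ _ => Finset.sum_nonneg fun _ _ => ind_nonneg _) ?_
    intro h
    obtain ⟨w, J, hJI, hJ0, hJne, S₀, hS₀, S₁, hS₁, hd, hr, hdis⟩ := exists_branch I hI y S h
    have hw : w ∈ U := hr.mem_heads (Finset.coe_subset.2 (hS₀.trans hS)) hU hx
    calc (1 : ℝ) = ind (DisjointlyOccur (fun A B => P.Reach ↑A x w ∧ D w J B) S) :=
          (ind_true ⟨S₀, hS₀, S₁, hS₁, hd, hr, hdis⟩).symm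
      _ ≤ ∑ J ∈ I.powerset.filter fun J => J.Nonempty ∧ J ≠ I,
        ind (DisjointlyOccur (fun A B => P.Reach ↑A x w ∧ D w J B) S) :=
          Finset.single_le_sum
            (f := fun J => ind (DisjointlyOccur (fun A B => P.Reach ↑A x w ∧ D w J B) S))
            (fun _ _ => ind_nonneg _)
            (Finset.mem_filter.2 ⟨Finset.mem_powerset.2 hJI, hJ0, hJne⟩)
      _ ≤ _ := Finset.single_le_sum
            (f := fun w => ∑ J ∈ I.powerset.filter fun J => J.Nonempty ∧ J ≠ I,
              ind (DisjointlyOccur (fun A B => P.Reach ↑A x w ∧ D w J B) S))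
            (fun _ _ => Finset.sum_nonneg fun _ _ => ind_nonneg _) hw
  refine (expect_mono h0 h1 step1).trans ?_
  rw [expect_sum]
  refine Finset.sum_le_sum fun w _ => ?_
  rw [expect_sum]
  refine Finset.sum_le_sum fun J _ => ?_
  refine (prob_disjointlyOccur_and_le h0 h1 (A := fun S => P.Reach ↑S x w) (B := D w J)
    (fun S S' hS h => h.mono (Finset.coe_subset.2 hS)) ?_).trans ?_
  · rintro S S' hS ⟨A, hA, B, hB, h⟩
    exact ⟨A, hA.trans hS, B, hB.trans hS, h⟩
  · exact mul_le_mul_of_nonneg_left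
      (prob_disjointlyOccur_and_le h0 h1 (mono w J) (mono w (I \ J))) (tau_nonneg h0 h1 _ _)

/-- The tree decomposition with the two targets indexed by `Bool`; the factor 2 counts the two
proper nonempty sets of targets. -/
theorem prob_reach_two_le (h0 : 0 ≤ p) (h1 : p ≤ 1) (hU : P.Heads F U) (hx : x ∈ U) (a b : V) :
    prob p F (fun S => P.Reach ↑S x a ∧ P.Reach ↑S x b) ≤
      2 * ∑ w ∈ U, P.tau p F x w * P.tau p F w a * P.tau p F w b := by
  have h := prob_reach_all_le h0 h1 hU hx (Finset.univ : Finset Bool) (by simp)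
    (fun i => if i then a else b)
  have hf : (Finset.univ : Finset Bool).powerset.filter
      (fun J => J.Nonempty ∧ J ≠ Finset.univ) = {{true}, {false}} := by decide
  have hc1 : (Finset.univ : Finset Bool) \ {true} = {false} := by decide
  have hc2 : (Finset.univ : Finset Bool) \ {false} = {true} := by decide
  have hne : ({true} : Finset Bool) ≠ {false} := by decide
  have e1 : prob p F (fun S => P.Reach ↑S x a ∧ P.Reach ↑S x b) =
      prob p F (fun S => ∀ i ∈ (Finset.univ : Finset Bool),
        P.Reach ↑S x (if i then a else b)) := by
    congr 1; funext S; simp [and_comm]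
  rw [e1]
  refine h.trans (le_of_eq ?_)
  rw [Finset.mul_sum]
  refine Finset.sum_congr rfl fun w _ => ?_
  have : (Finset.univ : Finset Bool).powerset.filter
      (fun J => J.Nonempty ∧ J ≠ Finset.univ) = {{true}, {false}} := by
    convert hf
  rw [this, Finset.sum_pair hne, hc1, hc2]
  simp only [Finset.mem_singleton, forall_eq, if_true, Bool.false_eq_true, if_false, tau]
  ring

/-- Two sites that are connected are so off the set `A`, or else there is a connection in two
disjoint steps through a site next to `A`. -/
theorem tau_le_avoid_add (h0 : 0 ≤ p) (h1 : p ≤ 1) (hU : P.Heads F U) (hw : w ∈ U)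
    {A : Finset V} (hA : A ⊆ U) :
    P.tau p F w z ≤ prob p F (fun S => P.Reach (↑S \ P.out ↑A) w z) +
      ∑ v ∈ U, (∑ a ∈ U.filter fun a => P.Near a v, ind (a ∈ A)) *
        (P.tau p F w v * P.tau p F v z) := by
  have step : ∀ S ⊆ F, ind (P.Reach ↑S w z) ≤ ind (P.Reach (↑S \ P.out ↑A) w z) +
      ∑ v ∈ U, (∑ a ∈ U.filter fun a => P.Near a v, ind (a ∈ A)) *
        ind (DisjointlyOccur (fun X Y => P.Reach ↑X w v ∧ P.Reach ↑Y v z) S) := by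
    intro S hS
    have nn : ∀ v ∈ U, 0 ≤ (∑ a ∈ U.filter fun a => P.Near a v, ind (a ∈ A)) *
        ind (DisjointlyOccur (fun X Y => P.Reach ↑X w v ∧ P.Reach ↑Y v z) S) :=
      fun v _ => mul_nonneg (Finset.sum_nonneg fun _ _ => ind_nonneg _) (ind_nonneg _)
    refine ind_le_of_imp (add_nonneg (ind_nonneg _) (Finset.sum_nonneg nn)) fun h => ?_
    by_cases hav : P.Reach (↑S \ P.out ↑A) w z
    · rw [ind_true hav]
      linarith [Finset.sum_nonneg nn]
    · obtain ⟨e, ⟨a, ha, b, hab⟩, u, v, huv, hd⟩ := h.exists_split S hav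
      have hvU : v ∈ U := by
        obtain ⟨X, hX, -, -, -, hXr, -⟩ := hd
        exact hXr.mem_heads (Finset.coe_subset.2 (hX.trans hS)) hU hw
      have hnear : P.Near a v := by
        rcases P.head_eq hab huv with h | h
        · exact Or.inl h
        · exact Or.inr ⟨e, h ▸ hab⟩
      have h2 : (1 : ℝ) ≤ ∑ a ∈ U.filter fun a => P.Near a v, ind (a ∈ A) := by
        rw [← ind_true (P := a ∈ A) ha]
        exact Finset.single_le_sum (f := fun a => ind (a ∈ A)) (fun _ _ => ind_nonneg _)
          (Finset.mem_filter.2 ⟨hA ha, hnear⟩)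
      have h3 := Finset.single_le_sum nn hvU
      rw [ind_true hd, mul_one] at h3
      linarith [ind_nonneg (P.Reach (↑S \ P.out ↑A) w z)]
  refine (expect_mono h0 h1 step).trans ?_
  rw [expect_add, expect_sum]
  refine add_le_add le_rfl (Finset.sum_le_sum fun v _ => ?_)
  rw [expect_mul_left]
  refine mul_le_mul_of_nonneg_left ?_ (Finset.sum_nonneg fun _ _ => ind_nonneg _)
  exact prob_disjointlyOccur_and_le h0 h1 (fun S S' hS h => h.mono (Finset.coe_subset.2 hS))
    fun S S' hS h => h.mono (Finset.coe_subset.2 hS)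

/-- Exploring the clusters of `W`, then connecting `w` to `z` off these clusters. -/
theorem prob_mul_tau_le (h0 : 0 ≤ p) (h1 : p ≤ 1) (hU : P.Heads F U) (hw : w ∈ U)
    (G : Finset E → Prop)
    (hG : ∀ S ⊆ F, ∀ S' ⊆ F, S.filter (· ∈ P.out ↑(P.reachSet U W S)) =
      S'.filter (· ∈ P.out ↑(P.reachSet U W S)) → G S →
      P.reachSet U W S' = P.reachSet U W S ∧ G S') :
    prob p F G * P.tau p F w z ≤
      prob p F (fun S => G S ∧ P.Reach (↑S \ P.out ↑(P.reachSet U W S)) w z) +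
      ∑ v ∈ U, (∑ a ∈ U.filter fun a => P.Near a v,
        prob p F (fun S => G S ∧ ∃ s ∈ W, P.Reach ↑S s a)) *
        (P.tau p F w v * P.tau p F v z) := by
  have e1 : prob p F (fun S => G S ∧ P.Reach (↑S \ P.out ↑(P.reachSet U W S)) w z) =
      expect p F fun S => ind (G S) *
        prob p F fun T => P.Reach (↑T \ P.out ↑(P.reachSet U W S)) w z := by
    have := expect_explore (p := p) (F := F) G (P.reachSet U W) (fun A => P.out ↑A) hG
      (fun _ T => ind (P.Reach ↑T w z))
    simp only [Finset.coe_filter] at this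
    have hs : ∀ (A : Finset V) (T : Finset E),
        {e | e ∈ T ∧ e ∉ P.out (A : Set V)} = (↑T : Set E) \ P.out ↑A := by
      intro A T; ext e; simp
    simp only [hs] at this
    simp only [prob, ind_and]
    exact this
  have e2 : ∀ a, prob p F (fun S => G S ∧ ∃ s ∈ W, P.Reach ↑S s a) =
      expect p F fun S => ind (G S) * ind (∃ s ∈ W, P.Reach ↑S s a) := by
    intro a; simp only [prob, ind_and]
  rw [e1]
  simp only [e2, ← expect_sum, ← expect_mul_right]
  rw [← expect_add]
  rw [prob, ← expect_mul_right]
  refine expect_mono h0 h1 fun S hS => ?_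
  -- Given the explored set, the configuration off it is fresh, so the avoidance bound is applied to
  -- an independent copy with this set held fixed.
  have key := tau_le_avoid_add (z := z) h0 h1 hU hw (A := P.reachSet U W S)
    (Finset.filter_subset _ _)
  have := mul_le_mul_of_nonneg_left key (ind_nonneg (G S))
  refine this.trans (le_of_eq ?_)
  rw [mul_add, Finset.mul_sum]
  congr 1
  refine Finset.sum_congr rfl fun v _ => ?_
  rw [← mul_assoc, Finset.mul_sum]
  congr 1
  refine Finset.sum_congr rfl fun a ha => ?_
  congr 2
  exact propext ⟨fun h => (mem_reachSet.1 h).2,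
    fun h => mem_reachSet.2 ⟨(Finset.mem_filter.1 ha).1, h⟩⟩

variable (P) in
/-- The diagram that bounds the probability that the connections `w ↔ x` and `w' ↔ y` meet. -/
def meet (p : ℝ) (F : Finset E) (U : Finset V) (w x w' y : V) : ℝ :=
  ∑ v ∈ U, (∑ a ∈ U.filter fun a => P.Near a v,
    prob p F (fun S => P.Reach ↑S w x ∧ P.Reach ↑S w a)) * (P.tau p F w' v * P.tau p F v y)

/-- Three connections that lie in three different clusters. -/
theorem tau_mul_tau_mul_tau_le (h0 : 0 ≤ p) (h1 : p ≤ 1) (hU : P.Heads F U) {w₁ w₂ w₃ x y z : V}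
    (hw₁ : w₁ ∈ U) (hw₂ : w₂ ∈ U) (hw₃ : w₃ ∈ U)
    (hy₁ : w₁ ≠ y) (hy₂ : w₂ ≠ y) (hz₁ : w₁ ≠ z) (hz₂ : w₂ ≠ z) (hz₃ : w₃ ≠ z) :
    P.tau p F w₁ x * P.tau p F w₂ y * P.tau p F w₃ z ≤
      prob p F (fun S => (P.Reach ↑S w₁ x ∧ P.Reach ↑S w₂ y ∧ P.Reach ↑S w₃ z) ∧
        ¬P.Reach ↑S x y ∧ ¬P.Reach ↑S x z ∧ ¬P.Reach ↑S y z) +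
      (P.meet p F U w₁ x w₂ y * P.tau p F w₃ z + P.meet p F U w₁ x w₃ z * P.tau p F w₂ y +
        P.meet p F U w₂ y w₃ z * P.tau p F w₁ x) := by
  have hsub1 : ({w₁} : Finset V) ⊆ U := by simpa using hw₁
  have hsub2 : ({w₁, w₂} : Finset V) ⊆ U := by
    intro v hv
    simp only [Finset.mem_insert, Finset.mem_singleton] at hv
    rcases hv with rfl | rfl <;> assumption
  set R1 := P.reachSet U {w₁} with hR1
  set R2 := P.reachSet U {w₁, w₂} with hR2
  set G2 : Finset E → Prop := fun S => P.Reach ↑S w₁ x ∧ P.Reach (↑S \ P.out ↑(R1 S)) w₂ y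
    with hG2
  have first := prob_mul_tau_le (z := y) (W := {w₁}) h0 h1 hU hw₂ (fun S => P.Reach ↑S w₁ x)
    (by
      intro S hS S' hS' hag h
      refine ⟨reachSet_eq_of_agree hS hU hsub1 hag subset_rfl, ?_⟩
      have := (reach_iff_of_agree hS hU hsub1 hag ∅ (Finset.mem_singleton_self w₁) x)
      simp only [Set.sdiff_empty] at this
      exact this.1 h)
  simp only [Finset.mem_singleton, exists_eq_left] at first
  change P.tau p F w₁ x * P.tau p F w₂ y ≤ prob p F G2 + P.meet p F U w₁ x w₂ y at first
  have second := prob_mul_tau_le (z := z) (W := {w₁, w₂}) h0 h1 hU hw₃ G2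
    (by
      intro S hS S' hS' hag h
      have r1 : R1 S' = R1 S := reachSet_eq_of_agree hS hU hsub2 hag (by simp)
      refine ⟨reachSet_eq_of_agree hS hU hsub2 hag subset_rfl, ?_, ?_⟩
      · have := (reach_iff_of_agree hS hU hsub2 hag ∅ (s := w₁) (by simp) x)
        simp only [Set.sdiff_empty] at this
        exact this.1 h.1
      · rw [r1]
        exact (reach_iff_of_agree hS hU hsub2 hag _ (s := w₂) (by simp) y).1 h.2)
  have good : prob p F (fun S => G2 S ∧ P.Reach (↑S \ P.out ↑(R2 S)) w₃ z) ≤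
      prob p F (fun S => (P.Reach ↑S w₁ x ∧ P.Reach ↑S w₂ y ∧ P.Reach ↑S w₃ z) ∧
        ¬P.Reach ↑S x y ∧ ¬P.Reach ↑S x z ∧ ¬P.Reach ↑S y z) := by
    refine prob_mono h0 h1 fun S hS ⟨⟨hx, hy⟩, hz⟩ => ?_
    have hy' : P.Reach ↑S w₂ y := hy.mono Set.sdiff_subset
    have hz' : P.Reach ↑S w₃ z := hz.mono Set.sdiff_subset
    have ny : y ∉ R1 S := hy.notMem_reachSet hS hU hsub1 hy₂ (by simpa using hy₁.symm)
    have nz : z ∉ R2 S := hz.notMem_reachSet hS hU hsub2 hz₃ (by simp [hz₁.symm, hz₂.symm])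
    have mem : ∀ v, P.Reach ↑S w₁ v → v ∈ U := fun v hv => hv.mem_heads hS hU hw₁
    have mem2 : ∀ v, P.Reach ↑S w₂ v → v ∈ U := fun v hv => hv.mem_heads hS hU hw₂
    refine ⟨⟨hx, hy', hz'⟩, fun h => ny ?_, fun h => nz ?_, fun h => nz ?_⟩
    · exact mem_reachSet.2 ⟨mem _ (hx.trans h), w₁, by simp, hx.trans h⟩
    · exact mem_reachSet.2 ⟨mem _ (hx.trans h), w₁, by simp, hx.trans h⟩
    · exact mem_reachSet.2 ⟨mem2 _ (hy'.trans h), w₂, by simp, hy'.trans h⟩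
  have bad : ∀ a, prob p F (fun S => G2 S ∧ ∃ s ∈ ({w₁, w₂} : Finset V), P.Reach ↑S s a) ≤
      prob p F (fun S => P.Reach ↑S w₁ x ∧ P.Reach ↑S w₁ a) * P.tau p F w₂ y +
      P.tau p F w₁ x * prob p F (fun S => P.Reach ↑S w₂ y ∧ P.Reach ↑S w₂ a) := by
    intro a
    have m2 : ∀ (w x : V), ∀ S S' : Finset E, S ⊆ S' → P.Reach ↑S w x ∧ P.Reach ↑S w a →
        P.Reach ↑S' w x ∧ P.Reach ↑S' w a := fun w x S S' hS h =>
      ⟨h.1.mono (Finset.coe_subset.2 hS), h.2.mono (Finset.coe_subset.2 hS)⟩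
    have m1 : ∀ (w x : V), ∀ S S' : Finset E, S ⊆ S' → P.Reach ↑S w x →
        P.Reach ↑S' w x := fun w x S S' hS h => h.mono (Finset.coe_subset.2 hS)
    have b1 := prob_disjointlyOccur_and_le (F := F) h0 h1 (m2 w₁ x) (m1 w₂ y)
    have b2 := prob_disjointlyOccur_and_le (F := F) h0 h1 (m1 w₁ x) (m2 w₂ y)
    refine le_trans ?_ (add_le_add b1 b2)
    refine le_trans ?_ (prob_or_le h0 h1)
    refine prob_mono h0 h1 fun S hS ⟨⟨hx, hy⟩, s, hs, ha⟩ => ?_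
    set O := P.out ↑(R1 S) with hO
    have cin : ((S.filter (· ∈ O) : Finset E) : Set E) = ↑S ∩ O := by
      ext e; simp
    have cout : ((S.filter (· ∉ O) : Finset E) : Set E) = ↑S \ O := by
      ext e; simp
    have dj : Disjoint (S.filter (· ∈ O)) (S.filter (· ∉ O)) :=
      Finset.disjoint_filter_filter_not _ _ _
    have hw₁R : w₁ ∈ (R1 S : Set V) := mem_reachSet.2 ⟨hw₁, w₁, by simp, Reach.refl _ _⟩
    have hcl := reachSet_closed (W := {w₁}) hS hU
    have inside : ∀ v, P.Reach ↑S w₁ v → P.Reach (↑S ∩ O) w₁ v := fun v hv =>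
      Reach.transfer hcl hw₁R (fun e he ho => ⟨he, ho⟩) hv
    -- The elements that lead out of the first cluster carry its connections, the others carry those
    -- of `w₂`. Whichever cluster contains `a`, this is a disjoint occurrence, to which van den
    -- Berg–Kesten applies.
    by_cases haR : P.Reach ↑S w₁ a
    · refine Or.inl ⟨_, Finset.filter_subset _ _, _, Finset.filter_subset _ _, dj, ?_, ?_⟩
      · rw [cin]; exact ⟨inside _ hx, inside _ haR⟩
      · rw [cout]; exact hy
    · have hs2 : s = w₂ := by
        simp only [Finset.mem_insert, Finset.mem_singleton] at hs
        rcases hs with rfl | rfl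
        · exact absurd ha haR
        · rfl
      subst hs2
      refine Or.inr ⟨_, Finset.filter_subset _ _, _, Finset.filter_subset _ _, dj, ?_, ?_⟩
      · rw [cin]; exact inside _ hx
      · rw [cout]
        refine ⟨hy, ?_⟩
        -- A path from `w₂` to `a` that had to use an open element leading out of the first cluster
        -- would enter that cluster and never leave it, so `a` would belong to it.
        by_contra hn
        obtain ⟨e, ⟨⟨c, hc, b, hcb⟩, heS⟩, u, v, huv, X, hX, Y, hY, -, hXr, hYr⟩ :=
          ha.exists_split (O := O ∩ ↑S) S (by
            intro h; exact hn (h.mono fun e he => ⟨he.1, fun ho => he.2 ⟨ho, he.1⟩⟩))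
        have hb : b ∈ (R1 S : Set V) := hcl c hc e heS b hcb
        have hv : v ∈ (R1 S : Set V) := by
          rcases P.head_eq hcb huv with h | h
          · exact h ▸ hc
          · exact h ▸ hb
        have := (hYr.mono (Finset.coe_subset.2 hY)).mem_of_closed hcl hv
        obtain ⟨-, s', hs', hr'⟩ := mem_reachSet.1 (Finset.mem_coe.1 this)
        rw [Finset.mem_singleton] at hs'
        exact haR (hs' ▸ hr')
  have badsum : (∑ v ∈ U, (∑ a ∈ U.filter fun a => P.Near a v,
        prob p F (fun S => G2 S ∧ ∃ s ∈ ({w₁, w₂} : Finset V), P.Reach ↑S s a)) *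
        (P.tau p F w₃ v * P.tau p F v z)) ≤
      P.meet p F U w₁ x w₃ z * P.tau p F w₂ y + P.meet p F U w₂ y w₃ z * P.tau p F w₁ x := by
    rw [meet, meet, Finset.sum_mul, Finset.sum_mul, ← Finset.sum_add_distrib]
    refine Finset.sum_le_sum fun v _ => ?_
    have t0 : 0 ≤ P.tau p F w₃ v * P.tau p F v z :=
      mul_nonneg (tau_nonneg h0 h1 _ _) (tau_nonneg h0 h1 _ _)
    refine (mul_le_mul_of_nonneg_right (Finset.sum_le_sum fun a _ => bad a) t0).trans
      (le_of_eq ?_)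
    rw [Finset.sum_add_distrib, ← Finset.sum_mul, ← Finset.mul_sum]
    ring
  have t3 := tau_nonneg (P := P) (F := F) h0 h1 w₃ z
  have := mul_le_mul_of_nonneg_right first t3
  linarith [second, good, badsum]

end LinkSystem

/-! ### Branching balls: a cluster branches only once between three sites. -/

namespace LinkSystem

variable {V E : Type*} {P : LinkSystem V E} {S : Set E} {B B' : Set V} {u v w x y z : V}

/-- By `head_eq`, one step within `B` confines all the heads of its element to `B`. Hence disjoint
sets of sites have disjoint insides. -/
theorem head_mem_of_inner {e : E} (he : e ∈ P.inner B) (hl : P.link u e v) : v ∈ B := by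
  obtain ⟨a, ha, b, hb, hab⟩ := he
  rcases P.head_eq hab hl with h | h
  · exact h ▸ ha
  · exact h ▸ hb

theorem disjoint_inner (h : Disjoint B B') : Disjoint (P.inner B) (P.inner B') := by
  rw [Set.disjoint_left] at h ⊢
  rintro e he ⟨a, -, b, hb, hab⟩
  exact h (head_mem_of_inner he hab) hb

theorem root_subset_diff_inner (hx : x ∉ B) (h : P.root x ⊆ S) : P.root x ⊆ S \ P.inner B := by
  intro e he
  refine ⟨h he, ?_⟩
  rintro ⟨a, -, b, hb, hab⟩
  exact hx (P.root_link he hab ▸ hb)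

/-- When `y` cannot see `B'` without the elements inside `B`, a path from `y` either avoids `B`, or
reaches `B` without the elements inside `B'`. -/
theorem Reach.avoid_or_hit (hBB : Disjoint B B')
    (hy : ∀ b ∈ B', ¬P.Reach (S \ P.inner B) y b) (h : P.Reach S y v) :
    (P.Reach (S \ P.inner B) y v ∧ P.Reach (S \ P.inner B') y v) ∨
      ∃ b ∈ B, P.Reach (S \ P.inner B') y b := by
  induction h with
  | refl => exact Or.inl ⟨Reach.refl _ _, Reach.refl _ _⟩
  | @tail v v' _ hs ih =>
    obtain ⟨e, he, hl⟩ := hs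
    rcases ih with ⟨h1, h2⟩ | h
    · by_cases heB : e ∈ P.inner B
      · refine Or.inr ⟨v', head_mem_of_inner heB hl, h2.step ⟨he, ?_⟩ hl⟩
        exact Set.disjoint_left.1 (disjoint_inner hBB) heB
      · have h1' := h1.step ⟨he, heB⟩ hl
        refine Or.inl ⟨h1', h2.step ⟨he, fun heB' => ?_⟩ hl⟩
        exact hy v' (head_mem_of_inner heB' hl) h1'
    · exact Or.inr h

/-- Two sites that are joined only through `B`, and do not see `B'` without `B`, are still joined
when the inside of `B'` is closed. -/
theorem reach_diff_of_not_reach (hBB : Disjoint B B')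
    (hB : ∀ a ∈ B, ∀ b ∈ B, P.Reach (P.inner B) a b) (hBS : P.inner B ⊆ S)
    (hzB' : z ∉ B') (hc : P.Conn S y z)
    (hyz : ¬P.Reach (S \ P.inner B) y z) (hzy : ¬P.Reach (S \ P.inner B) z y)
    (hy : ∀ b ∈ B', ¬P.Reach (S \ P.inner B) y b)
    (hz : ∀ b ∈ B', ¬P.Reach (S \ P.inner B) z b) : P.Reach (S \ P.inner B') y z := by
  have hc' := hc.symm
  obtain ⟨b, hb, hyb⟩ := (hc.2.avoid_or_hit hBB hy).resolve_left fun h => hyz h.1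
  obtain ⟨b', hb', hzb⟩ := (hc'.2.avoid_or_hit hBB hz).resolve_left fun h => hzy h.1
  have hsub : P.inner B ⊆ S \ P.inner B' := fun e he =>
    ⟨hBS he, Set.disjoint_left.1 (disjoint_inner hBB) he⟩
  exact hyb.trans (((hB b hb b' hb').mono hsub).trans
    (hzb.symm (root_subset_diff_inner hzB' hc'.1)))

variable (P) in
/-- The inside of `B` is open, and the cluster that contains `x`, `y` and `z` falls into different
pieces when it is closed. -/
def Branching (B : Set V) (x y z : V) (S : Set E) : Prop :=
  P.inner B ⊆ S ∧ P.Conn S x y ∧ P.Conn S x z ∧ ¬P.Reach (S \ P.inner B) x y ∧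
    ¬P.Reach (S \ P.inner B) x z ∧ ¬P.Reach (S \ P.inner B) y z

/-- A cluster branches only once between three given sites. -/
theorem Branching.not_disjoint (hB : ∀ a ∈ B, ∀ b ∈ B, P.Reach (P.inner B) a b)
    (hB' : ∀ a ∈ B', ∀ b ∈ B', P.Reach (P.inner B') a b)
    (hx : x ∉ B) (hy : y ∉ B) (hz : z ∉ B) (hy' : y ∉ B') (hz' : z ∉ B')
    (h : P.Branching B x y z S) (h' : P.Branching B' x y z S) : ¬Disjoint B B' := by
  intro hBB
  obtain ⟨hBS, hxy, hxz, nxy, nxz, nyz⟩ := h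
  obtain ⟨hBS', -, -, nxy', nxz', nyz'⟩ := h'
  have ox := root_subset_diff_inner hx hxy.1
  have oy := root_subset_diff_inner hy hxy.symm.1
  have oz := root_subset_diff_inner hz hxz.symm.1
  have nyx : ¬P.Reach (S \ P.inner B) y x := fun h => nxy (h.symm oy)
  have nzx : ¬P.Reach (S \ P.inner B) z x := fun h => nxz (h.symm oz)
  have nzy : ¬P.Reach (S \ P.inner B) z y := fun h => nyz (h.symm oz)
  have hyz : P.Conn S y z := hxy.symm.trans hxz
  have hsub : P.inner B' ⊆ S \ P.inner B := fun e he =>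
    ⟨hBS' he, Set.disjoint_left.1 (disjoint_inner hBB.symm) he⟩
  have link : ∀ {s t : V}, P.root t ⊆ S \ P.inner B → (∃ b ∈ B', P.Reach (S \ P.inner B) s b) →
      (∃ b ∈ B', P.Reach (S \ P.inner B) t b) → P.Reach (S \ P.inner B) s t := by
    rintro s t ht ⟨b, hb, hsb⟩ ⟨b', hb', htb⟩
    exact hsb.trans (((hB' b hb b' hb').mono hsub).trans (htb.symm ht))
  -- If neither site of a pair saw `B'` without the inside of `B`, their connection would run
  -- through `B` and survive the closing of `B'`.
  have key : ∀ {s t : V}, t ∉ B' → P.Conn S s t → ¬P.Reach (S \ P.inner B) s t →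
      ¬P.Reach (S \ P.inner B) t s → ¬P.Reach (S \ P.inner B') s t →
      (∃ b ∈ B', P.Reach (S \ P.inner B) s b) ∨ ∃ b ∈ B', P.Reach (S \ P.inner B) t b := by
    intro s t ht hc n1 n2 n3
    by_contra hn
    push Not at hn
    exact n3 (reach_diff_of_not_reach hBB hB hBS ht hc n1 n2 hn.1 hn.2)
  -- Over the pairs, two of the three sites see `B'` without the inside of `B`. The inside of `B'`
  -- is open and joins them off `B`, which contradicts the branching at `B`.
  rcases key hy' hxy nxy nyx nxy' with h1 | h1
  · rcases key hz' hyz nyz nzy nyz' with h2 | h2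
    · exact nxy (link oy h1 h2)
    · exact nxz (link oz h1 h2)
  · rcases key hz' hxz nxz nzx nxz' with h2 | h2
    · exact nyx (link ox h1 h2)
    · exact nyz (link oz h1 h2)

variable [DecidableEq E] {p : ℝ} {F : Finset E}

/-- Opening the inside of `B` joins three different clusters that have sites in `B`. -/
theorem pow_mul_prob_separated_le (h0 : 0 ≤ p) (h1 : p ≤ 1) {D : Finset E}
    (hD : (D : Set E) = P.inner B) (hDF : D ⊆ F)
    (hB : ∀ a ∈ B, ∀ b ∈ B, P.Reach (P.inner B) a b) {w₁ w₂ w₃ : V}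
    (hw₁ : w₁ ∈ B) (hw₂ : w₂ ∈ B) (hw₃ : w₃ ∈ B) (h12 : w₁ ≠ w₂) :
    p ^ D.card * prob p F (fun S => (P.Reach ↑S w₁ x ∧ P.Reach ↑S w₂ y ∧ P.Reach ↑S w₃ z) ∧
        ¬P.Reach ↑S x y ∧ ¬P.Reach ↑S x z ∧ ¬P.Reach ↑S y z) ≤
      prob p F fun S => P.Branching B x y z ↑S := by
  have hb : ∀ S : Finset E, ((P.Reach ↑S w₁ x ∧ P.Reach ↑S w₂ y ∧ P.Reach ↑S w₃ z) ∧
        ¬P.Reach ↑S x y ∧ ¬P.Reach ↑S x z ∧ ¬P.Reach ↑S y z) →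
      P.Branching B x y z ↑(S ∪ D) := by
    rintro S ⟨⟨hx1, hy2, hz3⟩, nxy, nxz, nyz⟩
    -- Closing the inside of `B` again leaves only elements of `S`, where the three sites lie in
    -- different clusters.
    have hsub : (↑(S ∪ D) : Set E) \ P.inner B ⊆ ↑S := by
      rw [← hD, Finset.coe_union]
      rintro e ⟨he | he, hne⟩
      · exact he
      · exact absurd he hne
    have hDS : P.inner B ⊆ ↑(S ∪ D) := by rw [← hD]; simp
    have hSS : (S : Set E) ⊆ ↑(S ∪ D) := by simp
    -- As `w₂` is another site of `B`, some step inside `B` enters `w₁`, and its element is the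
    -- whole root of `w₁`.
    have hroot : P.root w₁ ⊆ ↑(S ∪ D) := by
      refine Set.Subset.trans ?_ hDS
      obtain ⟨u, hu, e, he, hl⟩ := (hB w₂ hw₂ w₁ hw₁).eq_or_last.resolve_left h12.symm
      exact (P.root_head hl).trans (Set.singleton_subset_iff.2 he)
    have cx : P.Conn ↑(S ∪ D) w₁ x := ⟨hroot, hx1.mono hSS⟩
    have cy : P.Conn ↑(S ∪ D) w₁ y :=
      ⟨hroot, ((hB _ hw₁ _ hw₂).mono hDS).trans (hy2.mono hSS)⟩
    have cz : P.Conn ↑(S ∪ D) w₁ z :=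
      ⟨hroot, ((hB _ hw₁ _ hw₃).mono hDS).trans (hz3.mono hSS)⟩
    exact ⟨hDS, cx.symm.trans cy, cx.symm.trans cz, fun h => nxy (h.mono hsub),
      fun h => nxz (h.mono hsub), fun h => nyz (h.mono hsub)⟩
  have hp := pow_nonneg h0 D.card
  refine (mul_le_mul_of_nonneg_left
    (prob_mono h0 h1 (B := fun S => P.Branching B x y z ↑(S ∪ D)) fun S _ h => hb S h) hp).trans ?_
  refine (expect_union_mul_pow hDF fun S => ind (P.Branching B x y z ↑S)).trans_le ?_
  refine expect_mono h0 h1 fun S _ => ?_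
  exact (mul_le_mul_of_nonneg_right (ind_le_one _) (ind_nonneg _)).trans_eq (one_mul _)

/-- The expected number of branch points is at most a constant times the probability of the
connection. -/
theorem sum_prob_branching_le (h0 : 0 ≤ p) (h1 : p ≤ 1) (B : V → Set V) (𝒲 : Finset V) (M : ℕ)
    (hB : ∀ w ∈ 𝒲, ∀ a ∈ B w, ∀ b ∈ B w, P.Reach (P.inner (B w)) a b)
    (hx : ∀ w ∈ 𝒲, x ∉ B w) (hy : ∀ w ∈ 𝒲, y ∉ B w) (hz : ∀ w ∈ 𝒲, z ∉ B w)
    (hM : ∀ w ∈ 𝒲, (𝒲.filter fun w' => ¬Disjoint (B w) (B w')).card ≤ M) :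
    ∑ w ∈ 𝒲, prob p F (fun S => P.Branching (B w) x y z ↑S) ≤
      M * prob p F fun S => P.Conn ↑S x y ∧ P.Conn ↑S x z := by
  simp only [prob]
  rw [← expect_sum, ← expect_mul_left]
  refine expect_mono h0 h1 fun S _ => ?_
  by_cases h : ∃ w ∈ 𝒲, P.Branching (B w) x y z ↑S
  · obtain ⟨w, hw, hbr⟩ := h
    rw [ind_true ⟨hbr.2.1, hbr.2.2.1⟩, mul_one]
    -- Once one ball branches, any other branching ball must meet it.
    have : ∀ w' ∈ 𝒲, ind (P.Branching (B w') x y z ↑S) ≤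
        if ¬Disjoint (B w) (B w') then 1 else 0 := by
      intro w' hw'
      refine ind_le_of_imp (by split_ifs <;> norm_num) fun hbr' => ?_
      rw [if_pos (hbr.not_disjoint (hB w hw) (hB w' hw') (hx w hw) (hy w hw) (hz w hw)
        (hy w' hw') (hz w' hw') hbr')]
    refine (Finset.sum_le_sum this).trans ?_
    rw [Finset.sum_ite, Finset.sum_const_zero, add_zero, Finset.sum_const, nsmul_eq_mul, mul_one]
    exact_mod_cast hM w hw
  · push Not at h
    rw [Finset.sum_congr rfl fun w hw => ind_false (h w hw), Finset.sum_const_zero]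
    exact mul_nonneg (Nat.cast_nonneg _) (ind_nonneg _)

end LinkSystem

/-! ### Sums of powers of the distance, from the growth of balls. -/

section Radial

/-- Bernoulli's inequality for (M/(M + 1))^a; a discrete derivative of r^{-a}. -/
theorem inv_pow_sub_le (a M : ℕ) (hM : 1 ≤ M) :
    ((M : ℝ) ^ a)⁻¹ ≤ (((M + 1 : ℕ) : ℝ) ^ a)⁻¹ + a * ((M : ℝ) ^ (a + 1))⁻¹ := by
  have hM0 : (0 : ℝ) < M := by exact_mod_cast hM
  have h := one_add_mul_le_pow (a := -(1 / ((M : ℝ) + 1))) (by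
    have : 1 / ((M : ℝ) + 1) ≤ 1 := by rw [div_le_one (by positivity)]; linarith
    linarith) a
  have e : 1 + -(1 / ((M : ℝ) + 1)) = M / (M + 1) := by field_simp; ring
  rw [e, div_pow] at h
  have h2 : 1 - (a : ℝ) / M ≤ (M : ℝ) ^ a / (M + 1) ^ a := by
    refine le_trans ?_ h
    have : (a : ℝ) * (1 / (M + 1)) ≤ a / M := by
      rw [mul_one_div]
      exact div_le_div_of_nonneg_left (Nat.cast_nonneg _) hM0 (by linarith)
    linarith
  have hp : (0 : ℝ) < (M : ℝ) ^ a := by positivity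
  push_cast
  have h3 := mul_le_mul_of_nonneg_left h2 (inv_nonneg.2 hp.le)
  have e1 : ((M : ℝ) ^ a)⁻¹ * ((M : ℝ) ^ a / (M + 1) ^ a) = (((M : ℝ) + 1) ^ a)⁻¹ := by
    field_simp
  have e2 : ((M : ℝ) ^ a)⁻¹ * (1 - a / M) = ((M : ℝ) ^ a)⁻¹ - a * ((M : ℝ) ^ (a + 1))⁻¹ := by
    rw [pow_succ]; field_simp
  rw [e1, e2] at h3
  linarith

theorem inv_pow_le_sum (a n M : ℕ) (hn : 1 ≤ n) (hM : n ≤ M) :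
    ((n : ℝ) ^ a)⁻¹ ≤ ((M : ℝ) ^ a)⁻¹ + a * ∑ r ∈ Finset.Ico n M, ((r : ℝ) ^ (a + 1))⁻¹ := by
  induction M, hM using Nat.le_induction with
  | base => simp
  | succ M hM ih =>
    rw [Finset.sum_Ico_succ_top hM]
    have := inv_pow_sub_le a M (hn.trans hM)
    linarith

theorem sum_inv_sq_le (R M : ℕ) (hR : 1 ≤ R) :
    ∑ r ∈ Finset.Ico (R + 1) M, ((r : ℝ) ^ 2)⁻¹ ≤ (R : ℝ)⁻¹ := by
  by_cases h : R + 1 ≤ M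
  · suffices ∑ r ∈ Finset.Ico (R + 1) M, ((r : ℝ) ^ 2)⁻¹ ≤ (R : ℝ)⁻¹ - ((M : ℝ) - 1)⁻¹ by
      have : (0 : ℝ) ≤ ((M : ℝ) - 1)⁻¹ := by
        have : (1 : ℝ) ≤ M := by exact_mod_cast (by omega : 1 ≤ M)
        exact inv_nonneg.2 (by linarith)
      linarith
    induction M, h using Nat.le_induction with
    | base => simp
    | succ M hM ih =>
      rw [Finset.sum_Ico_succ_top hM]
      have hM2 : (2 : ℝ) ≤ M := by exact_mod_cast (by omega : 2 ≤ M)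
      have : ((M : ℝ) ^ 2)⁻¹ ≤ ((M : ℝ) - 1)⁻¹ - (M : ℝ)⁻¹ := by
        have : ((M : ℝ) - 1)⁻¹ - (M : ℝ)⁻¹ = (((M : ℝ) - 1) * M)⁻¹ := by
          have : (M : ℝ) - 1 ≠ 0 := by linarith
          have : (M : ℝ) ≠ 0 := by linarith
          field_simp; ring
        rw [this]
        exact inv_anti₀ (by nlinarith) (by nlinarith)
      push_cast
      simp only [add_sub_cancel_right]
      linarith
  · rw [Finset.Ico_eq_empty_of_le (by omega), Finset.sum_empty]
    positivity

variable {α : Type*} (A : Finset α) (n : α → ℕ) (hn : ∀ v ∈ A, 1 ≤ n v) {K : ℝ} {s : ℕ}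
  (hK : ∀ r : ℕ, 1 ≤ r → ((A.filter fun v => n v ≤ r).card : ℝ) ≤ K * (r : ℝ) ^ s)

include hn hK

/-- Summation by parts: each power is a telescoping sum over radii, and after exchanging the sums
only the number of points in a ball is needed. -/
theorem sum_radial_exchange (a m R : ℕ) (hm : 1 ≤ m) :
    ∑ v ∈ A.filter (fun v => m ≤ n v ∧ n v ≤ R), ((n v : ℝ) ^ a)⁻¹ ≤
      (∑ _v ∈ A.filter (fun v => m ≤ n v ∧ n v ≤ R), ((R : ℝ) ^ a)⁻¹) +
      a * ∑ r ∈ Finset.Ico m R, ((r : ℝ) ^ (a + 1))⁻¹ * (K * (r : ℝ) ^ s) := by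
  have h1 : ∀ v ∈ A.filter (fun v => m ≤ n v ∧ n v ≤ R), ((n v : ℝ) ^ a)⁻¹ ≤
      ((R : ℝ) ^ a)⁻¹ +
        a * ∑ r ∈ Finset.Ico m R, if n v ≤ r then ((r : ℝ) ^ (a + 1))⁻¹ else 0 := by
    intro v hv
    obtain ⟨hvA, hv1, hv2⟩ := Finset.mem_filter.1 hv
    refine (inv_pow_le_sum a (n v) R (hn v hvA) hv2).trans ?_
    refine add_le_add le_rfl (mul_le_mul_of_nonneg_left ?_ (Nat.cast_nonneg _))
    rw [← Finset.sum_filter]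
    refine Finset.sum_le_sum_of_subset_of_nonneg ?_ fun _ _ _ => by positivity
    intro r hr
    simp only [Finset.mem_Ico, Finset.mem_filter] at hr ⊢
    exact ⟨⟨hv1.trans hr.1, hr.2⟩, hr.1⟩
  refine (Finset.sum_le_sum h1).trans ?_
  rw [Finset.sum_add_distrib, ← Finset.mul_sum, Finset.sum_comm]
  refine add_le_add le_rfl (mul_le_mul_of_nonneg_left ?_ (Nat.cast_nonneg _))
  refine Finset.sum_le_sum fun r hr => ?_
  rw [← Finset.sum_filter, Finset.sum_const, nsmul_eq_mul, mul_comm]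
  refine mul_le_mul_of_nonneg_left ?_ (by positivity)
  refine le_trans ?_ (hK r (hm.trans (Finset.mem_Ico.1 hr).1))
  exact_mod_cast Finset.card_le_card fun v hv => by
    simp only [Finset.mem_filter] at hv ⊢
    exact ⟨hv.1.1, hv.2⟩

/-- The exponent is below the growth rate, so the largest radius dominates: every radius contributes
at most K R^k. -/
theorem sum_radial_near (hK0 : 0 ≤ K) (a k R : ℕ) (hs : s = a + (k + 1)) (hR : 1 ≤ R) :
    ∑ v ∈ A.filter (fun v => n v ≤ R), ((n v : ℝ) ^ a)⁻¹ ≤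
      (1 + a) * K * (R : ℝ) ^ (k + 1) := by
  have hR0 : (0 : ℝ) < R := by exact_mod_cast hR
  have e : A.filter (fun v => n v ≤ R) = A.filter (fun v => 1 ≤ n v ∧ n v ≤ R) :=
    Finset.filter_congr fun v hv => by simp [hn v hv]
  rw [e]
  refine (sum_radial_exchange A n hn hK a 1 R le_rfl).trans ?_
  rw [← e, Finset.sum_const, nsmul_eq_mul]
  have h1 : ((A.filter fun v => n v ≤ R).card : ℝ) * ((R : ℝ) ^ a)⁻¹ ≤ K * (R : ℝ) ^ (k + 1) := by
    refine (mul_le_mul_of_nonneg_right (hK R hR) (by positivity)).trans_eq ?_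
    rw [hs, pow_add]; field_simp
  have h2 : ∑ r ∈ Finset.Ico 1 R, ((r : ℝ) ^ (a + 1))⁻¹ * (K * (r : ℝ) ^ s) ≤
      K * (R : ℝ) ^ (k + 1) := by
    have : ∀ r ∈ Finset.Ico 1 R, ((r : ℝ) ^ (a + 1))⁻¹ * (K * (r : ℝ) ^ s) ≤ K * (R : ℝ) ^ k := by
      intro r hr
      rw [Finset.mem_Ico] at hr
      have hr0 : (0 : ℝ) < r := by exact_mod_cast hr.1
      have : ((r : ℝ) ^ (a + 1))⁻¹ * (K * (r : ℝ) ^ s) = K * (r : ℝ) ^ k := by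
        rw [hs, show a + (k + 1) = (a + 1) + k by ring, pow_add _ (a + 1)]; field_simp
      rw [this]
      have : (r : ℝ) ≤ R := by exact_mod_cast hr.2.le
      gcongr
    refine (Finset.sum_le_sum this).trans ?_
    rw [Finset.sum_const, nsmul_eq_mul, Nat.card_Ico, pow_succ]
    have : ((R - 1 : ℕ) : ℝ) ≤ R := by exact_mod_cast Nat.sub_le _ _
    calc ((R - 1 : ℕ) : ℝ) * (K * (R : ℝ) ^ k) ≤ R * (K * (R : ℝ) ^ k) := by gcongr
      _ = _ := by ring
  have := mul_le_mul_of_nonneg_left h2 (Nat.cast_nonneg (α := ℝ) a)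
  linarith

theorem sum_radial_far (hK0 : 0 ≤ K) (b k R : ℕ) (hb : b = s + (k + 1)) (hR : 1 ≤ R) :
    ∑ v ∈ A.filter (fun v => R < n v), ((n v : ℝ) ^ b)⁻¹ ≤
      (1 + b) * K * ((R : ℝ) ^ (k + 1))⁻¹ := by
  have hR0 : (0 : ℝ) < R := by exact_mod_cast hR
  -- The set is finite, so the sum can be truncated at the largest radius that occurs; the bound
  -- does not depend on it.
  set M := max R (A.sup n) with hM
  have hRM : R ≤ M := le_max_left _ _
  have hM0 : (0 : ℝ) < M := by exact_mod_cast hR.trans hRM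
  have hRM' : (R : ℝ) ≤ M := by exact_mod_cast hRM
  have e : A.filter (fun v => R < n v) = A.filter (fun v => R + 1 ≤ n v ∧ n v ≤ M) :=
    Finset.filter_congr fun v hv => by
      have : n v ≤ M := (Finset.le_sup (f := n) hv).trans (le_max_right _ _)
      simp [this]
  rw [e]
  refine (sum_radial_exchange A n hn hK b (R + 1) M (by omega)).trans ?_
  rw [Finset.sum_const, nsmul_eq_mul]
  have h1 : ((A.filter fun v => R + 1 ≤ n v ∧ n v ≤ M).card : ℝ) * ((M : ℝ) ^ b)⁻¹ ≤
      K * ((R : ℝ) ^ (k + 1))⁻¹ := by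
    have hc : ((A.filter fun v => R + 1 ≤ n v ∧ n v ≤ M).card : ℝ) ≤ K * (M : ℝ) ^ s := by
      refine le_trans ?_ (hK M (hR.trans hRM))
      exact_mod_cast Finset.card_le_card fun v hv => by
        simp only [Finset.mem_filter] at hv ⊢
        exact ⟨hv.1, hv.2.2⟩
    refine (mul_le_mul_of_nonneg_right hc (by positivity)).trans ?_
    have : K * (M : ℝ) ^ s * ((M : ℝ) ^ b)⁻¹ = K * ((M : ℝ) ^ (k + 1))⁻¹ := by
      rw [hb, pow_add _ s]; field_simp
    rw [this]
    gcongr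
  have h2 : ∑ r ∈ Finset.Ico (R + 1) M, ((r : ℝ) ^ (b + 1))⁻¹ * (K * (r : ℝ) ^ s) ≤
      K * ((R : ℝ) ^ (k + 1))⁻¹ := by
    have : ∀ r ∈ Finset.Ico (R + 1) M, ((r : ℝ) ^ (b + 1))⁻¹ * (K * (r : ℝ) ^ s) ≤
        K * ((R : ℝ) ^ k)⁻¹ * ((r : ℝ) ^ 2)⁻¹ := by
      intro r hr
      rw [Finset.mem_Ico] at hr
      have hr0 : (0 : ℝ) < r := by exact_mod_cast (by omega : 0 < r)
      have : ((r : ℝ) ^ (b + 1))⁻¹ * (K * (r : ℝ) ^ s) = K * ((r : ℝ) ^ k)⁻¹ * ((r : ℝ) ^ 2)⁻¹ := by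
        rw [hb, show s + (k + 1) + 1 = s + k + 2 by ring, pow_add, pow_add]; field_simp
      rw [this]
      have : (R : ℝ) ≤ r := by exact_mod_cast (by omega : R ≤ r)
      gcongr
    refine (Finset.sum_le_sum this).trans ?_
    rw [← Finset.mul_sum, pow_succ, mul_inv]
    have := mul_le_mul_of_nonneg_left (sum_inv_sq_le R M hR)
      (mul_nonneg hK0 (inv_nonneg.2 (pow_nonneg hR0.le k)))
    linarith
  have := mul_le_mul_of_nonneg_left h2 (Nat.cast_nonneg (α := ℝ) b)
  linarith

end Radial

/-! ### Power kernels on the lattice: growth of sets and convolutions. -/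

section Kernel

variable {d : ℕ}

/-- The size of a lattice vector: one plus its maximum norm. -/
def size (v : Site d) : ℕ := (Finset.univ.sup fun i => (v i).natAbs) + 1

/-- The kernel `size v ^ (-a)`. -/
def ker (a : ℕ) (v : Site d) : ℝ := ((size v : ℝ) ^ a)⁻¹

theorem one_le_size (v : Site d) : 1 ≤ size v := Nat.le_add_left _ _

theorem size_pos (v : Site d) : (0 : ℝ) < size v := by exact_mod_cast one_le_size v

theorem ker_pos (a : ℕ) (v : Site d) : 0 < ker a v := inv_pos.2 (pow_pos (size_pos v) a)

theorem ker_nonneg (a : ℕ) (v : Site d) : 0 ≤ ker a v := (ker_pos a v).le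

theorem size_le_iff {v : Site d} {r : ℕ} : size v ≤ r + 1 ↔ ∀ i, (v i).natAbs ≤ r := by
  simp [size]

theorem natAbs_lt_size (v : Site d) (i : Fin d) : (v i).natAbs < size v :=
  Nat.lt_succ_of_le (Finset.le_sup (f := fun i => (v i).natAbs) (Finset.mem_univ i))

theorem size_neg (v : Site d) : size (-v) = size v := by simp [size]

theorem size_sub_comm (u v : Site d) : size (u - v) = size (v - u) := by
  rw [← size_neg, neg_sub]

theorem size_add_le (u v : Site d) : size (u + v) + 1 ≤ size u + size v := by
  have : size (u + v) ≤ (size u + size v - 2) + 1 := by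
    rw [size_le_iff]
    intro i
    have h1 := natAbs_lt_size u i
    have h2 := natAbs_lt_size v i
    have := Int.natAbs_add_le (u i) (v i)
    simp only [Pi.add_apply]
    omega
  have := one_le_size u
  have := one_le_size v
  omega

theorem size_sub_le (u v w : Site d) : size (u - w) + 1 ≤ size (u - v) + size (v - w) := by
  have := size_add_le (u - v) (v - w)
  rwa [sub_add_sub_cancel] at this

theorem ker_sub_comm (a : ℕ) (u v : Site d) : ker a (u - v) = ker a (v - u) := by
  rw [ker, ker, size_sub_comm]

theorem ker_le_of_size_le {a : ℕ} {u v : Site d} {c : ℕ} (h : size u ≤ c * size v) :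
    ker a v ≤ (c : ℝ) ^ a * ker a u := by
  have h' : (size u : ℝ) ≤ c * size v := by exact_mod_cast h
  have hu := size_pos u
  have hv := size_pos v
  unfold ker
  rw [← div_eq_mul_inv, le_div_iff₀ (by positivity), inv_mul_le_iff₀ (by positivity), ← mul_pow,
    mul_comm (size v : ℝ)]
  exact pow_le_pow_left₀ hu.le h' a

theorem ker_anti {a : ℕ} {v : Site d} {r : ℕ} (hr : 1 ≤ r) (h : r ≤ size v) :
    ker a v ≤ ((r : ℝ) ^ a)⁻¹ := by
  have h' : (r : ℝ) ≤ size v := by exact_mod_cast h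
  have : (0 : ℝ) < r := by exact_mod_cast hr
  unfold ker
  gcongr

theorem le_ker {a : ℕ} {v : Site d} {r : ℕ} (h : size v ≤ r) :
    ((r : ℝ) ^ a)⁻¹ ≤ ker a v := by
  have h' : (size v : ℝ) ≤ r := by exact_mod_cast h
  have := size_pos v
  unfold ker
  gcongr

/-- The number of sites of `A` in a ball of radius `r` is at most of order `r ^ s`. -/
def Growth (K : ℝ) (s : ℕ) (A : Finset (Site d)) : Prop :=
  ∀ (w : Site d) (r : ℕ), 1 ≤ r →
    ((A.filter fun v => size (v - w) ≤ r).card : ℝ) ≤ K * (r : ℝ) ^ s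

/-- Coordinates in `T` are frozen; each of the others takes at most 2r - 1 values in the ball. -/
theorem card_filter_size_le (A : Finset (Site d)) (w : Site d) (T : Finset (Fin d))
    (hT : ∀ i ∈ T, ∃ c, ∀ v ∈ A, v i = c) (r : ℕ) (hr : 1 ≤ r) :
    (A.filter fun v => size (v - w) ≤ r).card ≤ (2 * r) ^ (d - T.card) := by
  choose! c hc using hT
  set t : Fin d → Finset ℤ := fun i =>
    if i ∈ T then {c i} else Finset.Icc (w i - (r - 1 : ℕ)) (w i + (r - 1 : ℕ)) with ht
  have hsub : (A.filter fun v => size (v - w) ≤ r) ⊆ Fintype.piFinset t := by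
    intro v hv
    obtain ⟨hvA, hv⟩ := Finset.mem_filter.1 hv
    rw [Fintype.mem_piFinset]
    intro i
    by_cases hi : i ∈ T
    · simp [ht, hi, hc i hi v hvA]
    · simp only [ht, hi, if_false, Finset.mem_Icc]
      have := natAbs_lt_size (v - w) i
      simp only [Pi.sub_apply] at this
      omega
  refine (Finset.card_le_card hsub).trans ?_
  rw [Fintype.card_piFinset]
  have : ∀ i, (t i).card ≤ if i ∈ T then 1 else 2 * r := by
    intro i
    by_cases hi : i ∈ T
    · simp [ht, hi]
    · simp only [ht, hi, if_false, Int.card_Icc]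
      omega
  refine (Finset.prod_le_prod' fun i _ => this i).trans ?_
  rw [Finset.prod_ite, Finset.prod_const_one, one_mul, Finset.prod_const]
  have : (Finset.univ.filter fun i => i ∉ T) = Tᶜ := by ext; simp
  rw [this, Finset.card_compl, Fintype.card_fin]

theorem growth_all (A : Finset (Site d)) : Growth (2 ^ d) d A := by
  intro w r hr
  have := card_filter_size_le A w ∅ (by simp) r hr
  rw [Finset.card_empty, Nat.sub_zero, mul_pow] at this
  exact_mod_cast this

theorem growth_of_coord (A : Finset (Site d)) (i : Fin d) (c : ℤ) (hA : ∀ v ∈ A, v i = c) :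
    Growth (2 ^ (d - 1)) (d - 1) A := by
  intro w r hr
  have := card_filter_size_le A w {i} (by simpa using ⟨c, hA⟩) r hr
  rw [Finset.card_singleton, mul_pow] at this
  exact_mod_cast this

variable {K : ℝ} {s : ℕ} {A : Finset (Site d)}

theorem Growth.sum_near (h : Growth K s A) (hK : 0 ≤ K) (w : Site d) (a k R : ℕ)
    (hs : s = a + (k + 1)) (hR : 1 ≤ R) :
    ∑ v ∈ A.filter (fun v => size (v - w) ≤ R), ker a (v - w) ≤
      (1 + a) * K * (R : ℝ) ^ (k + 1) :=
  sum_radial_near A (fun v => size (v - w)) (fun _ _ => one_le_size _) (h w) hK a k R hs hR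

theorem Growth.sum_far (h : Growth K s A) (hK : 0 ≤ K) (w : Site d) (b k R : ℕ)
    (hb : b = s + (k + 1)) (hR : 1 ≤ R) :
    ∑ v ∈ A.filter (fun v => R < size (v - w)), ker b (v - w) ≤
      (1 + b) * K * ((R : ℝ) ^ (k + 1))⁻¹ :=
  sum_radial_far A (fun v => size (v - w)) (fun _ _ => one_le_size _) (h w) hK b k R hb hR

theorem ker_mul_ker (a b : ℕ) (v : Site d) : ker a v * ker b v = ker (a + b) v := by
  rw [ker, ker, ker, pow_add, mul_inv]

/-- The convolution of two kernels. -/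
theorem sum_ker_mul_ker_le (a b k l m : ℕ) (ha : d = a + (k + 1)) (hb : d = b + (l + 1))
    (hm : a + b = d + (m + 1)) :
    ∃ C : ℝ, 0 < C ∧ ∀ (A : Finset (Site d)) (w u : Site d),
      ∑ v ∈ A, ker a (w - v) * ker b (v - u) ≤ C * ker (m + 1) (w - u) := by
  refine ⟨2 ^ a * ((1 + b) * 2 ^ d * 2 ^ (l + 1)) + 2 ^ b * ((1 + a) * 2 ^ d * 3 ^ (k + 1)) +
    2 ^ a * ((1 + (a + b : ℕ)) * 2 ^ d), by positivity, fun A w u => ?_⟩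
  set r := size (w - u) with hr
  have hr1 : 1 ≤ r := one_le_size _
  have hr0 : (0 : ℝ) < r := by exact_mod_cast hr1
  have hG := growth_all A
  have hK : (0 : ℝ) ≤ 2 ^ d := by positivity
  rw [← Finset.sum_filter_add_sum_filter_not A (fun v => size (v - u) ≤ 2 * r)]
  have near : ∑ v ∈ A.filter (fun v => size (v - u) ≤ 2 * r), ker a (w - v) * ker b (v - u) ≤
      (2 ^ a * ((1 + b) * 2 ^ d * 2 ^ (l + 1)) + 2 ^ b * ((1 + a) * 2 ^ d * 3 ^ (k + 1))) *
        ker (m + 1) (w - u) := by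
    -- One of the two legs is at least half as long as w - u, so its kernel is exchanged for the one
    -- at w - u.
    have pt : ∀ v ∈ A.filter (fun v => size (v - u) ≤ 2 * r), ker a (w - v) * ker b (v - u) ≤
        2 ^ a * ker a (w - u) * ker b (v - u) + 2 ^ b * ker b (w - u) * ker a (v - w) := by
      intro v _
      have htri := size_sub_le w v u
      have ka := ker_nonneg a (v - w)
      have kb := ker_nonneg b (v - u)
      have ka' := ker_nonneg a (w - u)
      have kb' := ker_nonneg b (w - u)
      rcases le_or_gt (size (w - u)) (2 * size (w - v)) with h | h
      · have := ker_le_of_size_le (a := a) h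
        push_cast at this
        have h2 := mul_le_mul_of_nonneg_right this kb
        have : 0 ≤ 2 ^ b * ker b (w - u) * ker a (v - w) := by positivity
        linarith
      · have h' : size (w - u) ≤ 2 * size (v - u) := by omega
        have := ker_le_of_size_le (a := b) h'
        push_cast at this
        have h2 := mul_le_mul_of_nonneg_left this ka
        rw [ker_sub_comm a w v]
        have : 0 ≤ 2 ^ a * ker a (w - u) * ker b (v - u) := by positivity
        linarith
    refine (Finset.sum_le_sum pt).trans ?_
    rw [Finset.sum_add_distrib, ← Finset.mul_sum, ← Finset.mul_sum]
    have s1 := hG.sum_near hK u b l (2 * r) hb (by omega)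
    have s2 : ∑ v ∈ A.filter (fun v => size (v - u) ≤ 2 * r), ker a (v - w) ≤
        (1 + a) * 2 ^ d * ((3 * r : ℕ) : ℝ) ^ (k + 1) := by
      refine le_trans ?_ (hG.sum_near hK w a k (3 * r) ha (by omega))
      refine Finset.sum_le_sum_of_subset_of_nonneg ?_ fun _ _ _ => ker_nonneg _ _
      intro v hv
      simp only [Finset.mem_filter] at hv ⊢
      have := size_sub_le v u w
      rw [size_sub_comm u w] at this
      exact ⟨hv.1, by omega⟩
    have m1 := mul_le_mul_of_nonneg_left s1 (by have := ker_nonneg a (w - u); positivity :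
      0 ≤ 2 ^ a * ker a (w - u))
    have m2 := mul_le_mul_of_nonneg_left s2 (by have := ker_nonneg b (w - u); positivity :
      0 ≤ 2 ^ b * ker b (w - u))
    refine (add_le_add m1 m2).trans (le_of_eq ?_)
    have ea : a = (m + 1) + (l + 1) := by omega
    have eb : b = (m + 1) + (k + 1) := by omega
    have k1 : ker a (w - u) * (r : ℝ) ^ (l + 1) = ker (m + 1) (w - u) := by
      unfold ker; rw [← hr, ea, pow_add _ (m + 1)]; field_simp
    have k2 : ker b (w - u) * (r : ℝ) ^ (k + 1) = ker (m + 1) (w - u) := by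
      unfold ker; rw [← hr, eb, pow_add _ (m + 1)]; field_simp
    push_cast
    rw [mul_pow, mul_pow]
    linear_combination (2 ^ a * ((1 + b) * 2 ^ d * 2 ^ (l + 1)) : ℝ) * k1 +
      (2 ^ b * ((1 + a) * 2 ^ d * 3 ^ (k + 1)) : ℝ) * k2
  have far : ∑ v ∈ A.filter (fun v => ¬size (v - u) ≤ 2 * r), ker a (w - v) * ker b (v - u) ≤
      2 ^ a * ((1 + (a + b : ℕ)) * 2 ^ d) * ker (m + 1) (w - u) := by
    -- Far away both legs are comparable, and the product behaves like a single kernel of exponent a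
    -- + b > d.
    have pt : ∀ v ∈ A.filter (fun v => ¬size (v - u) ≤ 2 * r), ker a (w - v) * ker b (v - u) ≤
        2 ^ a * ker (a + b) (v - u) := by
      intro v hv
      obtain ⟨-, hv⟩ := Finset.mem_filter.1 hv
      have htri := size_sub_le v w u
      rw [size_sub_comm v w] at htri
      have h : size (v - u) ≤ 2 * size (w - v) := by omega
      have := ker_le_of_size_le (a := a) h
      push_cast at this
      rw [← ker_mul_ker, ← mul_assoc]
      exact mul_le_mul_of_nonneg_right this (ker_nonneg _ _)
    refine (Finset.sum_le_sum pt).trans ?_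
    rw [← Finset.mul_sum, mul_assoc]
    refine mul_le_mul_of_nonneg_left ?_ (by positivity)
    simp only [not_le]
    refine (hG.sum_far hK u (a + b) m (2 * r) hm (by omega)).trans ?_
    refine mul_le_mul_of_nonneg_left ?_ (by positivity)
    unfold ker
    rw [← hr]
    push_cast
    gcongr
    linarith
  rw [add_mul]
  exact add_le_add near far

/-- The capped kernel `min(1, (R / size v) ^ a)`. -/
def cap (a R : ℕ) (v : Site d) : ℝ := min 1 ((R : ℝ) ^ a * ker a v)

theorem cap_nonneg (a R : ℕ) (v : Site d) : 0 ≤ cap a R v :=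
  le_min zero_le_one (mul_nonneg (by positivity) (ker_nonneg _ _))

theorem cap_le_one (a R : ℕ) (v : Site d) : cap a R v ≤ 1 := min_le_left _ _

theorem cap_le (a R : ℕ) (v : Site d) : cap a R v ≤ (R : ℝ) ^ a * ker a v := min_le_right _ _

theorem cap_eq (a R : ℕ) (v : Site d) : cap a R v = min 1 (R / size v : ℝ) ^ a := by
  have hs := size_pos v
  rw [cap, ker, ← div_eq_mul_inv, ← div_pow]
  rcases le_total (1 : ℝ) (R / size v) with h | h
  · rw [min_eq_left h, one_pow, min_eq_left (one_le_pow₀ h)]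
  · rw [min_eq_right h, min_eq_right (pow_le_one₀ (by positivity) h)]

/-- Convolution with a capped kernel. -/
theorem sum_ker_mul_cap_le (a k : ℕ) (ha : d = a + 2) (hk : a + a = d + (k + 1)) :
    ∃ C : ℝ, 0 < C ∧ ∀ (A : Finset (Site d)) (w : Site d) (R : ℕ), 1 ≤ R →
      ∑ v ∈ A, ker a (w - v) * cap a R v ≤ C * (R : ℝ) ^ 2 := by
  refine ⟨(1 + a) * 2 ^ d + 2 ^ d + 2 * ((1 + (a + a : ℕ)) * 2 ^ d), by positivity,
    fun A w R hR => ?_⟩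
  have hR0 : (0 : ℝ) < R := by exact_mod_cast hR
  have hG := growth_all A
  have hK : (0 : ℝ) ≤ 2 ^ d := by positivity
  -- Within R of `w` the cap is bounded by one. Within R of the origin, but not of `w`, the kernel
  -- is at most R^{-a}. Elsewhere the product of the kernels is at most the sum of their squares,
  -- which is summable because 2a > d.
  have pt : ∀ v ∈ A, ker a (w - v) * cap a R v ≤
      (if size (v - w) ≤ R then ker a (v - w) else 0) +
      (if size (v - 0) ≤ R then ((R : ℝ) ^ a)⁻¹ else 0) +
      (R : ℝ) ^ a * ((if R < size (v - w) then ker (a + a) (v - w) else 0) +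
        (if R < size (v - 0) then ker (a + a) (v - 0) else 0)) := by
    intro v _
    rw [ker_sub_comm a w v]
    have k1 := ker_nonneg a (v - w)
    have k2 := ker_nonneg (a + a) (v - w)
    have k3 := ker_nonneg (a + a) (v - 0)
    have c0 := cap_nonneg a R v
    have c1 := cap_le_one a R v
    have r1 : (0 : ℝ) ≤ ((R : ℝ) ^ a)⁻¹ := by positivity
    have r2 : (0 : ℝ) ≤ (R : ℝ) ^ a := by positivity
    by_cases h1 : size (v - w) ≤ R
    · have : ker a (v - w) * cap a R v ≤ ker a (v - w) := mul_le_of_le_one_right k1 c1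
      rw [if_pos h1, if_neg (by omega : ¬R < size (v - w))]
      have : 0 ≤ (R : ℝ) ^ a * (0 + if R < size (v - 0) then ker (a + a) (v - 0) else 0) := by
        split_ifs <;> positivity
      have : 0 ≤ (if size (v - 0) ≤ R then ((R : ℝ) ^ a)⁻¹ else 0) := by
        split_ifs <;> positivity
      linarith
    · rw [if_neg h1, if_pos (by omega : R < size (v - w))]
      by_cases h2 : size (v - 0) ≤ R
      · rw [if_pos h2, if_neg (by omega : ¬R < size (v - 0))]
        have h3 : ker a (v - w) ≤ ((R : ℝ) ^ a)⁻¹ := ker_anti hR (by omega)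
        have : ker a (v - w) * cap a R v ≤ ker a (v - w) := mul_le_of_le_one_right k1 c1
        have := mul_nonneg r2 k2
        linarith
      · rw [if_neg h2, if_pos (by omega : R < size (v - 0))]
        have h3 := mul_le_mul_of_nonneg_left (cap_le a R v) k1
        rw [← ker_mul_ker, ← ker_mul_ker, sub_zero]
        have h4 := two_mul_le_add_sq (ker a (v - w)) (ker a v)
        have h5 := mul_nonneg k1 (ker_nonneg a v)
        have h6 : ker a (v - w) * ker a v ≤
            ker a (v - w) * ker a (v - w) + ker a v * ker a v := by nlinarith
        have := mul_le_mul_of_nonneg_left h6 r2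
        linarith
  refine (Finset.sum_le_sum pt).trans ?_
  rw [Finset.sum_add_distrib, Finset.sum_add_distrib, ← Finset.mul_sum, Finset.sum_add_distrib]
  simp only [← Finset.sum_filter]
  have s1 : ∑ v ∈ A.filter (fun v => size (v - w) ≤ R), ker a (v - w) ≤
      (1 + a) * 2 ^ d * (R : ℝ) ^ 2 := hG.sum_near hK w a 1 R ha hR
  have s2 : ∑ v ∈ A.filter (fun v => size (v - 0) ≤ R), ((R : ℝ) ^ a)⁻¹ ≤ 2 ^ d * (R : ℝ) ^ 2 := by
    rw [Finset.sum_const, nsmul_eq_mul]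
    refine (mul_le_mul_of_nonneg_right (hG 0 R hR) (by positivity)).trans_eq ?_
    rw [show ((R : ℝ) ^ d) = (R : ℝ) ^ (a + 2) by rw [← ha], pow_add]; field_simp
  have s3 := hG.sum_far hK w (a + a) k R hk hR
  have s4 := hG.sum_far hK 0 (a + a) k R hk hR
  have s5 := mul_le_mul_of_nonneg_left (add_le_add s3 s4) (by positivity : (0 : ℝ) ≤ (R : ℝ) ^ a)
  have e : (R : ℝ) ^ a * ((R : ℝ) ^ (k + 1))⁻¹ = (R : ℝ) ^ 2 := by
    have : a = (k + 1) + 2 := by omega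
    rw [this, pow_add _ (k + 1)]; field_simp
  have e2 : (R : ℝ) ^ a * ((1 + (a + a : ℕ)) * 2 ^ d * ((R : ℝ) ^ (k + 1))⁻¹ +
      (1 + (a + a : ℕ)) * 2 ^ d * ((R : ℝ) ^ (k + 1))⁻¹) =
      2 * ((1 + (a + a : ℕ)) * 2 ^ d) * (R : ℝ) ^ 2 := by
    rw [← e]; ring
  rw [e2] at s5
  linarith

/-- The potential of a set of radius `R` that grows like `r ^ s`. -/
theorem Growth.sum_ker_le (hK : 0 ≤ K) (a k : ℕ) (hs : s = a + (k + 1)) :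
    ∃ C : ℝ, 0 < C ∧ ∀ (A : Finset (Site d)), Growth K s A → ∀ (R : ℕ), 1 ≤ R →
      (∀ v ∈ A, size v ≤ R) → ∀ w, ∑ v ∈ A, ker a (w - v) ≤ C * (R : ℝ) ^ (k + 1) * cap a R w := by
  refine ⟨(1 + a) * K * 3 ^ (k + 1) * 2 ^ a + K * 2 ^ a + 1, by positivity,
    fun A hA R hR hsize w => ?_⟩
  have hR0 : (0 : ℝ) < R := by exact_mod_cast hR
  have c0 := cap_nonneg a R w
  have hpos : 0 ≤ (R : ℝ) ^ (k + 1) * cap a R w := by positivity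
  -- Nearby the cap is bounded below and the near sum suffices; far away all sites of the set are
  -- about as far from `w` as the origin is.
  by_cases h : size w ≤ 2 * R
  · have hc : 1 ≤ 2 ^ a * cap a R w := by
      rw [cap_eq, ← mul_pow]
      refine one_le_pow₀ ?_
      have hw := size_pos w
      have : (1 : ℝ) / 2 ≤ R / size w := by
        rw [div_le_div_iff₀ (by norm_num) hw]
        have : (size w : ℝ) ≤ 2 * R := by exact_mod_cast h
        linarith
      have := le_min (by norm_num : (1 : ℝ) / 2 ≤ 1) this
      linarith
    have e : ∑ v ∈ A, ker a (w - v) =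
        ∑ v ∈ A.filter (fun v => size (v - w) ≤ 3 * R), ker a (v - w) := by
      rw [Finset.filter_true_of_mem]
      · exact Finset.sum_congr rfl fun v _ => ker_sub_comm _ _ _
      · intro v hv
        have h1 := size_add_le v (-w)
        rw [← sub_eq_add_neg, size_neg] at h1
        have := hsize v hv
        omega
    rw [e]
    refine (hA.sum_near hK w a k (3 * R) hs (by omega)).trans ?_
    push_cast
    rw [mul_pow]
    have h1 : (1 + a) * K * (3 ^ (k + 1) * (R : ℝ) ^ (k + 1)) * 1 ≤
        (1 + a) * K * (3 ^ (k + 1) * (R : ℝ) ^ (k + 1)) * (2 ^ a * cap a R w) :=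
      mul_le_mul_of_nonneg_left hc (by positivity)
    have h2 : 0 ≤ (K * 2 ^ a + 1) * ((R : ℝ) ^ (k + 1) * cap a R w) := by positivity
    linarith
  · have hcap : cap a R w = (R : ℝ) ^ a * ker a w := by
      refine min_eq_right ?_
      rw [ker, ← div_eq_mul_inv, ← div_pow]
      refine pow_le_one₀ (by positivity) ?_
      rw [div_le_one (size_pos w)]
      exact_mod_cast (by omega : R ≤ size w)
    have pt : ∀ v ∈ A, ker a (w - v) ≤ 2 ^ a * ker a w := by
      intro v hv
      have h1 := size_add_le (w - v) v
      rw [sub_add_cancel] at h1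
      have := hsize v hv
      have := ker_le_of_size_le (a := a) (u := w) (v := w - v) (c := 2) (by omega)
      exact_mod_cast this
    refine (Finset.sum_le_sum pt).trans ?_
    rw [Finset.sum_const, nsmul_eq_mul]
    have hcard : (A.card : ℝ) ≤ K * (R : ℝ) ^ s := by
      have := hA 0 R hR
      rwa [Finset.filter_true_of_mem fun v hv => by rw [sub_zero]; exact hsize v hv] at this
    have kw := ker_nonneg a w
    refine (mul_le_mul_of_nonneg_right hcard (by positivity)).trans ?_
    rw [hcap, hs, pow_add _ a]
    have : 0 ≤ ((1 + a) * K * 3 ^ (k + 1) * 2 ^ a + 1) *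
      ((R : ℝ) ^ (k + 1) * ((R : ℝ) ^ a * ker a w)) := by positivity
    linarith

end Kernel

/-! ### Convolutions with capped kernels, for the exponents d - 2 = e + 4 and d - 4 = e + 2. -/

section CapSums

variable {d e : ℕ}

theorem cap_mul_cap_le {a b R : ℕ} (h : a ≤ b + b) (v : Site d) :
    cap b R v * cap b R v ≤ cap a R v := by
  rw [cap_eq, cap_eq, ← pow_add]
  exact pow_le_pow_of_le_one (le_min zero_le_one (by positivity)) (min_le_left _ _) h

theorem cap_mono_radius {a R R' : ℕ} (h : R ≤ R') (v : Site d) : cap a R v ≤ cap a R' v := by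
  have : (R : ℝ) ≤ R' := by exact_mod_cast h
  have := ker_nonneg a v
  unfold cap
  gcongr

theorem cap_anti_exponent {a b R : ℕ} (h : a ≤ b) (v : Site d) : cap b R v ≤ cap a R v := by
  rw [cap_eq, cap_eq]
  exact pow_le_pow_of_le_one (le_min zero_le_one (by positivity)) (min_le_left _ _) h

/-- One convolution with |·|^{2-d} lowers the decay of the capped kernel from d - 2 to d - 4. Where
the cap on the right equals one the uniform bound of order R² applies; elsewhere the cap under the
sum is dropped and the kernels are convolved. -/
theorem exists_sum_ker_mul_cap_le (hd : d = e + 6) :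
    ∃ C : ℝ, 0 < C ∧ ∀ (A : Finset (Site d)) (x : Site d) (R : ℕ), 1 ≤ R →
      ∑ w ∈ A, ker (e + 4) (x - w) * cap (e + 4) R w ≤ C * (R : ℝ) ^ 2 * cap (e + 2) R x := by
  obtain ⟨C₁, h1, H1⟩ := sum_ker_mul_ker_le (d := d) (e + 4) (e + 4) 1 1 (e + 1) (by omega)
    (by omega) (by omega)
  obtain ⟨C₂, h2, H2⟩ := sum_ker_mul_cap_le (d := d) (e + 4) (e + 1) (by omega) (by omega)
  refine ⟨C₁ + C₂, by positivity, fun A x R hR => ?_⟩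
  have hR0 : (0 : ℝ) ≤ (R : ℝ) ^ 2 := by positivity
  have k0 := ker_nonneg (e + 2) x
  rcases le_total (1 : ℝ) ((R : ℝ) ^ (e + 2) * ker (e + 2) x) with h | h
  · rw [cap, min_eq_left h]
    refine (H2 A x R hR).trans ?_
    nlinarith
  · rw [cap, min_eq_right h]
    have pt : ∀ w ∈ A, ker (e + 4) (x - w) * cap (e + 4) R w ≤
        (R : ℝ) ^ (e + 4) * (ker (e + 4) (x - w) * ker (e + 4) (w - 0)) := by
      intro w _
      rw [sub_zero]
      have := mul_le_mul_of_nonneg_left (cap_le (e + 4) R w) (ker_nonneg (e + 4) (x - w))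
      linarith
    refine (Finset.sum_le_sum pt).trans ?_
    rw [← Finset.mul_sum]
    refine (mul_le_mul_of_nonneg_left (H1 A x 0) (by positivity)).trans ?_
    rw [sub_zero, show e + 4 = 2 + (e + 2) by ring, pow_add]
    have : 0 ≤ C₂ * ((R : ℝ) ^ 2 * ((R : ℝ) ^ (e + 2) * ker (e + 2) x)) := by positivity
    have e1 : e + 1 + 1 = e + 2 := rfl
    rw [e1]
    linarith

/-- The cap of radius `L` contributes only decay of order two. This raises the exponent of the other
cap from e + 2 to e + 4 and costs the factor L². Where the cap on the right equals one, the radius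
`R` is simply enlarged to `L`. -/
theorem exists_sum_ker_mul_cap_mul_cap_le (he : 1 ≤ e) (hd : d = e + 6) :
    ∃ C : ℝ, 0 < C ∧ ∀ (A : Finset (Site d)) (x : Site d) (R L : ℕ), 1 ≤ R → R ≤ L →
      ∑ w ∈ A, ker (e + 4) (x - w) * (cap (e + 2) R w * cap (e + 2) L w) ≤
        C * (L : ℝ) ^ 2 * cap (e + 2) R x := by
  obtain ⟨C₁, h1, H1⟩ := sum_ker_mul_ker_le (d := d) (e + 4) (e + 4) 1 1 (e + 1) (by omega)
    (by omega) (by omega)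
  obtain ⟨C₂, h2, H2⟩ := sum_ker_mul_cap_le (d := d) (e + 4) (e + 1) (by omega) (by omega)
  refine ⟨C₁ + C₂, by positivity, fun A x R L hR hRL => ?_⟩
  have hL0 : (0 : ℝ) ≤ (L : ℝ) ^ 2 := by positivity
  have k0 := ker_nonneg (e + 2) x
  rcases le_total (1 : ℝ) ((R : ℝ) ^ (e + 2) * ker (e + 2) x) with h | h
  · rw [cap, min_eq_left h]
    refine le_trans (Finset.sum_le_sum fun w _ => ?_) ((H2 A x L (hR.trans hRL)).trans ?_)
    · refine mul_le_mul_of_nonneg_left ?_ (ker_nonneg _ _)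
      exact (mul_le_mul_of_nonneg_right (cap_mono_radius hRL w) (cap_nonneg _ _ _)).trans
        (cap_mul_cap_le (by omega) w)
    · nlinarith
  · rw [cap, min_eq_right h]
    have pt : ∀ w ∈ A, ker (e + 4) (x - w) * (cap (e + 2) R w * cap (e + 2) L w) ≤
        (R : ℝ) ^ (e + 2) * (L : ℝ) ^ 2 * (ker (e + 4) (x - w) * ker (e + 4) (w - 0)) := by
      intro w _
      rw [sub_zero]
      have c1 := cap_le (e + 2) R w
      have c2 := (cap_anti_exponent (show 2 ≤ e + 2 by omega) w).trans (cap_le 2 L w)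
      have := mul_le_mul c1 c2 (cap_nonneg _ _ _)
        (mul_nonneg (by positivity) (ker_nonneg (e + 2) w))
      have h3 := mul_le_mul_of_nonneg_left this (ker_nonneg (e + 4) (x - w))
      have h4 := ker_mul_ker (e + 2) 2 w
      rw [show e + 2 + 2 = e + 4 by ring] at h4
      rw [← h4]
      linarith
    refine (Finset.sum_le_sum pt).trans ?_
    rw [← Finset.mul_sum]
    refine (mul_le_mul_of_nonneg_left (H1 A x 0) (by positivity)).trans ?_
    rw [sub_zero]
    have : 0 ≤ C₂ * ((L : ℝ) ^ 2 * ((R : ℝ) ^ (e + 2) * ker (e + 2) x)) := by positivity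
    have e1 : e + 1 + 1 = e + 2 := rfl
    rw [e1]
    linarith

end CapSums

/-! ### Joint moments of cluster sizes: the tree recursion and its solution. -/

theorem prod_sum_eq {ι V : Type*} [Fintype ι] [DecidableEq ι] (v₀ : V) (I : Finset ι)
    (t : ι → Finset V) (f : ι → V → ℝ) :
    ∏ i ∈ I, ∑ y ∈ t i, f i y =
      ∑ y ∈ Fintype.piFinset (fun i => if i ∈ I then t i else {v₀}), ∏ i ∈ I, f i (y i) := by
  have h1 : ∏ i ∈ I, ∑ y ∈ t i, f i y =
      ∏ i, ∑ y ∈ (if i ∈ I then t i else {v₀}), if i ∈ I then f i y else 1 := by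
    rw [← Finset.prod_subset (Finset.subset_univ I)]
    · refine Finset.prod_congr rfl fun i hi => by simp [hi]
    · intro i _ hi
      simp [hi]
  rw [h1, Finset.prod_univ_sum]
  refine Finset.sum_congr rfl fun y _ => ?_
  rw [← Finset.prod_subset (Finset.subset_univ I)]
  · refine Finset.prod_congr rfl fun i hi => by simp [hi]
  · intro i _ hi
    simp [hi]

theorem ind_forall_eq_prod {ι : Type*} [DecidableEq ι] (I : Finset ι) (A : ι → Prop) :
    ind (∀ i ∈ I, A i) = ∏ i ∈ I, ind (A i) := by
  induction I using Finset.induction_on with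
  | empty => simp [ind]
  | insert i I hi ih =>
    rw [Finset.prod_insert hi, ← ih, ← ind_and]
    simp only [Finset.forall_mem_insert]

namespace LinkSystem

variable {V E : Type*} [DecidableEq E] {P : LinkSystem V E} {p : ℝ} {F : Finset E} {U : Finset V}

variable (P) in
/-- The joint moment of the numbers of sites in the sets `t i`, `i ∈ I`, that can be reached
from `x`. -/
def moment {ι : Type*} (p : ℝ) (F : Finset E) (t : ι → Finset V) (x : V) (I : Finset ι) : ℝ :=
  expect p F fun S => ∏ i ∈ I, ∑ y ∈ t i, ind (P.Reach ↑S x y)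

theorem moment_nonneg {ι : Type*} (h0 : 0 ≤ p) (h1 : p ≤ 1) (t : ι → Finset V) (x : V)
    (I : Finset ι) : 0 ≤ P.moment p F t x I :=
  expect_nonneg h0 h1 fun _ _ => Finset.prod_nonneg fun _ _ =>
    Finset.sum_nonneg fun _ _ => ind_nonneg _

theorem moment_singleton {ι : Type*} (t : ι → Finset V) (x : V) (i : ι) :
    P.moment p F t x {i} = ∑ y ∈ t i, P.tau p F x y := by
  simp only [moment, Finset.prod_singleton, expect_sum]
  rfl

/-- The recursion for the moments that comes from the tree decomposition. -/
theorem moment_le {ι : Type*} [Fintype ι] [DecidableEq ι] (h0 : 0 ≤ p) (h1 : p ≤ 1)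
    (hU : P.Heads F U) (t : ι → Finset V) {x : V} (hx : x ∈ U) (I : Finset ι) (hI : 1 < I.card) :
    P.moment p F t x I ≤ ∑ w ∈ U, ∑ J ∈ I.powerset.filter fun J => J.Nonempty ∧ J ≠ I,
      P.tau p F x w * (P.moment p F t w J * P.moment p F t w (I \ J)) := by
  set Y := Fintype.piFinset (fun i => if i ∈ I then t i else {x}) with hY
  have e1 : P.moment p F t x I =
      ∑ y ∈ Y, prob p F (fun S => ∀ i ∈ I, P.Reach ↑S x (y i)) := by
    simp only [moment, prob, prod_sum_eq x, ind_forall_eq_prod]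
    rw [expect_sum]
  -- The product of two moments is an expectation over two independent configurations, `S` for the
  -- targets in `J` and `T` for the others; then the product of sums over sites can be expanded as
  -- for a single moment.
  have e2 : ∀ w, ∀ J ⊆ I, P.moment p F t w J * P.moment p F t w (I \ J) =
      ∑ y ∈ Y, prob p F (fun S => ∀ i ∈ J, P.Reach ↑S w (y i)) *
        prob p F (fun S => ∀ i ∈ I \ J, P.Reach ↑S w (y i)) := by
    intro w J hJ
    have l : P.moment p F t w J * P.moment p F t w (I \ J) = expect p F fun S => expect p F fun T =>
        ∏ i ∈ I, ∑ y ∈ t i, if i ∈ J then ind (P.Reach ↑S w y) else ind (P.Reach ↑T w y) := by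
      simp only [moment]
      rw [← expect_mul_right]
      refine congrArg _ (funext fun S => ?_)
      rw [← expect_mul_left]
      refine congrArg _ (funext fun T => ?_)
      rw [← Finset.prod_sdiff hJ, mul_comm]
      congr 1
      · refine Finset.prod_congr rfl fun i hi => ?_
        simp only [(Finset.mem_sdiff.1 hi).2, if_false]
      · refine Finset.prod_congr rfl fun i hi => ?_
        simp only [hi, if_true]
    have r : ∀ y : ι → V, prob p F (fun S => ∀ i ∈ J, P.Reach ↑S w (y i)) *
        prob p F (fun S => ∀ i ∈ I \ J, P.Reach ↑S w (y i)) =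
        expect p F fun S => expect p F fun T =>
          ∏ i ∈ I, if i ∈ J then ind (P.Reach ↑S w (y i)) else ind (P.Reach ↑T w (y i)) := by
      intro y
      simp only [prob, ind_forall_eq_prod]
      rw [← expect_mul_right]
      refine congrArg _ (funext fun S => ?_)
      rw [← expect_mul_left]
      refine congrArg _ (funext fun T => ?_)
      rw [← Finset.prod_sdiff hJ, mul_comm]
      congr 1
      · refine Finset.prod_congr rfl fun i hi => ?_
        simp only [(Finset.mem_sdiff.1 hi).2, if_false]
      · refine Finset.prod_congr rfl fun i hi => ?_
        simp only [hi, if_true]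
    rw [l]
    simp only [r]
    rw [← expect_sum]
    refine congrArg _ (funext fun S => ?_)
    rw [← expect_sum]
    refine congrArg _ (funext fun T => ?_)
    exact prod_sum_eq x I t fun i y => if i ∈ J then ind (P.Reach ↑S w y) else ind (P.Reach ↑T w y)
  rw [e1]
  refine (Finset.sum_le_sum fun y _ => prob_reach_all_le h0 h1 hU hx I hI y).trans (le_of_eq ?_)
  rw [Finset.sum_comm]
  refine Finset.sum_congr rfl fun w _ => ?_
  rw [Finset.sum_comm]
  refine Finset.sum_congr rfl fun J hJ => ?_
  rw [e2 w J (Finset.mem_powerset.1 (Finset.mem_filter.1 hJ).1), Finset.mul_sum]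

end LinkSystem

open LinkSystem in
/-- The moments of the numbers of sites of one set of radius `R` (index `o`) and of several sets of
radius `L` and codimension one. -/
theorem exists_moment_le {d e : ℕ} (he : 1 ≤ e) (hd : d = e + 6) {E ι : Type*} [DecidableEq E]
    [Fintype ι] [DecidableEq ι] (P : LinkSystem (Site d) E) (o : ι) (c : ℝ) (hc : 0 < c) (n : ℕ) :
    ∃ C : ℝ, 0 < C ∧ ∀ (p : ℝ) (F : Finset E) (U : Finset (Site d)) (t : ι → Finset (Site d))
      (R L : ℕ), 0 ≤ p → p ≤ 1 → P.Heads F U → 1 ≤ R → R ≤ L →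
      (∀ x y, P.tau p F x y ≤ c * ker (e + 4) (x - y)) →
      (∀ i ≠ o, ∀ w, ∑ y ∈ t i, P.tau p F w y ≤ c * L * cap (e + 4) L w) →
      (∀ w, ∑ y ∈ t o, P.tau p F w y ≤ c * (R : ℝ) ^ 2 * cap (e + 4) R w) →
      ∀ (I : Finset ι) (k : ℕ), I.card ≤ n → ∀ x ∈ U,
        (o ∉ I → I.card = k + 1 →
          P.moment p F t x I ≤ C * (L : ℝ) ^ (3 * k + 1) * cap (e + 2) L x) ∧
        (o ∈ I → I.card = 1 → P.moment p F t x I ≤ C * (R : ℝ) ^ 2 * cap (e + 4) R x) ∧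
        (o ∈ I → I.card = k + 2 →
          P.moment p F t x I ≤ C * (R : ℝ) ^ 4 * (L : ℝ) ^ (3 * k + 1) * cap (e + 2) R x) := by
  induction n with
  | zero =>
    refine ⟨1, one_pos, fun p F U t R L h0 h1 hU hR hRL hτ hface hbox I k hI x hx => ?_⟩
    refine ⟨fun _ h => by omega, fun _ h => by omega, fun _ h => by omega⟩
  | succ n ih =>
    obtain ⟨C, hC, H⟩ := ih
    obtain ⟨C₁, hC₁, H1⟩ := exists_sum_ker_mul_cap_le (d := d) hd
    obtain ⟨C₂, hC₂, H2⟩ := exists_sum_ker_mul_cap_mul_cap_le (d := d) he hd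
    refine ⟨C + c + 2 ^ (n + 1) * (c * (C * C) * (C₁ + C₂)), by positivity,
      fun p F U t R L h0 h1 hU hR hRL hτ hface hbox I k hI x hx => ?_⟩
    have hR0 : (0 : ℝ) < R := by exact_mod_cast hR
    have hL0 : (0 : ℝ) < L := by exact_mod_cast hR.trans hRL
    have cap0 : ∀ (a r : ℕ) (v : Site d), 0 ≤ cap a r v := cap_nonneg
    have rest : 0 ≤ 2 ^ (n + 1) * (c * (C * C) * (C₁ + C₂)) := by positivity
    have old := H p F U t R L h0 h1 hU hR hRL hτ hface hbox
    have mom0 := fun w J => moment_nonneg (P := P) (F := F) h0 h1 t w J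
    -- sizes one
    by_cases hI1 : I.card ≤ 1
    · refine ⟨fun ho hk => ?_, fun ho hk => ?_, fun _ hk => by omega⟩
      · obtain ⟨i, rfl⟩ := Finset.card_eq_one.1 (by omega : I.card = 1)
        have hk0 : k = 0 := by simpa using hk.symm
        subst hk0
        rw [moment_singleton]
        refine (hface i (by simpa using Ne.symm (by simpa using ho)) x).trans ?_
        have := cap_anti_exponent (R := L) (show e + 2 ≤ e + 4 by omega) x
        rw [mul_zero, zero_add, pow_one]
        have : c * L * cap (e + 4) L x ≤ c * L * cap (e + 2) L x := by gcongr
        have : 0 ≤ (C + 2 ^ (n + 1) * (c * (C * C) * (C₁ + C₂))) * (L * cap (e + 2) L x) := by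
          have := cap0 (e + 2) L x; positivity
        linarith
      · obtain ⟨i, rfl⟩ := Finset.card_eq_one.1 hk
        have hio : o = i := by simpa using ho
        subst hio
        rw [moment_singleton]
        refine (hbox x).trans ?_
        have : 0 ≤ (C + 2 ^ (n + 1) * (c * (C * C) * (C₁ + C₂))) *
            ((R : ℝ) ^ 2 * cap (e + 4) R x) := by
          have := cap0 (e + 4) R x; positivity
        linarith
    push Not at hI1
    set 𝒥 := I.powerset.filter fun J => J.Nonempty ∧ J ≠ I with h𝒥
    have hcard𝒥 : (𝒥.card : ℝ) ≤ 2 ^ (n + 1) := by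
      have h1 : 𝒥.card ≤ 2 ^ I.card := by
        rw [← Finset.card_powerset]; exact Finset.card_filter_le _ _
      have h2 : 2 ^ I.card ≤ 2 ^ (n + 1) := Nat.pow_le_pow_right (by norm_num) hI
      exact_mod_cast h1.trans h2
    have hrec := moment_le h0 h1 hU t hx I hI1
    -- a pointwise bound on the products gives a bound on the moment
    have finish : ∀ (B : Site d → ℝ) (D : ℝ), (∀ w, 0 ≤ B w) →
        (∀ w ∈ U, ∀ J ∈ 𝒥, P.moment p F t w J * P.moment p F t w (I \ J) ≤ C * C * B w) →
        (∑ w ∈ U, ker (e + 4) (x - w) * B w ≤ (C₁ + C₂) * D) → 0 ≤ D →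
        P.moment p F t x I ≤ (C + c + 2 ^ (n + 1) * (c * (C * C) * (C₁ + C₂))) * D := by
      intro B D hB hprod hsum hD
      refine hrec.trans ?_
      have pt : ∀ w ∈ U, ∑ J ∈ 𝒥, P.tau p F x w *
          (P.moment p F t w J * P.moment p F t w (I \ J)) ≤
          2 ^ (n + 1) * (c * (C * C)) * (ker (e + 4) (x - w) * B w) := by
        intro w hw
        have : ∀ J ∈ 𝒥, P.tau p F x w * (P.moment p F t w J * P.moment p F t w (I \ J)) ≤
            c * ker (e + 4) (x - w) * (C * C * B w) := fun J hJ =>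
          mul_le_mul (hτ x w) (hprod w hw J hJ) (mul_nonneg (mom0 _ _) (mom0 _ _))
            (mul_nonneg hc.le (ker_nonneg _ _))
        refine (Finset.sum_le_sum this).trans ?_
        rw [Finset.sum_const, nsmul_eq_mul]
        have hb : 0 ≤ c * ker (e + 4) (x - w) * (C * C * B w) := by
          have := ker_nonneg (e + 4) (x - w); have := hB w; positivity
        refine (mul_le_mul_of_nonneg_right hcard𝒥 hb).trans_eq ?_
        ring
      refine (Finset.sum_le_sum pt).trans ?_
      rw [← Finset.mul_sum]
      refine (mul_le_mul_of_nonneg_left hsum (by positivity)).trans ?_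
      have : 0 ≤ (C + c) * D := by positivity
      linarith
    have split𝒥 : ∀ J ∈ 𝒥, J ⊆ I ∧ 1 ≤ J.card ∧ 1 ≤ (I \ J).card ∧
        J.card + (I \ J).card = I.card := by
      intro J hJ
      obtain ⟨hJI, hJ0, hJne⟩ := Finset.mem_filter.1 hJ
      have hJI := Finset.mem_powerset.1 hJI
      have hne : (I \ J).Nonempty := by
        rw [Finset.nonempty_iff_ne_empty, Ne, Finset.sdiff_eq_empty_iff_subset]
        exact fun h => hJne (hJI.antisymm h)
      refine ⟨hJI, hJ0.card_pos, hne.card_pos, ?_⟩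
      rw [add_comm]
      exact Finset.card_sdiff_add_card_eq_card hJI
    refine ⟨fun ho hk => ?_, fun _ hk => by omega, fun ho hk => ?_⟩
    -- Only faces: the powers of the two branches multiply to L^{3k+2}, their caps of exponent e + 2
    -- to one of exponent e + 4, and summing over the branch point adds L².
    · obtain ⟨k, rfl⟩ : ∃ k', k = k' + 1 := ⟨k - 1, by omega⟩
      rw [mul_assoc]
      refine finish (fun w => (L : ℝ) ^ (3 * k + 2) * cap (e + 4) L w) _ (fun w => by
        have := cap0 (e + 4) L w; positivity) ?_ ?_ (by
        have := cap0 (e + 2) L x; positivity)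
      · intro w hw J hJ
        obtain ⟨hJI, h1J, h2J, hcard⟩ := split𝒥 J hJ
        have b1 := (old J (J.card - 1) (by omega) w hw).1 (fun h => ho (hJI h)) (by omega)
        have b2 := (old (I \ J) ((I \ J).card - 1) (by omega) w hw).1
          (fun h => ho (Finset.mem_sdiff.1 h).1) (by omega)
        refine (mul_le_mul b1 b2 (mom0 _ _) (by have := cap0 (e + 2) L w; positivity)).trans ?_
        have hexp : 3 * k + 2 = (3 * (J.card - 1) + 1) + (3 * ((I \ J).card - 1) + 1) := by omega
        rw [hexp, pow_add _ (3 * (J.card - 1) + 1)]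
        have := mul_le_mul_of_nonneg_left (cap_mul_cap_le (R := L) (show e + 4 ≤ e + 2 + (e + 2) by
          omega) w) (by positivity : 0 ≤ C * C * ((L : ℝ) ^ (3 * (J.card - 1) + 1) *
            (L : ℝ) ^ (3 * ((I \ J).card - 1) + 1)))
        linarith
      · have := H1 U x L (hR.trans hRL)
        have h2 := mul_le_mul_of_nonneg_left this (by positivity : 0 ≤ (L : ℝ) ^ (3 * k + 2))
        rw [Finset.mul_sum] at h2
        have e1 : ∑ w ∈ U, ker (e + 4) (x - w) * ((L : ℝ) ^ (3 * k + 2) * cap (e + 4) L w) =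
            ∑ w ∈ U, (L : ℝ) ^ (3 * k + 2) * (ker (e + 4) (x - w) * cap (e + 4) L w) :=
          Finset.sum_congr rfl fun w _ => by ring
        rw [e1]
        refine h2.trans ?_
        rw [show 3 * (k + 1) + 1 = 3 * k + 2 + 2 by ring, pow_add _ (3 * k + 2) 2]
        have : 0 ≤ C₂ * ((L : ℝ) ^ (3 * k + 2) * (L : ℝ) ^ 2 * cap (e + 2) L x) := by
          have := cap0 (e + 2) L x; positivity
        linarith
    -- The two summands of the bound are for a window that is alone on its branch and for a window
    -- that shares it with faces. In the first case the branch point contributes R²; in the second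
    -- it contributes L², whence the factor L^{-2}.
    · rw [mul_assoc, mul_assoc]
      refine finish (fun w => (R : ℝ) ^ 2 * (L : ℝ) ^ (3 * k + 1) * cap (e + 4) R w +
        (R : ℝ) ^ 4 * ((L : ℝ) ^ (3 * k + 1) * ((L : ℝ) ^ 2)⁻¹) *
          (cap (e + 2) R w * cap (e + 2) L w)) _ (fun w => by
        have := cap0 (e + 4) R w; have := cap0 (e + 2) R w; have := cap0 (e + 2) L w
        positivity) ?_ ?_ (by have := cap0 (e + 2) R x; positivity)
      · intro w hw
        have c1 := cap0 (e + 4) R w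
        have c2 := cap0 (e + 2) R w
        have c3 := cap0 (e + 2) L w
        have c4 := cap_le_one (e + 2) L w
        -- the statement is symmetric in the two parts
        have main : ∀ J J' : Finset ι, o ∈ J → o ∉ J' → 1 ≤ J.card → 1 ≤ J'.card →
            J.card + J'.card = I.card →
            P.moment p F t w J * P.moment p F t w J' ≤ C * C *
              ((R : ℝ) ^ 2 * (L : ℝ) ^ (3 * k + 1) * cap (e + 4) R w +
              (R : ℝ) ^ 4 * ((L : ℝ) ^ (3 * k + 1) * ((L : ℝ) ^ 2)⁻¹) *
                (cap (e + 2) R w * cap (e + 2) L w)) := by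
          intro J J' hoJ hoJ' hJ hJ' hcard
          have b2 := (old J' (J'.card - 1) (by omega) w hw).1 hoJ' (by omega)
          by_cases h1J : J.card = 1
          · have b1 := (old J 0 (by omega) w hw).2.1 hoJ h1J
            refine (mul_le_mul b1 b2 (mom0 _ _) (by positivity)).trans ?_
            have hexp : J'.card - 1 = k := by omega
            rw [hexp]
            have h5 : cap (e + 4) R w * cap (e + 2) L w ≤ cap (e + 4) R w :=
              mul_le_of_le_one_right c1 c4
            have h6 := mul_le_mul_of_nonneg_left h5
              (by positivity : 0 ≤ C * C * ((R : ℝ) ^ 2 * (L : ℝ) ^ (3 * k + 1)))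
            have h7 : 0 ≤ C * C * ((R : ℝ) ^ 4 * ((L : ℝ) ^ (3 * k + 1) * ((L : ℝ) ^ 2)⁻¹) *
                (cap (e + 2) R w * cap (e + 2) L w)) := by positivity
            linarith
          · have b1 := (old J (J.card - 2) (by omega) w hw).2.2 hoJ (by omega)
            refine (mul_le_mul b1 b2 (mom0 _ _) (by positivity)).trans ?_
            have hexp : 3 * k + 1 = (3 * (J.card - 2) + 1) + (3 * (J'.card - 1) + 1) + 2 := by
              omega
            have e1 : (L : ℝ) ^ (3 * k + 1) * ((L : ℝ) ^ 2)⁻¹ =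
                (L : ℝ) ^ (3 * (J.card - 2) + 1) * (L : ℝ) ^ (3 * (J'.card - 1) + 1) := by
              rw [hexp, pow_add _ _ 2, pow_add]; field_simp
            rw [e1]
            have : 0 ≤ C * C * ((R : ℝ) ^ 2 * (L : ℝ) ^ (3 * k + 1) * cap (e + 4) R w) := by
              positivity
            linarith
        intro J hJ
        obtain ⟨hJI, h1J, h2J, hcard⟩ := split𝒥 J hJ
        by_cases hoJ : o ∈ J
        · exact main J (I \ J) hoJ (fun h => (Finset.mem_sdiff.1 h).2 hoJ) h1J h2J hcard
        · rw [mul_comm (P.moment p F t w J)]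
          exact main (I \ J) J (Finset.mem_sdiff.2 ⟨ho, hoJ⟩) hoJ h2J h1J (by omega)
      · have s1 := H1 U x R hR
        have s2 := H2 U x R L hR hRL
        have s1' := mul_le_mul_of_nonneg_left s1
          (by positivity : 0 ≤ (R : ℝ) ^ 2 * (L : ℝ) ^ (3 * k + 1))
        have s2' := mul_le_mul_of_nonneg_left s2
          (by positivity : 0 ≤ (R : ℝ) ^ 4 * ((L : ℝ) ^ (3 * k + 1) * ((L : ℝ) ^ 2)⁻¹))
        rw [Finset.mul_sum] at s1' s2'
        have e1 : ∀ w, ker (e + 4) (x - w) * ((R : ℝ) ^ 2 * (L : ℝ) ^ (3 * k + 1) *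
            cap (e + 4) R w + (R : ℝ) ^ 4 * ((L : ℝ) ^ (3 * k + 1) * ((L : ℝ) ^ 2)⁻¹) *
            (cap (e + 2) R w * cap (e + 2) L w)) =
            (R : ℝ) ^ 2 * (L : ℝ) ^ (3 * k + 1) * (ker (e + 4) (x - w) * cap (e + 4) R w) +
            (R : ℝ) ^ 4 * ((L : ℝ) ^ (3 * k + 1) * ((L : ℝ) ^ 2)⁻¹) *
              (ker (e + 4) (x - w) * (cap (e + 2) R w * cap (e + 2) L w)) := fun w => by ring
        simp only [e1]
        rw [Finset.sum_add_distrib]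
        refine (add_le_add s1' s2').trans (le_of_eq ?_)
        have : ((L : ℝ) ^ 2)⁻¹ * (L : ℝ) ^ 2 = 1 := inv_mul_cancel₀ (by positivity)
        linear_combination (R : ℝ) ^ 4 * (L : ℝ) ^ (3 * k + 1) * C₂ * cap (e + 2) R x * this

/-! ### The lattice, and its two models as link systems. -/

section Lattice

variable {d : ℕ}

theorem lattice_adj_iff {x y : Site d} : (lattice d).Adj x y ↔ ∑ i, |x i - y i| = 1 := Iff.rfl

theorem size_sub_le_of_adj {x y : Site d} (h : (lattice d).Adj x y) : size (x - y) ≤ 2 := by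
  rw [show (2 : ℕ) = 1 + 1 from rfl, size_le_iff]
  intro i
  have h1 := Finset.single_le_sum (f := fun i => |x i - y i|) (fun _ _ => abs_nonneg _)
    (Finset.mem_univ i)
  rw [lattice_adj_iff] at h
  simp only [h] at h1
  have := abs_le.1 h1
  simp only [Pi.sub_apply]
  omega

end Lattice

/-- Bond and site percolation on the lattice as link systems. -/
def linkSystem (m : Model) (d : ℕ) : LinkSystem (Site d) (m.Element d) :=
  match m with
  | .bond =>
    { link := fun u (e : (lattice d).edgeSet) v => (e : Sym2 (Site d)) = s(u, v)
      root := fun _ => ∅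
      head_eq := by
        intro u e u' v v' h h'
        have : v' ∈ s(u, u') := by rw [← h, h']; exact Sym2.mem_mk_right _ _
        exact Sym2.mem_iff.1 this
      root_link := by intro x e u v h; exact absurd h (Set.notMem_empty _)
      reverse := by intro u e v h; exact ⟨e, by rw [h, Sym2.eq_swap], Or.inl rfl⟩
      root_head := by intro u e v _; exact Set.empty_subset _
      symm_or_unique := by intro u e v h; left; rw [h, Sym2.eq_swap]
      link_unique := by intro u e e' v h h'; exact Subtype.ext (h.trans h'.symm)
      root_inj := by intro x y e h; exact absurd h (Set.notMem_empty _) }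
  | .site =>
    { link := fun u (e : Site d) v => (lattice d).Adj u v ∧ e = v
      root := fun v => ({v} : Set (Site d))
      head_eq := by intro u e u' v v' h h'; exact Or.inr (h'.2.symm.trans h.2)
      root_link := by
        intro x e u v h h'
        exact h'.2.symm.trans (Set.mem_singleton_iff.1 h)
      reverse := by
        intro u e v h
        exact ⟨u, ⟨h.1.symm, rfl⟩, Or.inr rfl⟩
      root_head := by
        intro u e v h
        rw [h.2]
        exact subset_rfl
      symm_or_unique := by
        intro u e v h
        right
        intro a f h'
        exact h'.2.trans h.2.symm
      link_unique := by intro u e e' v h h'; exact h.2.trans h'.2.symm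
      root_inj := by
        intro x y e h h'
        exact (Set.mem_singleton_iff.1 h).symm.trans (Set.mem_singleton_iff.1 h') }

/-! ### From finite systems to the infinite product measure. -/

section Bridge

variable {m : Model} {d : ℕ}

instance (m : Model) (d : ℕ) : Countable (m.Element d) := by
  cases m
  · exact inferInstanceAs (Countable (lattice d).edgeSet)
  · exact inferInstanceAs (Countable (Site d))

theorem exists_link {u v : Site d} (h : (lattice d).Adj u v) :
    ∃ e, (linkSystem m d).link u e v := by
  cases m
  · exact ⟨⟨s(u, v), h⟩, rfl⟩
  · exact ⟨v, h, rfl⟩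

theorem adj_of_link {u v : Site d} {e : m.Element d} (h : (linkSystem m d).link u e v) :
    (lattice d).Adj u v := by
  cases m
  · have h' : (e : (lattice d).edgeSet).1 = s(u, v) := h
    have := (e : (lattice d).edgeSet).2
    rw [h'] at this
    exact this
  · exact h.1

/-- The set of open elements. -/
def openSet (ω : Config m d) : Set (m.Element d) := {e | ω e = true}

/-- In the site model `Reach` ignores the starting site, which `root` restores; every later site of
the path, `y` included, is open because it is entered by an open step. -/
theorem connected_iff (ω : Config m d) (x y : Site d) :
    Connected ω x y ↔ (linkSystem m d).Conn (openSet ω) x y := by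
  cases m
  · have hadj : ∀ u v, (openGraph .bond ω).Adj u v ↔
        ∃ e ∈ openSet ω, (linkSystem .bond d).link u e v := by
      intro u v
      constructor
      · intro h
        rw [openGraph, SimpleGraph.fromEdgeSet_adj] at h
        obtain ⟨⟨h, ho⟩, -⟩ := h
        exact ⟨⟨s(u, v), h⟩, ho, rfl⟩
      · rintro ⟨e, he, hl⟩
        rw [openGraph, SimpleGraph.fromEdgeSet_adj]
        have hadj : (lattice d).Adj u v := adj_of_link hl
        have hl' : (e : (lattice d).edgeSet) = ⟨s(u, v), hadj⟩ := Subtype.ext hl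
        refine ⟨⟨hadj, ?_⟩, hadj.ne⟩
        rw [← hl']
        exact he
    constructor
    · rintro ⟨-, -, h⟩
      refine ⟨Set.empty_subset _, ?_⟩
      rw [SimpleGraph.reachable_iff_reflTransGen] at h
      exact Relation.ReflTransGen.mono (fun u v h => (hadj u v).1 h) _ _ h
    · rintro ⟨-, h⟩
      refine ⟨Set.mem_univ _, Set.mem_univ _, ?_⟩
      rw [SimpleGraph.reachable_iff_reflTransGen]
      exact Relation.ReflTransGen.mono (fun u v h => (hadj u v).2 h) _ _ h
  · constructor
    · rintro ⟨hx, -, h⟩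
      refine ⟨Set.singleton_subset_iff.2 hx, ?_⟩
      rw [SimpleGraph.reachable_iff_reflTransGen] at h
      refine Relation.ReflTransGen.mono ?_ _ _ h
      rintro u v ⟨h, -, hv⟩
      exact ⟨v, hv, h, rfl⟩
    · rintro ⟨hx, h⟩
      have hx' : ω x = true := hx rfl
      have main : ω y = true ∧ Relation.ReflTransGen (openGraph .site ω).Adj x y := by
        induction h with
        | refl => exact ⟨hx', Relation.ReflTransGen.refl⟩
        | @tail u v _ hs ih =>
          obtain ⟨e, he, hl, rfl⟩ := hs
          exact ⟨he, ih.2.tail ⟨hl, ih.1, he⟩⟩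
      refine ⟨hx', main.1, ?_⟩
      rw [SimpleGraph.reachable_iff_reflTransGen]
      exact main.2

instance (m : Model) (d : ℕ) (p : unitInterval) : IsProbabilityMeasure (law m d p) := by
  unfold law; infer_instance

theorem law_cylinder (p : unitInterval) (F S : Finset (m.Element d)) (hS : S ⊆ F) :
    (law m d p).real {ω | F.filter (fun e => ω e = true) = S} = weight p F S := by
  have hset : {ω : Config m d | F.filter (fun e => ω e = true) = S} =
      Set.pi (F : Set (m.Element d)) fun e => {decide (e ∈ S)} := by
    ext ω
    simp only [Set.mem_ofPred_eq, Set.mem_pi, Set.mem_singleton_iff, Finset.mem_coe]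
    constructor
    · rintro rfl e he
      cases h : ω e <;> simp [he, h]
    · intro h
      ext e
      simp only [Finset.mem_filter]
      constructor
      · rintro ⟨he, ho⟩
        have := h e he
        rw [ho] at this
        exact of_decide_eq_true this.symm
      · intro he
        exact ⟨hS he, by rw [h e (hS he)]; exact decide_eq_true he⟩
  rw [hset, measureReal_def, law, Measure.infinitePi_pi _ fun _ _ => MeasurableSet.of_discrete,
    ENNReal.toReal_prod, weight]
  refine Finset.prod_congr rfl fun e _ => ?_
  rw [← measureReal_def, bernoulliMeasure_real_apply p MeasurableSet.of_discrete]
  by_cases he : e ∈ S <;> simp [he]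

theorem measurableSet_cylinder (F : Finset (m.Element d)) (A : Finset (m.Element d) → Prop) :
    MeasurableSet {ω : Config m d | A (F.filter fun e => ω e = true)} := by
  have : {ω : Config m d | A (F.filter fun e => ω e = true)} =
      ⋃ S ∈ F.powerset.filter A, ⋂ e ∈ F, {ω : Config m d | ω e = decide (e ∈ S)} := by
    ext ω
    simp only [Set.mem_ofPred_eq, Set.mem_iUnion, Set.mem_iInter, Finset.mem_filter,
      Finset.mem_powerset, exists_prop]
    constructor
    · intro h
      refine ⟨_, ⟨Finset.filter_subset _ _, h⟩, fun e he => ?_⟩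
      cases h : ω e <;> simp [he, h]
    · rintro ⟨S, ⟨hS, hA⟩, h⟩
      have : F.filter (fun e => ω e = true) = S := by
        ext e
        simp only [Finset.mem_filter]
        constructor
        · rintro ⟨he, ho⟩
          have := h e he
          rw [ho] at this
          exact of_decide_eq_true this.symm
        · intro he
          exact ⟨hS he, by rw [h e (hS he)]; exact decide_eq_true he⟩
      rwa [this]
  rw [this]
  refine Finset.measurableSet_biUnion _ fun S _ => Finset.measurableSet_biInter _ fun e _ => ?_
  exact measurableSet_eq_fun (measurable_pi_apply e) measurable_const

theorem law_finite (p : unitInterval) (F : Finset (m.Element d))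
    (A : Finset (m.Element d) → Prop) :
    (law m d p).real {ω | A (F.filter fun e => ω e = true)} = prob p F A := by
  have hset : {ω : Config m d | A (F.filter fun e => ω e = true)} =
      ⋃ S ∈ F.powerset.filter A, {ω : Config m d | F.filter (fun e => ω e = true) = S} := by
    ext ω
    simp only [Set.mem_ofPred_eq, Set.mem_iUnion, Finset.mem_filter, Finset.mem_powerset,
      exists_prop]
    exact ⟨fun h => ⟨_, ⟨Finset.filter_subset _ _, h⟩, rfl⟩, fun ⟨S, h, hS⟩ => hS ▸ h.2⟩
  rw [hset, measureReal_biUnion_finset]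
  · rw [prob, expect, Finset.sum_filter]
    refine Finset.sum_congr rfl fun S hS => ?_
    by_cases h : A S
    · rw [if_pos h, ind_true h, mul_one, law_cylinder p F S (Finset.mem_powerset.1 hS)]
    · rw [if_neg h, ind_false h, mul_zero]
  · intro S _ S' _ hne
    rw [Function.onFun, Set.disjoint_left]
    intro ω h h'
    exact hne (h.symm.trans h')
  · intro S _
    exact measurableSet_cylinder F fun T => T = S

/-- An increasing event that is always witnessed by finitely many open elements. -/
structure Finitary {E : Type*} (A : Set E → Prop) : Prop where
  mono : ∀ S T, S ⊆ T → A S → A T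
  finite : ∀ S, A S → ∃ F : Finset E, ↑F ⊆ S ∧ A ↑F

theorem Finitary.and {E : Type*} {A B : Set E → Prop} (hA : Finitary A) (hB : Finitary B) :
    Finitary fun S => A S ∧ B S where
  mono S T h hS := ⟨hA.mono S T h hS.1, hB.mono S T h hS.2⟩
  finite S hS := by
    obtain ⟨F, hF, hAF⟩ := hA.finite S hS.1
    obtain ⟨G, hG, hBG⟩ := hB.finite S hS.2
    refine ⟨F ∪ G, by rw [Finset.coe_union]; exact Set.union_subset hF hG, ?_, ?_⟩
    · exact hA.mono _ _ (by simp) hAF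
    · exact hB.mono _ _ (by simp) hBG

theorem finitary_reach (x y : Site d) : Finitary fun S => (linkSystem m d).Reach S x y where
  mono _ _ h hS := hS.mono h
  finite _ hS := hS.exists_finite

theorem root_finite (x : Site d) : ((linkSystem m d).root x).Finite := by
  cases m
  · exact Set.finite_empty
  · exact Set.finite_singleton x

theorem finitary_conn (x y : Site d) : Finitary fun S => (linkSystem m d).Conn S x y where
  mono _ _ h hS := hS.mono h
  finite S hS := by
    obtain ⟨F, hF, hr⟩ := hS.2.exists_finite
    refine ⟨F ∪ (root_finite x).toFinset, ?_, ?_, ?_⟩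
    · rw [Finset.coe_union, Set.Finite.coe_toFinset]
      exact Set.union_subset hF hS.1
    · rw [Finset.coe_union, Set.Finite.coe_toFinset]
      exact Set.subset_union_right
    · exact hr.mono (by simp)

theorem coe_filter_subset (ω : Config m d) (F : Finset (m.Element d)) :
    ↑(F.filter fun e => ω e = true) ⊆ openSet ω := by
  intro e he
  have := Finset.mem_filter.1 (Finset.mem_coe.1 he)
  exact this.2

theorem iUnion_cylinder {A : Set (m.Element d) → Prop} (hA : Finitary A) :
    {ω : Config m d | A (openSet ω)} =
      ⋃ F : Finset (m.Element d), {ω | A ↑(F.filter fun e => ω e = true)} := by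
  ext ω
  simp only [Set.mem_ofPred_eq, Set.mem_iUnion]
  constructor
  · intro h
    obtain ⟨F, hF, hAF⟩ := hA.finite _ h
    refine ⟨F, ?_⟩
    have : F.filter (fun e => ω e = true) = F := Finset.filter_true_of_mem fun e he => hF he
    rwa [this]
  · rintro ⟨F, h⟩
    exact hA.mono _ _ (coe_filter_subset ω F) h

theorem measurableSet_finitary {A : Set (m.Element d) → Prop} (hA : Finitary A) :
    MeasurableSet {ω : Config m d | A (openSet ω)} := by
  rw [iUnion_cylinder hA]
  exact MeasurableSet.iUnion fun F => measurableSet_cylinder F fun S => A ↑S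

/-- The probability of a finitary event is the limit of its probabilities in finite systems. -/
theorem tendsto_prob (p : unitInterval) {A : Set (m.Element d) → Prop} (hA : Finitary A) :
    Tendsto (fun F : Finset (m.Element d) => prob (p : ℝ) F fun S => A ↑S) atTop
      (𝓝 ((law m d p).real {ω | A (openSet ω)})) := by
  have hmono : Monotone fun F : Finset (m.Element d) =>
      {ω : Config m d | A ↑(F.filter fun e => ω e = true)} := by
    intro F G hFG ω h
    exact hA.mono _ _ (Finset.coe_subset.2 (Finset.filter_subset_filter _ hFG)) h
  have h := tendsto_measure_iUnion_atTop (μ := law m d p) hmono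
  rw [← iUnion_cylinder hA] at h
  have h2 := (ENNReal.tendsto_toReal (measure_ne_top _ _)).comp h
  refine h2.congr fun F => ?_
  exact law_finite p F fun S => A ↑S

theorem prob_le_law (p : unitInterval) {A : Set (m.Element d) → Prop} (hA : Finitary A)
    (F : Finset (m.Element d)) :
    prob (p : ℝ) F (fun S => A ↑S) ≤ (law m d p).real {ω | A (openSet ω)} := by
  rw [← law_finite p F fun S => A ↑S]
  refine measureReal_mono fun ω h => ?_
  exact hA.mono _ _ (coe_filter_subset ω F) h

/-- Every finite system has only finitely many heads. -/
theorem exists_heads (F : Finset (m.Element d)) (W : Finset (Site d)) :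
    ∃ U : Finset (Site d), W ⊆ U ∧ (linkSystem m d).Heads F U := by
  have hfin : ∀ e : m.Element d, {v | ∃ u, (linkSystem m d).link u e v}.Finite := by
    intro e
    by_cases h : ∃ u v, (linkSystem m d).link u e v
    · obtain ⟨u, v, huv⟩ := h
      refine (Set.toFinite {u, v}).subset ?_
      rintro v' ⟨u', h'⟩
      exact (linkSystem m d).head_eq huv h'
    · push Not at h
      refine Set.finite_empty.subset ?_
      rintro v ⟨u, hu⟩
      exact (h u v hu).elim
  refine ⟨W ∪ F.biUnion fun e => (hfin e).toFinset, Finset.subset_union_left, ?_⟩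
  intro u e he v hl
  refine Finset.mem_union_right _ (Finset.mem_biUnion.2 ⟨e, he, ?_⟩)
  rw [Set.Finite.mem_toFinset]
  exact ⟨u, hl⟩

end Bridge

/-! ### Balls are connected inside and contain boundedly many elements. -/

section Ball

variable {m : Model} {d : ℕ}

/-- The ball of radius `r` about `w` in the maximum norm. -/
def ball (r : ℕ) (w : Site d) : Set (Site d) := {v | size (v - w) ≤ r + 1}

theorem center_mem_ball (r : ℕ) (w : Site d) : w ∈ ball r w := by
  simp [ball, size]

/-- One coordinate at a time moves towards `w`, which lowers the ℓ¹ distance and never leaves the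
ball. Both directions are carried along because a single step need not be reversible through its own
element. -/
theorem reach_center (r : ℕ) (w v : Site d) (hv : v ∈ ball r w) :
    (linkSystem m d).Reach ((linkSystem m d).inner (ball r w)) v w ∧
      (linkSystem m d).Reach ((linkSystem m d).inner (ball r w)) w v := by
  induction hn : ∑ i, (v i - w i).natAbs using Nat.strong_induction_on generalizing v with
  | _ n ih =>
    by_cases hvw : v = w
    · subst hvw
      exact ⟨LinkSystem.Reach.refl _ _, LinkSystem.Reach.refl _ _⟩
    obtain ⟨i, hi⟩ : ∃ i, v i ≠ w i := by
      by_contra h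
      push Not at h
      exact hvw (funext h)
    set s : ℤ := if w i < v i then -1 else 1 with hs
    set v' : Site d := Function.update v i (v i + s) with hv'
    have hi' : v' i = v i + s := Function.update_self _ _ _
    have hj' : ∀ j, j ≠ i → v' j = v j := fun j hj => Function.update_of_ne hj _ _
    have hlt : (v' i - w i).natAbs < (v i - w i).natAbs := by
      rw [hi', hs]; split_ifs <;> omega
    have hle : ∀ j, (v' j - w j).natAbs ≤ (v j - w j).natAbs := by
      intro j
      by_cases hj : j = i
      · subst hj; exact hlt.le
      · rw [hj' j hj]
    have hball : v' ∈ ball r w := by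
      rw [ball, Set.mem_ofPred_eq, size_le_iff] at hv ⊢
      exact fun j => (hle j).trans (hv j)
    have hadj : (lattice d).Adj v v' := by
      rw [lattice_adj_iff, Finset.sum_eq_single i]
      · rw [hi', hs]; split_ifs <;> simp
      · intro j _ hj; rw [hj' j hj]; simp
      · simp
    have hsum : ∑ j, (v' j - w j).natAbs < n := by
      rw [← hn]
      exact Finset.sum_lt_sum (fun j _ => hle j) ⟨i, Finset.mem_univ _, hlt⟩
    obtain ⟨h1, h2⟩ := ih _ hsum v' hball rfl
    obtain ⟨e, he⟩ := exists_link (m := m) hadj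
    obtain ⟨f, hf⟩ := exists_link (m := m) hadj.symm
    refine ⟨(LinkSystem.Reach.single (e := e) ?_ he).trans h1, h2.step (e := f) ?_ hf⟩
    · exact ⟨v, hv, v', hball, he⟩
    · exact ⟨v', hball, v, hv, hf⟩

theorem reach_ball (r : ℕ) (w a b : Site d) (ha : a ∈ ball r w) (hb : b ∈ ball r w) :
    (linkSystem m d).Reach ((linkSystem m d).inner (ball r w)) a b :=
  (reach_center r w a ha).1.trans (reach_center r w b hb).2

theorem ball_subset_pi (r : ℕ) (w : Site d) :
    ∃ B : Finset (Site d), (B : Set (Site d)) = ball r w ∧ B.card ≤ (2 * r + 1) ^ d := by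
  refine ⟨Fintype.piFinset fun i => Finset.Icc (w i - r) (w i + r), ?_, ?_⟩
  · ext v
    rw [Finset.mem_coe, Fintype.mem_piFinset, ball, Set.mem_ofPred_eq, size_le_iff]
    refine forall_congr' fun i => ?_
    rw [Finset.mem_Icc, Pi.sub_apply]
    omega
  · rw [Fintype.card_piFinset]
    refine (Finset.prod_le_pow_card _ _ (2 * r + 1) fun i _ => ?_).trans ?_
    · rw [Int.card_Icc]; omega
    · rw [Finset.card_univ, Fintype.card_fin]

/-- An element inside the ball is determined by an ordered pair of its sites, by `link_unique`. -/
theorem exists_inner_ball (r : ℕ) (w : Site d) :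
    ∃ D : Finset (m.Element d), (D : Set (m.Element d)) = (linkSystem m d).inner (ball r w) ∧
      D.card ≤ (2 * r + 1) ^ d * (2 * r + 1) ^ d := by
  obtain ⟨B, hB, hcard⟩ := ball_subset_pi r w
  set L : Site d × Site d → Option (m.Element d) := fun q =>
    if h : ∃ e, (linkSystem m d).link q.1 e q.2 then some h.choose else none with hL
  have hfin : (linkSystem m d).inner (ball r w) ⊆
      ↑(Finset.eraseNone ((B ×ˢ B).image L)) := by
    rintro e ⟨u, hu, v, hv, hl⟩
    rw [Finset.mem_coe, Finset.mem_eraseNone, Finset.mem_image]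
    rw [← hB] at hu hv
    refine ⟨(u, v), Finset.mem_product.2 ⟨hu, hv⟩, ?_⟩
    have h : ∃ e, (linkSystem m d).link u e v := ⟨e, hl⟩
    simp only [hL, h, dif_pos]
    rw [(linkSystem m d).link_unique hl h.choose_spec]
  have hF := (Finset.finite_toSet _).subset hfin
  refine ⟨hF.toFinset, hF.coe_toFinset, ?_⟩
  have h1 : hF.toFinset ⊆ Finset.eraseNone ((B ×ˢ B).image L) := by
    rw [← Finset.coe_subset, hF.coe_toFinset]; exact hfin
  refine (Finset.card_le_card h1).trans ?_
  refine (Finset.card_eraseNone_le _).trans (Finset.card_image_le.trans ?_)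
  rw [Finset.card_product]
  exact Nat.mul_le_mul hcard hcard

end Ball

/-! ### The hypothesis on the two-point function in terms of kernels. -/

section TwoPoint

variable {m : Model} {d : ℕ}

theorem size_le_eDist {x y : Site d} (h : x ≠ y) : (size (x - y) : ℝ) ≤ 2 * eDist x y := by
  have hpos : 0 < Finset.univ.sup fun i => ((x - y) i).natAbs := by
    obtain ⟨i, hi⟩ : ∃ i, x i ≠ y i := by
      by_contra hn; push Not at hn; exact h (funext hn)
    refine lt_of_lt_of_le ?_ (Finset.le_sup (f := fun i => ((x - y) i).natAbs) (Finset.mem_univ i))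
    simp only [Pi.sub_apply]; omega
  have hne : (Finset.univ : Finset (Fin d)).Nonempty := by
    by_contra hn
    rw [Finset.not_nonempty_iff_eq_empty] at hn
    rw [hn] at hpos
    simp at hpos
  obtain ⟨i, -, hi⟩ := Finset.exists_mem_eq_sup _ hne fun i => ((x - y) i).natAbs
  have h1 : (((x - y) i).natAbs : ℝ) ≤ eDist x y := by
    rw [Nat.cast_natAbs]
    refine Real.le_sqrt_of_sq_le ?_
    have := Finset.single_le_sum (f := fun i => ((x i : ℝ) - (y i : ℝ)) ^ 2)
      (fun _ _ => sq_nonneg _) (Finset.mem_univ i)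
    refine le_trans (le_of_eq ?_) this
    simp
  have h2 : (1 : ℝ) ≤ ((x - y) i).natAbs := by
    exact_mod_cast (by omega : 1 ≤ ((x - y) i).natAbs)
  rw [size, hi]
  push_cast at h1 h2 ⊢
  linarith

theorem eDist_le_size (x y : Site d) : eDist x y ≤ d * size (x - y) := by
  refine Real.sqrt_le_iff.2 ⟨by positivity, ?_⟩
  have h1 : ∀ i, ((x i : ℝ) - (y i : ℝ)) ^ 2 ≤ (size (x - y) : ℝ) ^ 2 := by
    intro i
    have := natAbs_lt_size (x - y) i
    have h2 : (((x - y) i).natAbs : ℝ) ≤ size (x - y) := by exact_mod_cast this.le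
    rw [Nat.cast_natAbs] at h2
    rw [← sq_abs]
    refine pow_le_pow_left₀ (abs_nonneg _) (le_trans (le_of_eq ?_) h2) 2
    simp
  refine (Finset.sum_le_sum fun i _ => h1 i).trans ?_
  rw [Finset.sum_const, Finset.card_univ, Fintype.card_fin, nsmul_eq_mul, mul_pow]
  rcases Nat.eq_zero_or_pos d with rfl | hd
  · simp
  · have h2 : (1 : ℝ) ≤ d := by exact_mod_cast hd
    exact mul_le_mul_of_nonneg_right (le_self_pow₀ h2 two_ne_zero) (sq_nonneg _)

theorem eDist_pos {x y : Site d} (h : x ≠ y) : 0 < eDist x y := by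
  have := size_le_eDist h
  have := size_pos (x - y)
  linarith

/-- Requiring the starting point to be occupied costs a factor of at least `p`. -/
theorem mul_reach_le_conn (p : unitInterval) (x y : Site d) :
    p * (law m d p).real {ω | (linkSystem m d).Reach (openSet ω) x y} ≤
      (law m d p).real {ω | (linkSystem m d).Conn (openSet ω) x y} := by
  have h0 : (0 : ℝ) ≤ p := p.2.1
  have h1 : (p : ℝ) ≤ 1 := p.2.2
  have t1 := (tendsto_prob (m := m) p (finitary_reach x y)).const_mul (p : ℝ)
  have t2 := tendsto_prob (m := m) p (finitary_conn x y)
  refine le_of_tendsto_of_tendsto t1 t2 ?_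
  set D := (root_finite (m := m) x).toFinset with hD
  have hDc : (D : Set (m.Element d)) = (linkSystem m d).root x := Set.Finite.coe_toFinset _
  have hcard : D.card ≤ 1 := by
    refine Finset.card_le_one.2 fun e he f hf => ?_
    rw [hD, Set.Finite.mem_toFinset] at he hf
    cases m
    · exact absurd he (Set.notMem_empty _)
    · exact (Set.mem_singleton_iff.1 he).trans (Set.mem_singleton_iff.1 hf).symm
  filter_upwards [eventually_ge_atTop D] with F hF
  set O := (linkSystem m d).root x with hO
  -- The root of the starting point is not needed along the path, so it is open independently of
  -- reachability.
  have ind1 := expect_mul_of_disjoint (p := (p : ℝ)) (F := F) O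
    (fun S => ind (O ⊆ ↑S)) (fun S => ind ((linkSystem m d).Reach ↑S x y))
  have e1 : ∀ S : Finset (m.Element d), ind (O ⊆ ↑(S.filter (· ∈ O))) = ind (D ⊆ S) := by
    intro S
    congr 1
    refine propext ⟨fun h e he => ?_, fun h e he => ?_⟩
    · have h' := h (hDc ▸ Finset.mem_coe.2 he)
      exact (Finset.mem_filter.1 (Finset.mem_coe.1 h')).1
    · rw [← hDc] at he
      exact Finset.mem_coe.2 (Finset.mem_filter.2 ⟨h he, hDc ▸ he⟩)
  have e2 : ∀ S : Finset (m.Element d),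
      ind ((linkSystem m d).Reach ↑(S.filter (· ∉ O)) x y) =
        ind ((linkSystem m d).Reach ↑S x y) := by
    intro S
    congr 1
    refine propext ⟨fun h => h.mono fun e he =>
      Finset.mem_coe.2 (Finset.mem_filter.1 (Finset.mem_coe.1 he)).1, fun h => ?_⟩
    refine h.diff_root.mono fun e he => ?_
    rw [Finset.coe_filter]
    exact ⟨he.1, he.2⟩
  simp only [e1, e2, ← ind_and] at ind1
  have e3 : (fun S : Finset (m.Element d) => ind (D ⊆ S ∧ (linkSystem m d).Reach ↑S x y)) =
      fun S : Finset (m.Element d) => ind ((linkSystem m d).Conn ↑S x y) := by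
    funext S
    congr 1
    rw [LinkSystem.Conn, ← hO, ← hDc, Finset.coe_subset]
  rw [e3] at ind1
  have e4 : (p : ℝ) ≤ expect p F fun S => ind (D ⊆ S) := by
    have := expect_union_mul_pow (p := (p : ℝ)) hF fun _ => 1
    rw [expect_const, mul_one] at this
    simp only [mul_one] at this
    rw [← this]
    exact (pow_one (p : ℝ)).symm.le.trans (pow_le_pow_of_le_one h0 h1 hcard)
  rw [prob, prob, ind1]
  exact mul_le_mul_of_nonneg_right e4 (expect_nonneg h0 h1 fun _ _ => ind_nonneg _)

/-- The bounds on the two-point function, in the form that is used below. -/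
theorem exists_tau_bounds {e : ℕ} (hd : d = e + 6)
    (hτ : ∃ c₁ c₂ : ℝ, 0 < c₁ ∧ c₁ ≤ c₂ ∧ ∀ x y : Site d, x ≠ y →
      c₁ / eDist x y ^ (d - 2) ≤ twoPoint m d x y ∧
      twoPoint m d x y ≤ c₂ / eDist x y ^ (d - 2)) :
    0 < (criticalDensity m d : ℝ) ∧ ∃ c C : ℝ, 0 < c ∧ 0 < C ∧
      (∀ x y : Site d, x ≠ y → c * ker (e + 4) (x - y) ≤
        (criticalLaw m d).real {ω | (linkSystem m d).Reach (openSet ω) x y}) ∧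
      ∀ (F : Finset (m.Element d)) (x y : Site d),
        (linkSystem m d).tau (criticalDensity m d) F x y ≤ C * ker (e + 4) (x - y) := by
  obtain ⟨c₁, c₂, hc₁, hc₁₂, h⟩ := hτ
  have hc₂ : 0 < c₂ := hc₁.trans_le hc₁₂
  have hd2 : d - 2 = e + 4 := by omega
  rw [hd2] at h
  have hd0 : (0 : ℝ) < d := by exact_mod_cast (by omega : 0 < d)
  set p := criticalDensity m d with hp
  have two : ∀ x y, twoPoint m d x y =
      (law m d p).real {ω | (linkSystem m d).Conn (openSet ω) x y} := by
    intro x y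
    simp only [twoPoint, criticalLaw, connected_iff]
    rfl
  have lower : ∀ x y : Site d, x ≠ y → c₁ * ((d : ℝ) ^ (e + 4))⁻¹ * ker (e + 4) (x - y) ≤
      (law m d p).real {ω | (linkSystem m d).Reach (openSet ω) x y} := by
    intro x y hxy
    have h1 := (h x y hxy).1
    rw [two] at h1
    have h2 : (law m d p).real {ω | (linkSystem m d).Conn (openSet ω) x y} ≤
        (law m d p).real {ω | (linkSystem m d).Reach (openSet ω) x y} :=
      measureReal_mono fun ω hω => hω.2
    refine le_trans ?_ (h1.trans h2)
    have h3 := eDist_le_size x y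
    have h4 := eDist_pos hxy
    have h5 := size_pos (x - y)
    rw [ker, div_eq_mul_inv, mul_assoc, ← mul_inv, ← mul_pow]
    gcongr
  -- At density zero two different sites are never connected, against the lower bound.
  have hp0 : 0 < (p : ℝ) := by
    refine lt_of_le_of_ne p.2.1 fun h0 => ?_
    set x : Site d := 0 with hx
    set y : Site d := fun _ => 1 with hy
    have hxy : x ≠ y := by
      intro hh
      have := congrFun hh ⟨0, by omega⟩
      simp [hx, hy] at this
    have h1 := lower x y hxy
    have h2 : (law m d p).real {ω | (linkSystem m d).Reach (openSet ω) x y} = 0 := by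
      refine tendsto_nhds_unique (tendsto_prob (m := m) p (finitary_reach x y)) ?_
      have : ∀ F : Finset (m.Element d),
          prob (p : ℝ) F (fun S => (linkSystem m d).Reach ↑S x y) = 0 := by
        intro F
        have key : ∀ (F : Finset (m.Element d)) (f : Finset (m.Element d) → ℝ),
            expect 0 F f = f ∅ := by
          intro F
          induction F using Finset.induction_on with
          | empty => intro f; exact expect_empty
          | insert a F ha ih => intro f; rw [expect_insert ha, ih]; ring
        rw [← h0, prob, key, ind_false]
        intro hr
        rcases hr.eq_or_first with h | ⟨u, e, he, -⟩
        · exact hxy h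
        · simp at he
      simp only [this]
      exact tendsto_const_nhds
    rw [h2] at h1
    have := ker_pos (e + 4) (x - y)
    have : 0 < c₁ * ((d : ℝ) ^ (e + 4))⁻¹ * ker (e + 4) (x - y) := by positivity
    linarith
  refine ⟨hp0, c₁ * ((d : ℝ) ^ (e + 4))⁻¹, (p : ℝ)⁻¹ * c₂ * 2 ^ (e + 4) + 1, by positivity,
    by positivity, lower, fun F x y => ?_⟩
  have k0 := ker_nonneg (e + 4) (x - y)
  -- On the diagonal the hypothesis is silent; the `+ 1` in the constant covers it.
  by_cases hxy : x = y
  · subst hxy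
    have : ker (e + 4) (x - x) = 1 := by
      have : size (x - x) = 1 := le_antisymm ((size_le_iff (r := 0)).2 (by simp)) (one_le_size _)
      rw [ker, this]; simp
    rw [this, mul_one]
    have : 0 ≤ (p : ℝ)⁻¹ * c₂ * 2 ^ (e + 4) := by positivity
    have := LinkSystem.tau_le_one (P := linkSystem m d) (F := F) p.2.1 p.2.2 x x
    linarith
  · have h1 := (h x y hxy).2
    rw [two] at h1
    have h2 := mul_reach_le_conn (m := m) p x y
    have h3 : (linkSystem m d).tau p F x y ≤ _ := prob_le_law p (finitary_reach x y) F
    refine h3.trans ?_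
    have h4 : (law m d p).real {ω | (linkSystem m d).Reach (openSet ω) x y} ≤
        (p : ℝ)⁻¹ * (c₂ / eDist x y ^ (e + 4)) := by
      rw [← div_eq_inv_mul, le_div_iff₀ hp0, mul_comm]
      exact h2.trans h1
    refine h4.trans ?_
    have h5 : c₂ / eDist x y ^ (e + 4) ≤ c₂ * 2 ^ (e + 4) * ker (e + 4) (x - y) := by
      have := size_le_eDist hxy
      have h6 := size_pos (x - y)
      have : (size (x - y) : ℝ) / 2 ≤ eDist x y := by linarith
      have h7 : c₂ / eDist x y ^ (e + 4) ≤ c₂ / ((size (x - y) : ℝ) / 2) ^ (e + 4) := by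
        gcongr
      refine h7.trans (le_of_eq ?_)
      rw [ker, div_pow]
      field_simp
    have := mul_le_mul_of_nonneg_left h5 (inv_nonneg.2 hp0.le)
    linarith

end TwoPoint

/-! ### The diagram for two connections that meet. -/

section Meet

variable {d e : ℕ}

/-- By the triangle inequality one leg is at least half as long as x - y; its kernel is exchanged
for the direct one. -/
theorem ker_mul_ker_le_add (a : ℕ) (x y u : Site d) :
    ker a (x - u) * ker a (u - y) ≤
      2 ^ a * ker a (x - y) * (ker a (x - u) + ker a (u - y)) := by
  have htri := size_sub_le x u y
  have k1 := ker_nonneg a (x - u)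
  have k2 := ker_nonneg a (u - y)
  have k3 := ker_nonneg a (x - y)
  rcases le_or_gt (size (x - y)) (2 * size (x - u)) with h | h
  · have := ker_le_of_size_le (a := a) h
    push_cast at this
    have h2 := mul_le_mul_of_nonneg_right this k2
    have : 0 ≤ 2 ^ a * ker a (x - y) * ker a (x - u) := by positivity
    linarith
  · have h' : size (x - y) ≤ 2 * size (u - y) := by omega
    have := ker_le_of_size_le (a := a) h'
    push_cast at this
    have h2 := mul_le_mul_of_nonneg_left this k1
    have : 0 ≤ 2 ^ a * ker a (x - y) * ker a (u - y) := by positivity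
    linarith

/-- The probability that two connections from distant starting points meet is relatively small. -/
theorem exists_meet_le (m : Model) (he : 1 ≤ e) (hd : d = e + 6) (C : ℝ) (hC : 0 < C) :
    ∃ C' : ℝ, 0 < C' ∧ ∀ (p : ℝ) (F : Finset (m.Element d)) (U : Finset (Site d)),
      0 ≤ p → p ≤ 1 → (linkSystem m d).Heads F U →
      (∀ x y, (linkSystem m d).tau p F x y ≤ C * ker (e + 4) (x - y)) →
      ∀ (K : ℕ), 1 ≤ K → ∀ w ∈ U, ∀ x w' y : Site d, K ≤ size (w - w') → K ≤ size (w - y) →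
      K ≤ size (x - w') → K ≤ size (x - y) →
      (linkSystem m d).meet p F U w x w' y ≤
        C' * (K : ℝ)⁻¹ * (ker (e + 4) (w - x) * ker (e + 4) (w' - y)) := by
  obtain ⟨C₁, h1, H1⟩ := sum_ker_mul_ker_le (d := d) (e + 4) (e + 4) 1 1 (e + 1) (by omega)
    (by omega) (by omega)
  obtain ⟨C₂, h2, H2⟩ := sum_ker_mul_ker_le (d := d) (e + 2) (e + 4) 3 1 (e - 1) (by omega)
    (by omega) (by omega)
  refine ⟨2 * C ^ 5 * 4 ^ d * 2 ^ (e + 4) * (2 ^ (e + 4) * 2 ^ (e + 4)) * (4 * (C₁ * C₂)),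
    by positivity, fun p F U h0 hp1 hU hτ K hK w hw x w' y d1 d2 d3 d4 => ?_⟩
  have k0 : ∀ v : Site d, 0 ≤ ker (e + 4) v := ker_nonneg _
  have K0 : (0 : ℝ) < K := by exact_mod_cast hK
  have t0 : ∀ x y, 0 ≤ (linkSystem m d).tau p F x y := LinkSystem.tau_nonneg h0 hp1
  -- Two convolutions turn three kernels of exponent d - 2 into one of exponent d - 6 = e. As e ≥ 1,
  -- it is at most 1/K at distance K.
  have triple : ∀ s q : Site d, K ≤ size (s - q) →
      ∑ v ∈ U, ∑ u ∈ U, ker (e + 4) (s - u) * ker (e + 4) (u - v) * ker (e + 4) (v - q) ≤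
        C₁ * C₂ * (K : ℝ)⁻¹ := by
    intro s q hsq
    have i1 : ∀ v ∈ U, ∑ u ∈ U, ker (e + 4) (s - u) * ker (e + 4) (u - v) * ker (e + 4) (v - q) ≤
        C₁ * (ker (e + 2) (s - v) * ker (e + 4) (v - q)) := by
      intro v _
      rw [← Finset.sum_mul, ← mul_assoc]
      exact mul_le_mul_of_nonneg_right (H1 U s v) (k0 _)
    refine (Finset.sum_le_sum i1).trans ?_
    rw [← Finset.mul_sum, mul_assoc]
    refine mul_le_mul_of_nonneg_left ((H2 U s q).trans ?_) h1.le
    refine mul_le_mul_of_nonneg_left ?_ h2.le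
    rw [show e - 1 + 1 = e by omega]
    refine (ker_anti hK hsq).trans ?_
    have : (1 : ℝ) ≤ K := by exact_mod_cast hK
    exact inv_anti₀ K0 (le_self_pow₀ this (by omega))
  -- the diagram in terms of kernels
  have step : ∀ v ∈ U, (∑ a ∈ U.filter fun a => (linkSystem m d).Near a v,
      prob p F (fun S => (linkSystem m d).Reach ↑S w x ∧ (linkSystem m d).Reach ↑S w a)) *
      ((linkSystem m d).tau p F w' v * (linkSystem m d).tau p F v y) ≤
      2 * C ^ 5 * 4 ^ d * 2 ^ (e + 4) * ∑ u ∈ U, (ker (e + 4) (w - u) * ker (e + 4) (u - x)) *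
        ker (e + 4) (u - v) * (ker (e + 4) (w' - v) * ker (e + 4) (v - y)) := by
    intro v _
    have near : ∀ a ∈ U.filter (fun a => (linkSystem m d).Near a v), size (a - v) ≤ 2 := by
      intro a ha
      rcases (Finset.mem_filter.1 ha).2 with h | ⟨f, hf⟩
      · rw [h, sub_self]; simp [size]
      · exact size_sub_le_of_adj (adj_of_link hf)
    have cardnear : ((U.filter fun a => (linkSystem m d).Near a v).card : ℝ) ≤ 4 ^ d := by
      have := card_filter_size_le U v ∅ (by simp) 2 (by norm_num)
      rw [Finset.card_empty, Nat.sub_zero] at this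
      have h' : (U.filter fun a => (linkSystem m d).Near a v).card ≤ 4 ^ d := by
        refine (Finset.card_le_card fun a ha => ?_).trans this
        exact Finset.mem_filter.2 ⟨(Finset.mem_filter.1 ha).1, near a ha⟩
      exact_mod_cast h'
    have each : ∀ a ∈ U.filter (fun a => (linkSystem m d).Near a v),
        prob p F (fun S => (linkSystem m d).Reach ↑S w x ∧ (linkSystem m d).Reach ↑S w a) ≤
        2 * C ^ 3 * 2 ^ (e + 4) * ∑ u ∈ U, ker (e + 4) (w - u) * ker (e + 4) (u - x) *
          ker (e + 4) (u - v) := by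
      intro a ha
      refine (LinkSystem.prob_reach_two_le h0 hp1 hU hw x a).trans ?_
      rw [Finset.mul_sum, Finset.mul_sum]
      refine Finset.sum_le_sum fun u _ => ?_
      -- `a` is `v` or a neighbour of it, so it may be replaced by `v` at the cost of a constant.
      have hs : size (u - v) ≤ 2 * size (u - a) := by
        have h3 := size_sub_le u a v
        have h4 := near a ha
        have h5 := one_le_size (u - a)
        omega
      have hk := ker_le_of_size_le (a := e + 4) hs
      push_cast at hk
      have q1 : (linkSystem m d).tau p F w u * (linkSystem m d).tau p F u x *
          (linkSystem m d).tau p F u a ≤ C * ker (e + 4) (w - u) * (C * ker (e + 4) (u - x)) *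
            (C * (2 ^ (e + 4) * ker (e + 4) (u - v))) := by
        have k1 := k0 (w - u); have k2 := k0 (u - x); have k3 := k0 (u - v)
        have := t0 w u; have := t0 u x; have := t0 u a
        refine mul_le_mul (mul_le_mul (hτ _ _) (hτ _ _) (t0 _ _) (by positivity)) ?_ (t0 _ _)
          (by positivity)
        exact (hτ u a).trans (mul_le_mul_of_nonneg_left hk hC.le)
      refine (mul_le_mul_of_nonneg_left q1 zero_le_two).trans (le_of_eq ?_)
      ring
    have S0 : 0 ≤ ∑ u ∈ U, ker (e + 4) (w - u) * ker (e + 4) (u - x) * ker (e + 4) (u - v) :=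
      Finset.sum_nonneg fun u _ => mul_nonneg (mul_nonneg (k0 _) (k0 _)) (k0 _)
    have b1 := Finset.sum_le_sum each
    rw [Finset.sum_const, nsmul_eq_mul] at b1
    have b2 := b1.trans (mul_le_mul_of_nonneg_right cardnear (by positivity))
    have b3 : (linkSystem m d).tau p F w' v * (linkSystem m d).tau p F v y ≤
        C * ker (e + 4) (w' - v) * (C * ker (e + 4) (v - y)) :=
      mul_le_mul (hτ _ _) (hτ _ _) (t0 _ _) (mul_nonneg hC.le (k0 _))
    refine (mul_le_mul b2 b3 (mul_nonneg (t0 _ _) (t0 _ _)) (by positivity)).trans (le_of_eq ?_)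
    rw [← Finset.sum_mul]
    ring
  refine (Finset.sum_le_sum step).trans ?_
  rw [← Finset.mul_sum]
  -- Once the two direct kernels have been extracted, four chains through u and v remain. Each joins
  -- an end of the first connection to an end of the second, and these ends are at distance at least
  -- K.
  have pt : ∀ v ∈ U, ∀ u ∈ U, (ker (e + 4) (w - u) * ker (e + 4) (u - x)) * ker (e + 4) (u - v) *
      (ker (e + 4) (w' - v) * ker (e + 4) (v - y)) ≤
      2 ^ (e + 4) * 2 ^ (e + 4) * (ker (e + 4) (w - x) * ker (e + 4) (w' - y)) *
      (ker (e + 4) (w - u) * ker (e + 4) (u - v) * ker (e + 4) (v - w') +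
       ker (e + 4) (w - u) * ker (e + 4) (u - v) * ker (e + 4) (v - y) +
       ker (e + 4) (x - u) * ker (e + 4) (u - v) * ker (e + 4) (v - w') +
       ker (e + 4) (x - u) * ker (e + 4) (u - v) * ker (e + 4) (v - y)) := by
    intro v _ u _
    have a1 := ker_mul_ker_le_add (e + 4) w x u
    have a2 := ker_mul_ker_le_add (e + 4) w' y v
    rw [ker_sub_comm _ x u, ker_sub_comm _ v w']
    have k1 := k0 (w - u); have k2 := k0 (u - x); have k3 := k0 (u - v); have k4 := k0 (w' - v)
    have k5 := k0 (v - y); have k6 := k0 (w - x); have k7 := k0 (w' - y)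
    have a3 := mul_le_mul (mul_le_mul_of_nonneg_right a1 k3) a2 (by positivity) (by positivity)
    refine a3.trans (le_of_eq ?_)
    ring
  refine (mul_le_mul_of_nonneg_left (Finset.sum_le_sum fun v hv => Finset.sum_le_sum fun u hu =>
    pt v hv u hu) (by positivity)).trans ?_
  simp only [← Finset.mul_sum, Finset.sum_add_distrib]
  have T := add_le_add (add_le_add (add_le_add (triple w w' d1) (triple w y d2))
    (triple x w' d3)) (triple x y d4)
  have k6 := k0 (w - x); have k7 := k0 (w' - y)
  have T2 := mul_le_mul_of_nonneg_left T (by positivity :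
    0 ≤ 2 * C ^ 5 * 4 ^ d * 2 ^ (e + 4) * (2 ^ (e + 4) * 2 ^ (e + 4) *
      (ker (e + 4) (w - x) * ker (e + 4) (w' - y))))
  rw [← mul_assoc]
  refine T2.trans (le_of_eq ?_)
  ring

end Meet

/-! ### Lower bound for the connection of a site to both faces. -/

section LowerBound

variable {m : Model} {d e : ℕ}

theorem natAbs_le_of_mem_box {L : ℕ} {y : Site d} (h : y ∈ box d L) (i : Fin d) :
    (y i).natAbs ≤ L := by
  have h1 : |y i| ≤ (L : ℤ) := by exact_mod_cast h i
  rw [Int.abs_eq_natAbs] at h1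
  exact_mod_cast h1

/-- Three connections that start close to each other can be joined at a bounded cost. -/
theorem pow_mul_le_prob_branching {p : unitInterval} {F : Finset (m.Element d)}
    {U : Finset (Site d)} (hU : (linkSystem m d).Heads F U) {C C' : ℝ} (hC' : 0 < C')
    (hτ : ∀ x y, (linkSystem m d).tau p F x y ≤ C * ker (e + 4) (x - y))
    {K : ℕ} (hK : 1 ≤ K) (hmeet : ∀ w ∈ U, ∀ x w' y : Site d, K ≤ size (w - w') →
      K ≤ size (w - y) → K ≤ size (x - w') → K ≤ size (x - y) →
      (linkSystem m d).meet p F U w x w' y ≤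
        C' * (K : ℝ)⁻¹ * (ker (e + 4) (w - x) * ker (e + 4) (w' - y)))
    {w w₂ w₃ x y z : Site d} {D : Finset (m.Element d)}
    (hD : (D : Set (m.Element d)) = (linkSystem m d).inner (ball K w)) (hDF : D ⊆ F)
    (hw : w ∈ U) (hw₂ : w₂ ∈ U) (hw₃ : w₃ ∈ U) (b₂ : w₂ ∈ ball K w) (b₃ : w₃ ∈ ball K w)
    (h12 : w ≠ w₂) (hy₁ : w ≠ y) (hy₂ : w₂ ≠ y) (hz₁ : w ≠ z) (hz₂ : w₂ ≠ z) (hz₃ : w₃ ≠ z)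
    (d12 : K ≤ size (w - w₂)) (d13 : K ≤ size (w - w₃)) (d23 : K ≤ size (w₂ - w₃))
    (d1y : K ≤ size (w - y)) (d1z : K ≤ size (w - z)) (d2z : K ≤ size (w₂ - z))
    (dx2 : K ≤ size (x - w₂)) (dx3 : K ≤ size (x - w₃)) (dy3 : K ≤ size (y - w₃))
    (dxy : K ≤ size (x - y)) (dxz : K ≤ size (x - z)) (dyz : K ≤ size (y - z)) :
    (p : ℝ) ^ ((2 * K + 1) ^ d * (2 * K + 1) ^ d) * ((linkSystem m d).tau p F w x *
      (linkSystem m d).tau p F w₂ y * (linkSystem m d).tau p F w₃ z -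
      3 * (C' * (K : ℝ)⁻¹ * C) *
        (ker (e + 4) (w - x) * ker (e + 4) (w₂ - y) * ker (e + 4) (w₃ - z))) ≤
      prob (p : ℝ) F fun S => (linkSystem m d).Branching (ball K w) x y z ↑S := by
  have h0 : (0 : ℝ) ≤ p := p.2.1
  have h1 : (p : ℝ) ≤ 1 := p.2.2
  have k0 : ∀ v : Site d, 0 ≤ ker (e + 4) v := ker_nonneg _
  have hC0 : ∀ v v', 0 ≤ C * ker (e + 4) (v - v') := fun v v' =>
    (LinkSystem.tau_nonneg h0 h1 v v').trans (hτ v v')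
  have K0 : (0 : ℝ) < K := by exact_mod_cast hK
  have main := LinkSystem.tau_mul_tau_mul_tau_le (P := linkSystem m d) (F := F) (x := x) h0 h1 hU
    hw hw₂ hw₃ hy₁ hy₂ hz₁ hz₂ hz₃
  have bad : ∀ a ∈ U, ∀ a' b b' c c' : Site d, K ≤ size (a - a') → K ≤ size (a - b') →
      K ≤ size (b - a') → K ≤ size (b - b') →
      (linkSystem m d).meet p F U a b a' b' * (linkSystem m d).tau p F c c' ≤
        (C' * (K : ℝ)⁻¹ * C) *
          (ker (e + 4) (a - b) * ker (e + 4) (a' - b') * ker (e + 4) (c - c')) := by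
    intro a ha a' b b' c c' q1 q2 q3 q4
    refine (mul_le_mul (hmeet a ha b a' b' q1 q2 q3 q4) (hτ c c')
      (LinkSystem.tau_nonneg h0 h1 _ _) ?_).trans (le_of_eq (by ring))
    have := k0 (a - b); have := k0 (a' - b')
    positivity
  have m1 := bad w hw w₂ x y w₃ z d12 d1y dx2 dxy
  have m2 := bad w hw w₃ x z w₂ y d13 d1z dx3 dxz
  have m3 := bad w₂ hw₂ w₃ y z w x d23 d2z dy3 dyz
  obtain ⟨D', hD', hcard⟩ := exists_inner_ball (m := m) K w
  have hDD : D = D' := Finset.coe_injective (hD.trans hD'.symm)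
  have sep := LinkSystem.pow_mul_prob_separated_le (p := (p : ℝ)) (F := F) (x := x) (y := y)
    (z := z) h0 h1 hD hDF (fun a ha b hb => reach_ball K w a b ha hb) (center_mem_ball K w) b₂ b₃ h12
  refine le_trans ?_ sep
  have hpow : (p : ℝ) ^ ((2 * K + 1) ^ d * (2 * K + 1) ^ d) ≤ (p : ℝ) ^ D.card :=
    pow_le_pow_of_le_one h0 h1 (hDD ▸ hcard)
  refine le_trans (mul_le_mul_of_nonneg_left ?_ (pow_nonneg h0 _))
    (mul_le_mul_of_nonneg_right hpow (prob_nonneg h0 h1 _))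
  linarith

/-- A lower bound on the probability that a site is connected to both faces at given sites. -/
theorem exists_le_law_conn_conn [NeZero d] (he : 1 ≤ e) (hd : d = e + 6) (p : unitInterval)
    (hp : 0 < (p : ℝ)) {c C : ℝ} (hc : 0 < c) (hC : 0 < C)
    (hlow : ∀ x y : Site d, x ≠ y → c * ker (e + 4) (x - y) ≤
      (law m d p).real {ω | (linkSystem m d).Reach (openSet ω) x y})
    (hup : ∀ (F : Finset (m.Element d)) (x y : Site d),
      (linkSystem m d).tau p F x y ≤ C * ker (e + 4) (x - y)) :
    ∃ c' : ℝ, 0 < c' ∧ ∃ L₀ : ℕ, 1 ≤ L₀ ∧ ∀ L ≥ L₀, ∀ x y z : Site d,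
      (∀ i, 2 * (x i).natAbs ≤ L) → y ∈ leftFace d L → z ∈ rightFace d L →
      c' * ((L : ℝ) ^ (2 * e + 6))⁻¹ ≤ (law m d p).real {ω |
        (linkSystem m d).Conn (openSet ω) x y ∧ (linkSystem m d).Conn (openSet ω) x z} := by
  have h0 : (0 : ℝ) ≤ p := p.2.1
  have h1 : (p : ℝ) ≤ 1 := p.2.2
  obtain ⟨C', hC', hmeet⟩ := exists_meet_le m he hd C hC
  -- With this separation the three meeting terms take away at most half of the lower bound for the
  -- product of the three connections.
  obtain ⟨K, hK1, hKbig⟩ : ∃ K : ℕ, 1 ≤ K ∧ 3 * (C' * (K : ℝ)⁻¹ * C) ≤ c ^ 3 / 2 := by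
    obtain ⟨K, hK⟩ := exists_nat_ge (6 * C' * C / c ^ 3 + 1)
    have hpos : 0 ≤ 6 * C' * C / c ^ 3 := by positivity
    have K1 : (1 : ℝ) ≤ K := by linarith
    refine ⟨K, by exact_mod_cast K1, ?_⟩
    have hK' : 6 * C' * C / c ^ 3 ≤ K := by linarith
    rw [div_le_iff₀ (by positivity)] at hK'
    have : 3 * (C' * (K : ℝ)⁻¹ * C) = (6 * C' * C) / (2 * K) := by field_simp; ring
    rw [this, div_le_iff₀ (by positivity)]
    linarith
  set N : ℕ := (2 * K + 1) ^ d * (2 * K + 1) ^ d with hN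
  -- A bound on the number of centres whose ball of radius K meets a given one.
  set M : ℕ := (2 * (2 * K + 1)) ^ d with hM
  have M0 : (0 : ℝ) < M := by rw [hM]; positivity
  refine ⟨(p : ℝ) ^ N * (c ^ 3 / 2) * (8 ^ d)⁻¹ * ((4 : ℝ) ^ (3 * (e + 4)))⁻¹ / M, by positivity,
    8 * (3 * K + 4), by omega, fun L hL x y z hx hy hz => ?_⟩
  set l : ℕ := L / 8 with hl
  have hl1 : 8 * l ≤ L := by omega
  have hl2 : L ≤ 8 * l + 7 := by omega
  have hlK : 3 * K + 4 ≤ l := by omega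
  have hyb := fun i => natAbs_le_of_mem_box hy.1 i
  have hzb := fun i => natAbs_le_of_mem_box hz.1 i
  have hy0 : y 0 = -(L : ℤ) := hy.2
  have hz0 : z 0 = L := hz.2
  -- The candidate branch points fill a cube of side of order L. Their first coordinate lies between
  -- 6l and 7l, hence far from `x`, which is at most 4l + 3 there, and far from both faces.
  set 𝒲 : Finset (Site d) := Fintype.piFinset fun i =>
    if i = 0 then Finset.Icc (6 * l : ℤ) (7 * l) else Finset.Icc (0 : ℤ) l with h𝒲
  have mem𝒲 : ∀ w ∈ 𝒲, (6 * l : ℤ) ≤ w 0 ∧ w 0 ≤ 7 * l ∧ ∀ i, 0 ≤ w i ∧ w i ≤ 7 * l := by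
    intro w hw
    rw [h𝒲, Fintype.mem_piFinset] at hw
    have hw0 := hw 0
    rw [if_pos rfl, Finset.mem_Icc] at hw0
    refine ⟨hw0.1, hw0.2, fun i => ?_⟩
    have hwi := hw i
    split_ifs at hwi with h
    · rw [Finset.mem_Icc] at hwi; omega
    · rw [Finset.mem_Icc] at hwi; omega
  have card𝒲 : ((L : ℝ) / 8) ^ d ≤ 𝒲.card := by
    have hcard : 𝒲.card = (l + 1) ^ d := by
      rw [h𝒲, Fintype.card_piFinset]
      have : ∀ i : Fin d, (if i = 0 then Finset.Icc (6 * l : ℤ) (7 * l)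
          else Finset.Icc (0 : ℤ) l).card = l + 1 := by
        intro i; split_ifs <;> rw [Int.card_Icc] <;> omega
      rw [Finset.prod_congr rfl fun i _ => this i, Finset.prod_const, Finset.card_univ,
        Fintype.card_fin]
    rw [hcard]
    push_cast
    refine pow_le_pow_left₀ (by positivity) ?_ d
    have : (L : ℝ) ≤ 8 * l + 7 := by exact_mod_cast hl2
    linarith
  -- The three connections start at w, w + δ and w - δ: at least K apart, and all inside the ball of
  -- radius K about w.
  set δ : Site d := Pi.single 0 (K : ℤ) with hδ
  have δ0 : δ 0 = K := Pi.single_eq_same _ _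
  have δi : ∀ i, 0 ≤ δ i ∧ δ i ≤ K := by
    intro i
    by_cases h : i = 0
    · rw [h, δ0]; omega
    · rw [hδ, Pi.single_eq_of_ne h]; omega
  have far : ∀ (u v : Site d) (r : ℕ), r ≤ (u 0 - v 0).natAbs → r + 1 ≤ size (u - v) := by
    intro u v r h
    have := natAbs_lt_size (u - v) 0
    rw [Pi.sub_apply] at this
    omega
  have near : ∀ u v : Site d, (∀ i, (u i - v i).natAbs ≤ 2 * L) → size (u - v) ≤ 4 * L := by
    intro u v h
    have : size (u - v) ≤ 2 * L + 1 := by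
      rw [size_le_iff]
      intro i
      have := h i
      rw [Pi.sub_apply]
      omega
    omega
  have ne_of_far : ∀ u v : Site d, 1 ≤ (u 0 - v 0).natAbs → u ≠ v := by
    rintro u _ h rfl; simp at h
  choose D hD hDcard using fun w : Site d => exists_inner_ball (m := m) K w
  set Φ : Site d → ℝ := fun w => ker (e + 4) (w - x) * ker (e + 4) (w + δ - y) *
    ker (e + 4) (w - δ - z) with hΦ
  have fin : ∀ F : Finset (m.Element d), 𝒲.biUnion D ⊆ F →
      ∑ w ∈ 𝒲, (p : ℝ) ^ N * ((linkSystem m d).tau p F w x *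
        (linkSystem m d).tau p F (w + δ) y * (linkSystem m d).tau p F (w - δ) z -
        3 * (C' * (K : ℝ)⁻¹ * C) * Φ w) ≤
      M * prob (p : ℝ) F fun S =>
        (linkSystem m d).Conn ↑S x y ∧ (linkSystem m d).Conn ↑S x z := by
    intro F hF
    obtain ⟨U, hWU, hU⟩ := exists_heads (m := m) F
      (𝒲 ∪ 𝒲.image (fun w => w + δ) ∪ 𝒲.image fun w => w - δ)
    refine le_trans (Finset.sum_le_sum fun w hw => ?_)
      (LinkSystem.sum_prob_branching_le h0 h1 (ball K) 𝒲 M (fun w _ a ha b hb => reach_ball K w a b ha hb) ?_ ?_ ?_ ?_)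
    · obtain ⟨a1, a2, a3⟩ := mem𝒲 w hw
      have hx0 := hx 0
      have q2 : (w + δ) 0 = w 0 + K := by rw [Pi.add_apply, δ0]
      have q3 : (w - δ) 0 = w 0 - K := by rw [Pi.sub_apply, δ0]
      have F' : ∀ u v : Site d, K ≤ (u 0 - v 0).natAbs → K ≤ size (u - v) := fun u v h =>
        (Nat.le_succ _).trans (far u v K h)
      refine pow_mul_le_prob_branching (p := p) hU hC' (hup F) hK1
        (fun w hw x w' y => hmeet p F U h0 h1 hU (hup F) K hK1 w hw x w' y) (hD w)
        ((Finset.subset_biUnion_of_mem D hw).trans hF) (hWU ?_) (hWU ?_) (hWU ?_) ?_ ?_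
        ?_ ?_ ?_ ?_ ?_ ?_ ?_ ?_ ?_ ?_ ?_ ?_ ?_ ?_ ?_ ?_ ?_ ?_
      · exact Finset.mem_union_left _ (Finset.mem_union_left _ hw)
      · exact Finset.mem_union_left _ (Finset.mem_union_right _ (Finset.mem_image_of_mem _ hw))
      · exact Finset.mem_union_right _ (Finset.mem_image_of_mem _ hw)
      · rw [ball, Set.mem_ofPred_eq, size_le_iff]
        intro i; have := δi i; simp only [Pi.sub_apply, Pi.add_apply]; omega
      · rw [ball, Set.mem_ofPred_eq, size_le_iff]
        intro i; have := δi i; simp only [Pi.sub_apply]; omega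
      iterate 6 exact ne_of_far _ _ (by omega)
      iterate 12 exact F' _ _ (by omega)
    · intro w hw hb
      obtain ⟨a1, a2, a3⟩ := mem𝒲 w hw
      have hx0 := hx 0
      have := far x w (K + 2) (by omega)
      rw [ball, Set.mem_ofPred_eq] at hb
      omega
    · intro w hw hb
      obtain ⟨a1, a2, a3⟩ := mem𝒲 w hw
      have := far y w (K + 2) (by omega)
      rw [ball, Set.mem_ofPred_eq] at hb
      omega
    · intro w hw hb
      obtain ⟨a1, a2, a3⟩ := mem𝒲 w hw
      have := far z w (K + 2) (by omega)
      rw [ball, Set.mem_ofPred_eq] at hb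
      omega
    · intro w hw
      have := card_filter_size_le 𝒲 w ∅ (by simp) (2 * K + 1) (by omega)
      rw [Finset.card_empty, Nat.sub_zero] at this
      refine (Finset.card_le_card fun w' hw' => ?_).trans this
      obtain ⟨hw'1, hw'2⟩ := Finset.mem_filter.1 hw'
      rw [Set.not_disjoint_iff] at hw'2
      obtain ⟨v, hv, hv'⟩ := hw'2
      rw [ball, Set.mem_ofPred_eq] at hv hv'
      refine Finset.mem_filter.2 ⟨hw'1, ?_⟩
      have t := size_sub_le w' v w
      rw [size_sub_comm] at hv'
      omega
  have reach : ∀ u v : Site d, Tendsto (fun F => (linkSystem m d).tau p F u v) atTop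
      (𝓝 ((law m d p).real {ω | (linkSystem m d).Reach (openSet ω) u v})) := fun u v =>
    tendsto_prob p (finitary_reach u v)
  -- The lower bound on the two-point function is only available in infinite volume, so the finite
  -- systems are exhausted before it is inserted.
  have lim := le_of_tendsto_of_tendsto
    (tendsto_finsetSum 𝒲 fun w _ => ((((reach w x).mul (reach (w + δ) y)).mul
      (reach (w - δ) z)).sub_const (3 * (C' * (K : ℝ)⁻¹ * C) * Φ w)).const_mul ((p : ℝ) ^ N))
    ((tendsto_prob (m := m) p ((finitary_conn x y).and (finitary_conn x z))).const_mul (M : ℝ))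
    (by filter_upwards [eventually_ge_atTop (𝒲.biUnion D)] with F hF using fin F hF)
  have term : ∀ w ∈ 𝒲, (p : ℝ) ^ N * (c ^ 3 / 2 * ((4 * L : ℝ) ^ (3 * (e + 4)))⁻¹) ≤
      (p : ℝ) ^ N * ((law m d p).real {ω | (linkSystem m d).Reach (openSet ω) w x} *
        (law m d p).real {ω | (linkSystem m d).Reach (openSet ω) (w + δ) y} *
        (law m d p).real {ω | (linkSystem m d).Reach (openSet ω) (w - δ) z} -
        3 * (C' * (K : ℝ)⁻¹ * C) * Φ w) := by
    intro w hw
    obtain ⟨a1, a2, a3⟩ := mem𝒲 w hw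
    have hx0 := hx 0
    have q2 : (w + δ) 0 = w 0 + K := by rw [Pi.add_apply, δ0]
    have q3 : (w - δ) 0 = w 0 - K := by rw [Pi.sub_apply, δ0]
    refine mul_le_mul_of_nonneg_left ?_ (pow_nonneg h0 _)
    have l1 := hlow w x (ne_of_far _ _ (by omega))
    have l2 := hlow (w + δ) y (ne_of_far _ _ (by omega))
    have l3 := hlow (w - δ) z (ne_of_far _ _ (by omega))
    have k1 := ker_nonneg (e + 4) (w - x)
    have k2 := ker_nonneg (e + 4) (w + δ - y)
    have k3 := ker_nonneg (e + 4) (w - δ - z)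
    have prod : c ^ 3 * Φ w ≤ (law m d p).real {ω | (linkSystem m d).Reach (openSet ω) w x} *
        (law m d p).real {ω | (linkSystem m d).Reach (openSet ω) (w + δ) y} *
        (law m d p).real {ω | (linkSystem m d).Reach (openSet ω) (w - δ) z} := by
      refine le_trans (le_of_eq ?_) (mul_le_mul (mul_le_mul l1 l2 (by positivity)
        measureReal_nonneg) l3 (by positivity) (by positivity))
      rw [hΦ]; ring
    have s1 := le_ker (a := e + 4) (near w x fun i => by
      have := a3 i; have := hx i; omega)
    have s2 := le_ker (a := e + 4) (near (w + δ) y fun i => by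
      have := a3 i; have := hyb i; have := δi i; rw [Pi.add_apply]; omega)
    have s3 := le_ker (a := e + 4) (near (w - δ) z fun i => by
      have := a3 i; have := hzb i; have := δi i; rw [Pi.sub_apply]; omega)
    push_cast at s1 s2 s3
    have Φlow : ((4 * L : ℝ) ^ (3 * (e + 4)))⁻¹ ≤ Φ w := by
      refine le_trans (le_of_eq ?_) (mul_le_mul (mul_le_mul s1 s2 (by positivity) k1) s3
        (by positivity) (by positivity))
      rw [← mul_inv, ← mul_inv, ← pow_add, ← pow_add]
      congr 2; ring
    have Φ0 : 0 ≤ Φ w := by positivity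
    have := mul_le_mul_of_nonneg_right hKbig Φ0
    have := mul_le_mul_of_nonneg_left Φlow (by positivity : 0 ≤ c ^ 3 / 2)
    linarith
  have total := (Finset.sum_le_sum term).trans lim
  rw [Finset.sum_const, nsmul_eq_mul] at total
  have hL0 : (0 : ℝ) < L := by
    have : 0 < L := by omega
    exact_mod_cast this
  rw [div_mul_eq_mul_div, div_le_iff₀ M0, mul_comm _ (M : ℝ)]
  refine le_trans ?_ total
  -- Three kernels give L^{-3(d-2)}, and the order of L^d branch points reduces this to L^{-(2d-6)}.
  have pw : (L : ℝ) ^ (3 * (e + 4)) = (L : ℝ) ^ d * (L : ℝ) ^ (2 * e + 6) := by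
    rw [← pow_add]; congr 1; omega
  refine le_trans (le_of_eq ?_) (mul_le_mul_of_nonneg_right card𝒲 (by positivity))
  rw [mul_pow, pw, div_pow]
  field_simp

end LowerBound

/-! ### Different clusters occur disjointly. -/

namespace LinkSystem

variable {V E : Type*} {P : LinkSystem V E} {S : Finset E} {x y z x' y' z' : V}

/-- The open elements of the cluster of a site. -/
def clusterElements (P : LinkSystem V E) (S : Finset E) (x : V) : Finset E :=
  S.filter fun e => e ∈ P.root x ∨ ∃ u v, P.Reach ↑S x u ∧ P.link u e v

theorem Conn.clusterElements (h : P.Conn ↑S x y) : P.Conn ↑(P.clusterElements S x) x y := by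
  refine ⟨fun e he => Finset.mem_coe.2 (Finset.mem_filter.2 ⟨h.1 he, Or.inl he⟩), ?_⟩
  have hr := h.2
  have : P.Reach ↑S x y ∧ P.Reach ↑(P.clusterElements S x) x y := by
    induction hr with
    | refl => exact ⟨Reach.refl _ _, Reach.refl _ _⟩
    | @tail u v hu hs ih =>
      obtain ⟨e, he, hl⟩ := hs
      exact ⟨Reach.step hu he hl, (ih ⟨h.1, hu⟩).2.step
        (Finset.mem_coe.2 (Finset.mem_filter.2 ⟨he, Or.inr ⟨u, v, hu, hl⟩⟩)) hl⟩
  exact this.2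

/-- A common open element would give the two clusters a common site: by `root_inj` for two roots, by
`root_link` for a root and a step, by `head_eq` for two steps. -/
theorem disjoint_clusterElements (hx : P.root x ⊆ ↑S) (hx' : P.root x' ⊆ ↑S)
    (h : ¬P.Conn ↑S x x') : Disjoint (P.clusterElements S x) (P.clusterElements S x') := by
  rw [Finset.disjoint_left]
  intro e he he'
  obtain ⟨heS, h1⟩ := Finset.mem_filter.1 he
  obtain ⟨-, h2⟩ := Finset.mem_filter.1 he'
  rcases h1 with h1 | ⟨u, v, hu, hl⟩
  · rcases h2 with h2 | ⟨u', v', hu', hl'⟩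
    · exact h (P.root_inj h1 h2 ▸ ⟨hx, Reach.refl _ _⟩)
    · exact h (Conn.symm ⟨hx', P.root_link h1 hl' ▸ hu'.step heS hl'⟩)
  · rcases h2 with h2 | ⟨u', v', hu', hl'⟩
    · exact h ⟨hx, P.root_link h2 hl ▸ hu.step heS hl⟩
    · have c' : P.Conn ↑S x' v' := ⟨hx', hu'.step heS hl'⟩
      rcases P.head_eq hl hl' with q | q
      · exact h (Conn.trans ⟨hx, q ▸ hu⟩ c'.symm)
      · exact h (Conn.trans ⟨hx, q ▸ hu.step heS hl⟩ c'.symm)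

/-- Up to the event that the two clusters coincide, clusters are negatively correlated. -/
theorem prob_conn_and_conn_le {p : ℝ} {F : Finset E} (h0 : 0 ≤ p) (h1 : p ≤ 1)
    (x y z x' y' z' : V) :
    prob p F (fun S => (P.Conn ↑S x y ∧ P.Conn ↑S x z) ∧ (P.Conn ↑S x' y' ∧ P.Conn ↑S x' z')) ≤
      prob p F (fun S => P.Conn ↑S x y ∧ P.Conn ↑S x z) *
        prob p F (fun S => P.Conn ↑S x' y' ∧ P.Conn ↑S x' z') +
      prob p F fun S => ((P.Conn ↑S x y ∧ P.Conn ↑S x z) ∧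
        (P.Conn ↑S x' y' ∧ P.Conn ↑S x' z')) ∧ P.Conn ↑S x x' := by
  have bk := prob_disjointlyOccur_and_le (p := p) (F := F) h0 h1
    (A := fun S => P.Conn ↑S x y ∧ P.Conn ↑S x z)
    (B := fun S => P.Conn ↑S x' y' ∧ P.Conn ↑S x' z')
    (fun S T h hS => ⟨hS.1.mono (Finset.coe_subset.2 h), hS.2.mono (Finset.coe_subset.2 h)⟩)
    (fun S T h hS => ⟨hS.1.mono (Finset.coe_subset.2 h), hS.2.mono (Finset.coe_subset.2 h)⟩)
  refine le_trans (le_trans (prob_mono h0 h1 fun S _ hS => ?_) (prob_or_le h0 h1))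
    (add_le_add_left bk _)
  by_cases hc : P.Conn ↑S x x'
  · exact Or.inr ⟨hS, hc⟩
  · exact Or.inl ⟨_, Finset.filter_subset _ _, _, Finset.filter_subset _ _,
      disjoint_clusterElements hS.1.1.1 hS.2.1.1 hc,
      ⟨hS.1.1.clusterElements, hS.1.2.clusterElements⟩,
      ⟨hS.2.1.clusterElements, hS.2.2.clusterElements⟩⟩

end LinkSystem

/-! ### Pairs of spanning triples in a single cluster. -/

section SecondMoment

variable {m : Model} {d e : ℕ}

/-- A site in the window that is connected to given sites of the two faces. -/
def Spans (m : Model) {d : ℕ} (i : Site d × Site d × Site d) (S : Set (m.Element d)) : Prop :=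
  (linkSystem m d).Conn S i.1 i.2.1 ∧ (linkSystem m d).Conn S i.1 i.2.2

/-- Two triples of sites that lie in a single cluster. -/
def SpansTogether (m : Model) {d : ℕ} (i j : Site d × Site d × Site d) (S : Set (m.Element d)) :
    Prop :=
  (Spans m i S ∧ Spans m j S) ∧ (linkSystem m d).Conn S i.1 j.1

theorem finitary_spans (i : Site d × Site d × Site d) : Finitary (Spans m i) :=
  (finitary_conn _ _).and (finitary_conn _ _)

theorem finitary_spansTogether (i j : Site d × Site d × Site d) :
    Finitary (SpansTogether m i j) :=
  ((finitary_spans i).and (finitary_spans j)).and (finitary_conn _ _)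

theorem law_spans_and_spans_le (p : unitInterval) (i j : Site d × Site d × Site d) :
    (law m d p).real {ω | Spans m i (openSet ω) ∧ Spans m j (openSet ω)} ≤
      (law m d p).real {ω | Spans m i (openSet ω)} * (law m d p).real {ω | Spans m j (openSet ω)} +
        (law m d p).real {ω | SpansTogether m i j (openSet ω)} :=
  le_of_tendsto_of_tendsto (tendsto_prob p ((finitary_spans i).and (finitary_spans j)))
    (((tendsto_prob p (finitary_spans i)).mul (tendsto_prob p (finitary_spans j))).add
      (tendsto_prob p (finitary_spansTogether i j)))
    (Eventually.of_forall fun _ => LinkSystem.prob_conn_and_conn_le p.2.1 p.2.2 _ _ _ _ _ _)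

/-- The sites of a window and of two faces, in the order window, face, face, face, face. -/
def targets (X Y Z : Finset (Site d)) : Fin 5 → Finset (Site d) := ![X, Y, Z, Y, Z]

/-- When two triples share a cluster, the five other sites are all reachable from `x`, so the sum
over them is at most a product of five counts. -/
theorem sum_prob_spansTogether_le {p : ℝ} (h0 : 0 ≤ p) (h1 : p ≤ 1) (F : Finset (m.Element d))
    (X Y Z : Finset (Site d)) :
    ∑ i ∈ X ×ˢ Y ×ˢ Z, ∑ j ∈ X ×ˢ Y ×ˢ Z, prob p F (fun S => SpansTogether m i j ↑S) ≤
      ∑ x ∈ X, (linkSystem m d).moment p F (targets X Y Z) x Finset.univ := by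
  simp only [prob, LinkSystem.moment]
  simp only [← expect_sum]
  refine expect_mono h0 h1 fun S _ => ?_
  rw [Finset.sum_product]
  refine Finset.sum_le_sum fun x _ => ?_
  set r : Site d → ℝ := fun y => ind ((linkSystem m d).Reach ↑S x y) with hr
  have key : ∀ y z x' y' z' : Site d, ind (SpansTogether m (x, y, z) (x', y', z') (S : Set _)) ≤
      r y * (r z * (r x' * (r y' * r z'))) := by
    intro y z x' y' z'
    rw [hr]
    simp only [← ind_and]
    refine ind_mono fun h => ?_
    obtain ⟨⟨⟨a1, a2⟩, a3, a4⟩, a5⟩ := h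
    exact ⟨a1.2, a2.2, a5.2, (a5.trans a3).2, (a5.trans a4).2⟩
  have e1 : ∏ i : Fin 5, ∑ y ∈ targets X Y Z i, r y =
      ∑ y ∈ Y, ∑ z ∈ Z, ∑ x' ∈ X, ∑ y' ∈ Y, ∑ z' ∈ Z,
        r y * (r z * (r x' * (r y' * r z'))) := by
    simp only [← Finset.mul_sum, ← Finset.sum_mul]
    simp only [Fin.prod_univ_five, targets]
    simp
    ring
  rw [e1, Finset.sum_product]
  refine Finset.sum_le_sum fun y _ => Finset.sum_le_sum fun z _ => ?_
  rw [Finset.sum_product]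
  refine Finset.sum_le_sum fun x' _ => ?_
  rw [Finset.sum_product]
  exact Finset.sum_le_sum fun y' _ => Finset.sum_le_sum fun z' _ => key y z x' y' z'

/-- An upper bound on the second moments of the sizes of the clusters. -/
theorem exists_sum_law_spansTogether_le [NeZero d] (he : 1 ≤ e) (hd : d = e + 6)
    (p : unitInterval) {C : ℝ} (hC : 0 < C)
    (hup : ∀ (F : Finset (m.Element d)) (x y : Site d),
      (linkSystem m d).tau p F x y ≤ C * ker (e + 4) (x - y)) :
    ∃ C' : ℝ, 0 < C' ∧ ∀ (R L : ℕ) (X Y Z : Finset (Site d)), 1 ≤ R → R ≤ L →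
      (∀ v ∈ X, size v ≤ R) → (∀ v ∈ Y, size v ≤ L) → (∀ v ∈ Z, size v ≤ L) →
      (∃ c, ∀ v ∈ Y, v 0 = c) → (∃ c, ∀ v ∈ Z, v 0 = c) →
      ∑ i ∈ X ×ˢ Y ×ˢ Z, ∑ j ∈ X ×ˢ Y ×ˢ Z,
        (law m d p).real {ω | SpansTogether m i j (openSet ω)} ≤
        C' * X.card * (R : ℝ) ^ 4 * (L : ℝ) ^ 10 := by
  obtain ⟨C₁, hC₁, face⟩ := Growth.sum_ker_le (d := d) (s := d - 1)
    (by positivity : (0 : ℝ) ≤ 2 ^ (d - 1)) (e + 4) 0 (by omega)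
  obtain ⟨C₂, hC₂, window⟩ := Growth.sum_ker_le (d := d) (s := d)
    (by positivity : (0 : ℝ) ≤ 2 ^ d) (e + 4) 1 (by omega)
  obtain ⟨C', hC', mom⟩ := exists_moment_le he hd (linkSystem m d) (0 : Fin 5)
    (C * (1 + C₁ + C₂)) (by positivity) 5
  refine ⟨C', hC', fun R L X Y Z hR hRL hX hY hZ hY0 hZ0 => ?_⟩
  refine le_of_tendsto (tendsto_finsetSum _ fun i _ => tendsto_finsetSum _ fun j _ =>
    tendsto_prob p (finitary_spansTogether (m := m) i j)) (Eventually.of_forall fun F => ?_)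
  refine (sum_prob_spansTogether_le p.2.1 p.2.2 F X Y Z).trans ?_
  obtain ⟨U, hXU, hU⟩ := exists_heads (m := m) F X
  have hface : ∀ A : Finset (Site d), (∃ c, ∀ v ∈ A, v 0 = c) → (∀ v ∈ A, size v ≤ L) →
      ∀ w, ∑ y ∈ A, (linkSystem m d).tau p F w y ≤
        C * (1 + C₁ + C₂) * L * cap (e + 4) L w := by
    rintro A ⟨c, hA⟩ hs w
    have q := face A (growth_of_coord A 0 c hA) L (hR.trans hRL) hs w
    refine (Finset.sum_le_sum fun y _ => hup F w y).trans ?_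
    rw [← Finset.mul_sum]
    refine (mul_le_mul_of_nonneg_left q hC.le).trans ?_
    have := cap_nonneg (e + 4) L w
    have : 0 ≤ C * (1 + C₂) * L * cap (e + 4) L w := by positivity
    rw [zero_add, pow_one]
    linarith
  have hwin : ∀ w, ∑ y ∈ X, (linkSystem m d).tau p F w y ≤
      C * (1 + C₁ + C₂) * (R : ℝ) ^ 2 * cap (e + 4) R w := by
    intro w
    have q := window X (growth_all X) R hR hX w
    rw [one_add_one_eq_two] at q
    refine (Finset.sum_le_sum fun y _ => hup F w y).trans ?_
    rw [← Finset.mul_sum]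
    refine (mul_le_mul_of_nonneg_left q hC.le).trans ?_
    have := cap_nonneg (e + 4) R w
    have : 0 ≤ C * (1 + C₁) * (R : ℝ) ^ 2 * cap (e + 4) R w := by positivity
    linarith
  have hup' : ∀ x y, (linkSystem m d).tau p F x y ≤ C * (1 + C₁ + C₂) * ker (e + 4) (x - y) := by
    intro x y
    refine (hup F x y).trans ?_
    have := ker_nonneg (e + 4) (x - y)
    have : 0 ≤ C * (C₁ + C₂) * ker (e + 4) (x - y) := by positivity
    linarith
  have each : ∀ x ∈ X, (linkSystem m d).moment p F (targets X Y Z) x Finset.univ ≤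
      C' * (R : ℝ) ^ 4 * (L : ℝ) ^ 10 := by
    intro x hx
    -- One window and four faces: five targets, so k = 3 and the bound is of order R⁴ L^{10} for
    -- each starting site.
    have q := (mom p F U (targets X Y Z) R L p.2.1 p.2.2 hU hR hRL hup' ?_ hwin
      Finset.univ 3 (by simp) x (hXU hx)).2.2 (Finset.mem_univ _) (by simp)
    · refine q.trans ?_
      exact mul_le_of_le_one_right (by positivity) (cap_le_one _ _ _)
    · intro i hi
      fin_cases i
      · exact absurd rfl hi
      · exact hface Y hY0 hY
      · exact hface Z hZ0 hZ
      · exact hface Y hY0 hY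
      · exact hface Z hZ0 hZ
  refine (Finset.sum_le_sum each).trans (le_of_eq ?_)
  rw [Finset.sum_const, nsmul_eq_mul]
  ring

end SecondMoment

/-! ### Chebyshev and Markov inequalities. -/

section Chebyshev

variable {Ω ι : Type*} [MeasurableSpace Ω] {μ : Measure Ω}

theorem integrable_ind [IsFiniteMeasure μ] {A : Set Ω} (hA : MeasurableSet A) :
    Integrable (fun ω => ind (ω ∈ A)) μ :=
  (integrable_const (1 : ℝ)).indicator hA

theorem integral_ind {A : Set Ω} (hA : MeasurableSet A) :
    ∫ ω, ind (ω ∈ A) ∂μ = μ.real A :=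
  integral_indicator_one hA

/-- Chebyshev's inequality for a number of events, and Markov's inequality for a number of pairs
of events that dominates its variance. -/
theorem measureReal_count_le [IsProbabilityMeasure μ] {s : Finset ι} {A : ι → Set Ω} {B : ι → ι → Set Ω}
    (hA : ∀ i, MeasurableSet (A i)) (hB : ∀ i j, MeasurableSet (B i j))
    (hAB : ∀ i j, μ.real (A i ∩ A j) ≤ μ.real (A i) * μ.real (A j) + μ.real (B i j))
    {a b r : ℝ} (ha : 0 < a) (haA : a ≤ ∑ i ∈ s, μ.real (A i))
    (hb : ∑ i ∈ s, ∑ j ∈ s, μ.real (B i j) ≤ b) (hr : 0 < r) :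
    μ.real {ω | ¬(a / 2 ≤ ∑ i ∈ s, ind (ω ∈ A i) ∧
      ∑ i ∈ s, ∑ j ∈ s, ind (ω ∈ B i j) ≤ r)} ≤ 4 * b / a ^ 2 + b / r := by
  set T : Ω → ℝ := fun ω => ∑ i ∈ s, ind (ω ∈ A i) with hT
  set Q : Ω → ℝ := fun ω => ∑ i ∈ s, ∑ j ∈ s, ind (ω ∈ B i j) with hQ
  set M : ℝ := ∑ i ∈ s, μ.real (A i) with hM
  have T_int : Integrable T μ := integrable_finsetSum _ fun i _ => integrable_ind (hA i)
  have T_mean : ∫ ω, T ω ∂μ = M := by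
    rw [hT, integral_finsetSum _ fun i _ => integrable_ind (hA i)]
    exact Finset.sum_congr rfl fun i _ => integral_ind (hA i)
  have Q_int : Integrable Q μ := integrable_finsetSum _ fun i _ =>
    integrable_finsetSum _ fun j _ => integrable_ind (hB i j)
  have Q_mean : ∫ ω, Q ω ∂μ ≤ b := by
    rw [hQ, integral_finsetSum _ fun i _ =>
      integrable_finsetSum _ fun j _ => integrable_ind (hB i j)]
    refine le_trans (le_of_eq (Finset.sum_congr rfl fun i _ => ?_)) hb
    rw [integral_finsetSum _ fun j _ => integrable_ind (hB i j)]
    exact Finset.sum_congr rfl fun j _ => integral_ind (hB i j)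
  set D : Ω → ℝ := fun ω => ∑ i ∈ s, ∑ j ∈ s, ind (ω ∈ A i ∩ A j) with hD
  have D_int : Integrable D μ := integrable_finsetSum _ fun i _ =>
    integrable_finsetSum _ fun j _ => integrable_ind ((hA i).inter (hA j))
  have T_sq : ∀ ω, T ω ^ 2 = D ω := by
    intro ω
    rw [hT, hD, sq, Finset.sum_mul_sum]
    refine Finset.sum_congr rfl fun i _ => Finset.sum_congr rfl fun j _ => ?_
    rw [← ind_and]
    rfl
  have D_mean : ∫ ω, D ω ∂μ ≤ M ^ 2 + b := by
    rw [hD, integral_finsetSum _ fun i _ =>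
      integrable_finsetSum _ fun j _ => integrable_ind ((hA i).inter (hA j))]
    have : ∀ i ∈ s, ∫ ω, ∑ j ∈ s, ind (ω ∈ A i ∩ A j) ∂μ ≤
        ∑ j ∈ s, (μ.real (A i) * μ.real (A j) + μ.real (B i j)) := by
      intro i _
      rw [integral_finsetSum _ fun j _ => integrable_ind ((hA i).inter (hA j))]
      refine Finset.sum_le_sum fun j _ => ?_
      rw [integral_ind ((hA i).inter (hA j))]
      exact hAB i j
    refine (Finset.sum_le_sum this).trans ?_
    simp only [Finset.sum_add_distrib]
    rw [← Finset.sum_mul_sum, ← sq]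
    linarith
  have V_eq : ∀ ω, (T ω - M) ^ 2 = D ω - 2 * M * T ω + M ^ 2 := by
    intro ω; rw [← T_sq]; ring
  have V_int : Integrable (fun ω => (T ω - M) ^ 2) μ := by
    simp only [V_eq]
    exact (D_int.sub (T_int.const_mul _)).add (integrable_const _)
  have V_mean : ∫ ω, (T ω - M) ^ 2 ∂μ ≤ b := by
    simp only [V_eq]
    have W_int : Integrable (fun ω => D ω - 2 * M * T ω) μ := D_int.sub (T_int.const_mul _)
    rw [integral_add W_int (integrable_const _), integral_sub D_int (T_int.const_mul (2 * M)), integral_const_mul, T_mean, integral_const,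
      probReal_univ, one_smul]
    linarith
  -- If T < a/2 while the mean is at least a, the deviation exceeds a/2; hence the level a²/4.
  have cheb := (mul_meas_ge_le_integral_of_nonneg (Eventually.of_forall fun ω => sq_nonneg _)
    V_int (a ^ 2 / 4)).trans V_mean
  have markov := (mul_meas_ge_le_integral_of_nonneg (Eventually.of_forall fun ω =>
    Finset.sum_nonneg fun i _ => Finset.sum_nonneg fun j _ => ind_nonneg _) Q_int r).trans Q_mean
  have sub : {ω | ¬(a / 2 ≤ T ω ∧ Q ω ≤ r)} ⊆
      {ω | a ^ 2 / 4 ≤ (T ω - M) ^ 2} ∪ {ω | r ≤ Q ω} := by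
    intro ω hω
    rw [Set.mem_ofPred_eq, not_and_or] at hω
    rcases hω with hω | hω
    · left
      rw [Set.mem_ofPred_eq]
      nlinarith
    · right
      exact (not_le.1 hω).le
  refine (measureReal_mono sub).trans ((measureReal_union_le _ _).trans (add_le_add ?_ ?_))
  · rw [le_div_iff₀ (by positivity)]
    linarith
  · rw [le_div_iff₀ hr]
    linarith

end Chebyshev

/-! ### Counting spanning clusters. -/

section Count

variable {m : Model} {d e : ℕ}

theorem Spans.cluster_mem [NeZero d] {L : ℕ} {W : ℝ} {ω : Config m d}
    {i : Site d × Site d × Site d} (h : Spans m i (openSet ω)) (h₁ : i.1 ∈ box d W)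
    (h₂ : i.2.1 ∈ leftFace d L) (h₃ : i.2.2 ∈ rightFace d L) :
    cluster ω i.1 ∈ spanningClustersSeen L W ω := by
  have c1 := (connected_iff ω i.1 i.2.1).2 h.1
  have c2 := (connected_iff ω i.1 i.2.2).2 h.2
  have c0 := (connected_iff ω i.1 i.1).2 ⟨h.1.1, LinkSystem.Reach.refl _ _⟩
  exact ⟨⟨⟨i.1, c0.1, rfl⟩, ⟨i.2.1, c1, h₂⟩, ⟨i.2.2, c2, h₃⟩⟩, ⟨i.1, c0, h₁⟩⟩

theorem finite_spanningClustersSeen [NeZero d] (L : ℕ) (W : ℝ) (ω : Config m d) :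
    (spanningClustersSeen L W ω).Finite :=
  (finite_spanningClusters L ω).subset fun _ hC => hC.1

/-- By the Cauchy–Schwarz inequality, there are many spanning clusters unless some of them are
large. -/
theorem sq_sum_spans_le [NeZero d] (L : ℕ) (W : ℝ) (ω : Config m d)
    (s : Finset (Site d × Site d × Site d))
    (hs : ∀ i ∈ s, i.1 ∈ box d W ∧ i.2.1 ∈ leftFace d L ∧ i.2.2 ∈ rightFace d L) :
    (∑ i ∈ s, ind (Spans m i (openSet ω))) ^ 2 ≤
      numSpanningSeen L W ω * ∑ i ∈ s, ∑ j ∈ s, ind (SpansTogether m i j (openSet ω)) := by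
  have hfin := finite_spanningClustersSeen L W ω
  set 𝒞 := hfin.toFinset with h𝒞
  have hN : (numSpanningSeen L W ω : ℝ) = 𝒞.card := by
    rw [numSpanningSeen, Set.ncard_eq_toFinset_card _ hfin]
  -- Each spanning triple is credited to its own cluster, which is one of the clusters that are
  -- counted.
  set f : Set (Site d) → Site d × Site d × Site d → ℝ := fun C i =>
    ind (Spans m i (openSet ω) ∧ cluster ω i.1 = C) with hf
  have hT : ∑ i ∈ s, ind (Spans m i (openSet ω)) = ∑ C ∈ 𝒞, ∑ i ∈ s, f C i := by
    rw [Finset.sum_comm]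
    refine Finset.sum_congr rfl fun i hi => ?_
    by_cases h : Spans m i (openSet ω)
    · have hmem : cluster ω i.1 ∈ 𝒞 := by
        rw [h𝒞, Set.Finite.mem_toFinset]
        exact h.cluster_mem (hs i hi).1 (hs i hi).2.1 (hs i hi).2.2
      rw [Finset.sum_eq_single_of_mem _ hmem]
      · rw [ind_true h, hf]; exact (ind_true ⟨h, rfl⟩).symm
      · intro C _ hne
        exact ind_false fun h' => hne h'.2.symm
    · rw [ind_false h, Finset.sum_eq_zero]
      intro C _
      exact ind_false fun h' => h h'.1
  rw [hT, hN]
  refine sq_sum_le_card_mul_sum_sq.trans (mul_le_mul_of_nonneg_left ?_ (Nat.cast_nonneg _))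
  simp only [sq, Finset.sum_mul_sum]
  rw [Finset.sum_comm]
  refine Finset.sum_le_sum fun i _ => ?_
  rw [Finset.sum_comm]
  refine Finset.sum_le_sum fun j _ => ?_
  -- A pair of triples contributes for at most one cluster, and only if that cluster contains both.
  have : ∀ C ∈ 𝒞, f C i * f C j ≤
      if cluster ω i.1 = C then ind (SpansTogether m i j (openSet ω)) else 0 := by
    intro C _
    rw [hf]
    simp only [← ind_and]
    split_ifs with h
    · refine ind_mono ?_
      rintro ⟨⟨hi, h1⟩, hj, h2⟩
      refine ⟨⟨hi, hj⟩, (connected_iff ω _ _).1 ?_⟩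
      have hjj : j.1 ∈ cluster ω j.1 :=
        (connected_iff ω j.1 j.1).2 ⟨hj.1.1, LinkSystem.Reach.refl _ _⟩
      rw [h2, ← h1] at hjj
      exact hjj
    · rw [ind_false]
      rintro ⟨⟨-, h1⟩, -⟩
      exact h h1
  refine (Finset.sum_le_sum this).trans ?_
  rw [Finset.sum_ite_eq]
  split_ifs
  · exact le_rfl
  · exact ind_nonneg _

/-- The sites of a cube. -/
def cube (d R : ℕ) : Finset (Site d) := Fintype.piFinset fun _ => Finset.Icc (-R : ℤ) R

/-- The sites of a cube with a prescribed first coordinate. -/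
def slice (d : ℕ) [NeZero d] (L : ℕ) (c : ℤ) : Finset (Site d) :=
  Fintype.piFinset fun i => if i = 0 then {c} else Finset.Icc (-L : ℤ) L

theorem mem_cube {R : ℕ} {v : Site d} : v ∈ cube d R ↔ ∀ i, (v i).natAbs ≤ R := by
  rw [cube, Fintype.mem_piFinset]
  refine forall_congr' fun i => ?_
  rw [Finset.mem_Icc]
  omega

theorem card_cube (R : ℕ) : (cube d R).card = (2 * R + 1) ^ d := by
  rw [cube, Fintype.card_piFinset, Finset.prod_const, Finset.card_univ, Fintype.card_fin,
    Int.card_Icc]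
  congr 1
  omega

theorem coord_of_mem_slice [NeZero d] {L : ℕ} {c : ℤ} {v : Site d} (h : v ∈ slice d L c) :
    v 0 = c := by
  have := Fintype.mem_piFinset.1 h 0
  rwa [if_pos rfl, Finset.mem_singleton] at this

theorem mem_cube_of_mem_slice [NeZero d] {L : ℕ} {c : ℤ} (hc : c.natAbs ≤ L) {v : Site d}
    (h : v ∈ slice d L c) : v ∈ cube d L := by
  rw [mem_cube]
  intro i
  have := Fintype.mem_piFinset.1 h i
  split_ifs at this with hi
  · rw [Finset.mem_singleton] at this; rw [this]; exact hc
  · rw [Finset.mem_Icc] at this; omega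

theorem card_slice [NeZero d] (L : ℕ) (c : ℤ) : (slice d L c).card = (2 * L + 1) ^ (d - 1) := by
  have h : ∀ i : Fin d, (if i = 0 then ({c} : Finset ℤ) else Finset.Icc (-L : ℤ) L).card =
      if i = 0 then 1 else 2 * L + 1 := by
    intro i
    split_ifs
    · exact Finset.card_singleton _
    · rw [Int.card_Icc]; omega
  rw [slice, Fintype.card_piFinset, Finset.prod_congr rfl fun i _ => h i, Finset.prod_ite,
    Finset.prod_const_one, one_mul, Finset.prod_const, Finset.filter_ne',
    Finset.card_erase_of_mem (Finset.mem_univ _), Finset.card_univ, Fintype.card_fin]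

theorem mem_box_of_mem_cube {R : ℕ} {W : ℝ} (hR : (R : ℝ) ≤ W) {v : Site d} (h : v ∈ cube d R) :
    v ∈ box d W := by
  intro i
  have h1 := mem_cube.1 h i
  have h2 : |v i| ≤ (R : ℤ) := by
    rw [Int.abs_eq_natAbs]
    exact_mod_cast h1
  have h3 : |(v i : ℝ)| ≤ R := by exact_mod_cast h2
  exact h3.trans hR

/-- The probability that few spanning clusters are seen in a window. -/
theorem exists_law_numSpanningSeen_lt_le [NeZero d] (he : 1 ≤ e) (hd : d = e + 6)
    (hτ : ∃ c₁ c₂ : ℝ, 0 < c₁ ∧ c₁ ≤ c₂ ∧ ∀ x y : Site d, x ≠ y →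
      c₁ / eDist x y ^ (d - 2) ≤ twoPoint m d x y ∧
      twoPoint m d x y ≤ c₂ / eDist x y ^ (d - 2)) :
    ∃ C : ℝ, 0 < C ∧ ∃ L₀ : ℕ, 1 ≤ L₀ ∧ ∀ L ≥ L₀, ∀ R : ℕ, 1 ≤ R → 2 * R ≤ L → ∀ W : ℝ, R ≤ W →
      ∀ ε : ℝ, 0 < ε → (criticalLaw m d).real
        {ω | ¬ε * ((R : ℝ) ^ (e + 2) / (L : ℝ) ^ 2) ≤ numSpanningSeen L W ω} ≤
        C * ((R : ℝ) ^ (e + 2) / (L : ℝ) ^ 2)⁻¹ + C * ε := by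
  obtain ⟨hp, c, C, hc, hC, hlow, hup⟩ := exists_tau_bounds hd hτ
  obtain ⟨c', hc', L₀, hL₀, low⟩ := exists_le_law_conn_conn he hd (criticalDensity m d) hp hc hC
    hlow hup
  obtain ⟨C', hC', up⟩ := exists_sum_law_spansTogether_le he hd (criticalDensity m d) hC hup
  refine ⟨4 * (C' * 3 ^ d * 2 ^ 4 * 2 ^ 10) / c' ^ 2, by positivity, L₀, hL₀,
    fun L hL R hR hRL W hRW ε hε => ?_⟩
  have hL1 : 1 ≤ L := hL₀.trans hL
  have R0 : (0 : ℝ) < R := by exact_mod_cast hR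
  have L0 : (0 : ℝ) < L := by exact_mod_cast hL1
  have R1 : (1 : ℝ) ≤ R := by exact_mod_cast hR
  have L1 : (1 : ℝ) ≤ L := by exact_mod_cast hL1
  set X := cube d R with hX
  set Y := slice d L (-(L : ℤ)) with hY
  set Z := slice d L (L : ℤ) with hZ
  set s := X ×ˢ Y ×ˢ Z with hs
  have hYc : ∀ y ∈ Y, y ∈ cube d L := fun y hy => mem_cube_of_mem_slice (by simp) hy
  have hZc : ∀ z ∈ Z, z ∈ cube d L := fun z hz => mem_cube_of_mem_slice (by simp) hz
  have hYl : ∀ y ∈ Y, y ∈ leftFace d L := fun y hy =>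
    ⟨mem_box_of_mem_cube le_rfl (hYc y hy), coord_of_mem_slice hy⟩
  have hZr : ∀ z ∈ Z, z ∈ rightFace d L := fun z hz =>
    ⟨mem_box_of_mem_cube le_rfl (hZc z hz), coord_of_mem_slice hz⟩
  have mem_s : ∀ i ∈ s, i.1 ∈ X ∧ i.2.1 ∈ Y ∧ i.2.2 ∈ Z := by
    intro i hi
    rw [hs, Finset.mem_product, Finset.mem_product] at hi
    exact hi
  have size_le : ∀ {r : ℕ} {v : Site d}, v ∈ cube d r → size v ≤ r + 1 := fun h =>
    size_le_iff.2 (mem_cube.1 h)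
  -- The R^d sites of the window and the L^{2(d-1)} pairs of face sites, each with probability of
  -- order L^{-(2d-6)}, give R^d L⁴.
  set a : ℝ := c' * (R : ℝ) ^ d * (L : ℝ) ^ 4 with ha
  set b : ℝ := C' * 3 ^ d * 2 ^ 4 * 2 ^ 10 * (R : ℝ) ^ (d + 4) * (L : ℝ) ^ 10 with hb
  set n : ℝ := (R : ℝ) ^ (e + 2) / (L : ℝ) ^ 2 with hn
  have a0 : 0 < a := by positivity
  have n0 : 0 < n := by positivity
  have first : a ≤ ∑ i ∈ s, (law m d (criticalDensity m d)).real
      {ω | Spans m i (openSet ω)} := by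
    have each : ∀ i ∈ s, c' * ((L : ℝ) ^ (2 * e + 6))⁻¹ ≤
        (law m d (criticalDensity m d)).real {ω | Spans m i (openSet ω)} := by
      intro i hi
      obtain ⟨h1, h2, h3⟩ := mem_s i hi
      refine low L hL i.1 i.2.1 i.2.2 (fun k => ?_) (hYl _ h2) (hZr _ h3)
      have := mem_cube.1 h1 k
      omega
    refine le_trans ?_ (Finset.sum_le_sum each)
    rw [Finset.sum_const, nsmul_eq_mul, hs, Finset.card_product, Finset.card_product, hX, hY, hZ,
      card_cube, card_slice, card_slice]
    have i1 : (R : ℝ) ^ d ≤ ((2 * R + 1 : ℕ) : ℝ) ^ d :=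
      pow_le_pow_left₀ R0.le (by push_cast; linarith) d
    have i2 : (L : ℝ) ^ (d - 1) ≤ ((2 * L + 1 : ℕ) : ℝ) ^ (d - 1) :=
      pow_le_pow_left₀ L0.le (by push_cast; linarith) _
    have i3 : (R : ℝ) ^ d * ((L : ℝ) ^ (d - 1) * (L : ℝ) ^ (d - 1)) ≤
        (((2 * R + 1) ^ d * ((2 * L + 1) ^ (d - 1) * (2 * L + 1) ^ (d - 1)) : ℕ) : ℝ) := by
      rw [Nat.cast_mul, Nat.cast_mul, Nat.cast_pow, Nat.cast_pow]
      gcongr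
    refine le_trans (le_of_eq ?_) (mul_le_mul_of_nonneg_right i3 (by positivity))
    have : (L : ℝ) ^ (d - 1) * (L : ℝ) ^ (d - 1) = (L : ℝ) ^ 4 * (L : ℝ) ^ (2 * e + 6) := by
      rw [← pow_add, ← pow_add]; congr 1; omega
    rw [this, ha]
    field_simp
  have second : ∑ i ∈ s, ∑ j ∈ s, (law m d (criticalDensity m d)).real
      {ω | SpansTogether m i j (openSet ω)} ≤ b := by
    refine (up (R + 1) (L + 1) X Y Z (by omega) (by omega) (fun v hv => size_le hv)
      (fun v hv => size_le (hYc v hv)) (fun v hv => size_le (hZc v hv))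
      ⟨_, fun v hv => coord_of_mem_slice hv⟩ ⟨_, fun v hv => coord_of_mem_slice hv⟩).trans ?_
    rw [hX, card_cube]
    have i1 : (((2 * R + 1) ^ d : ℕ) : ℝ) ≤ (3 * R : ℝ) ^ d := by
      push_cast
      exact pow_le_pow_left₀ (by positivity) (by linarith) d
    have i2 : ((R + 1 : ℕ) : ℝ) ^ 4 ≤ (2 * R : ℝ) ^ 4 :=
      pow_le_pow_left₀ (by positivity) (by push_cast; linarith) 4
    have i3 : ((L + 1 : ℕ) : ℝ) ^ 10 ≤ (2 * L : ℝ) ^ 10 :=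
      pow_le_pow_left₀ (by positivity) (by push_cast; linarith) 10
    calc C' * (((2 * R + 1) ^ d : ℕ) : ℝ) * ((R + 1 : ℕ) : ℝ) ^ 4 * ((L + 1 : ℕ) : ℝ) ^ 10
        ≤ C' * (3 * R : ℝ) ^ d * (2 * R : ℝ) ^ 4 * (2 * L : ℝ) ^ 10 := by gcongr
      _ = b := by rw [hb]; ring
  -- The level a²/(4εn) for the pairs is the one at which (a/2)² ≤ N · Q yields N ≥ εn.
  have main := measureReal_count_le (μ := law m d (criticalDensity m d)) (s := s)
    (A := fun i => {ω | Spans m i (openSet ω)})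
    (B := fun i j => {ω | SpansTogether m i j (openSet ω)})
    (fun i => measurableSet_finitary (finitary_spans i))
    (fun i j => measurableSet_finitary (finitary_spansTogether i j))
    (fun i j => law_spans_and_spans_le _ i j) a0 first second
    (by positivity : 0 < a ^ 2 / (4 * ε * n))
  rw [criticalLaw]
  refine le_trans ?_ (main.trans (le_of_eq ?_))
  · refine measureReal_mono fun ω hω hgood => ?_
    refine hω ?_
    have cs := sq_sum_spans_le L W ω s fun i hi =>
      ⟨mem_box_of_mem_cube hRW (mem_s i hi).1, hYl _ (mem_s i hi).2.1, hZr _ (mem_s i hi).2.2⟩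
    obtain ⟨g1, g2⟩ := hgood
    have g3 : (a / 2) ^ 2 ≤ numSpanningSeen L W ω * (a ^ 2 / (4 * ε * n)) :=
      (pow_le_pow_left₀ (by positivity) g1 2).trans
        (cs.trans (mul_le_mul_of_nonneg_left g2 (Nat.cast_nonneg _)))
    rw [mul_div_assoc', le_div_iff₀ (by positivity)] at g3
    have g4 : a ^ 2 * (ε * n) ≤ a ^ 2 * numSpanningSeen L W ω := by linarith
    exact le_of_mul_le_mul_left g4 (by positivity)
  -- The relative variance is of order R^{d+4} L^{10} / (R^d L⁴)² = L²/R^{d-4}.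
  · have hba : b / a ^ 2 = C' * 3 ^ d * 2 ^ 4 * 2 ^ 10 / c' ^ 2 * n⁻¹ := by
      have : (R : ℝ) ^ d * (R : ℝ) ^ d = (R : ℝ) ^ (d + 4) * (R : ℝ) ^ (e + 2) := by
        rw [← pow_add, ← pow_add]; congr 1; omega
      have ha2 : a ^ 2 = c' ^ 2 * ((R : ℝ) ^ (d + 4) * (R : ℝ) ^ (e + 2)) * (L : ℝ) ^ 8 := by
        rw [← this, ha]; ring
      rw [ha2, hb, hn]
      field_simp
    have h1 : 4 * b / a ^ 2 = 4 * (b / a ^ 2) := by ring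
    have h2 : b / (a ^ 2 / (4 * ε * n)) = 4 * ε * n * (b / a ^ 2) := by
      field_simp
    rw [h1, h2, hba]
    field_simp

end Count

/-! ### Passage to the limit. -/

section Limits

variable {m : Model} {d e : ℕ}

instance (m : Model) (d : ℕ) : IsProbabilityMeasure (criticalLaw m d) := by
  unfold criticalLaw; infer_instance

/-- Subadditivity is enough, so the events need not be known to be measurable. -/
theorem tendsto_measureReal_of_compl {Ω : Type*} [MeasurableSpace Ω] {μ : Measure Ω}
    [IsProbabilityMeasure μ] {A : ℕ → Set Ω} {g : ℕ → ℝ} (hg : Tendsto g atTop (𝓝 0))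
    (h : ∀ᶠ n in atTop, μ.real (A n)ᶜ ≤ g n) : Tendsto (fun n => μ.real (A n)) atTop (𝓝 1) := by
  have h1 : Tendsto (fun n => 1 - g n) atTop (𝓝 1) := by simpa using hg.const_sub 1
  refine tendsto_of_tendsto_of_tendsto_of_le_of_le' h1 tendsto_const_nhds ?_
    (Eventually.of_forall fun n => measureReal_le_one)
  filter_upwards [h] with n hn
  have := measureReal_union_le (μ := μ) (A n) (A n)ᶜ
  rw [Set.union_compl_self, probReal_univ] at this
  linarith

theorem tendsto_measureReal_of_subset {Ω : Type*} [MeasurableSpace Ω] {μ : Measure Ω}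
    [IsProbabilityMeasure μ] {A B : ℕ → Set Ω}
    (hA : Tendsto (fun n => μ.real (A n)) atTop (𝓝 1)) (h : ∀ᶠ n in atTop, A n ⊆ B n) :
    Tendsto (fun n => μ.real (B n)) atTop (𝓝 1) :=
  tendsto_of_tendsto_of_tendsto_of_le_of_le' hA tendsto_const_nhds
    (h.mono fun _ hn => measureReal_mono hn) (Eventually.of_forall fun _ => measureReal_le_one)

/-- The number of spanning clusters seen in a window. -/
theorem tendsto_law_numSpanningSeen [NeZero d] (he : 1 ≤ e) (hd : d = e + 6)
    (hτ : ∃ c₁ c₂ : ℝ, 0 < c₁ ∧ c₁ ≤ c₂ ∧ ∀ x y : Site d, x ≠ y →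
      c₁ / eDist x y ^ (d - 2) ≤ twoPoint m d x y ∧
      twoPoint m d x y ≤ c₂ / eDist x y ^ (d - 2))
    {L : ℕ → ℕ} {W ε : ℕ → ℝ} (hL : Tendsto L atTop atTop) (hWL : ∀ᶠ n in atTop, W n ≤ L n)
    (hW : Tendsto (fun n => W n / (L n : ℝ) ^ ((2 : ℝ) / ((d : ℝ) - 4))) atTop atTop)
    (hε : Tendsto ε atTop (𝓝 0)) :
    Tendsto (fun n => (criticalLaw m d).real {ω | ε n * (W n ^ (d - 4) / (L n : ℝ) ^ 2) ≤
      (numSpanningSeen (L n) (W n) ω : ℝ)}) atTop (𝓝 1) := by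
  obtain ⟨C, hC, L₀, hL₀, main⟩ := exists_law_numSpanningSeen_lt_le (m := m) he hd hτ
  have hd4 : d - 4 = e + 2 := by omega
  have hα : (d : ℝ) - 4 = ((e + 2 : ℕ) : ℝ) := by rw [hd]; push_cast; ring
  rw [hα] at hW
  rw [hd4]
  set α : ℝ := 2 / ((e + 2 : ℕ) : ℝ) with hαdef
  have hα0 : 0 ≤ α := by positivity
  set q : ℕ → ℝ := fun n => W n / (L n : ℝ) ^ α with hq
  -- Half the window, so that W ≤ L gives 2R ≤ L, as the counting estimate requires.
  set R : ℕ → ℕ := fun n => ⌊W n / 2⌋₊ with hR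
  set ν : ℕ → ℝ := fun n => (R n : ℝ) ^ (e + 2) / (L n : ℝ) ^ 2 with hν
  have hLpos : ∀ᶠ n in atTop, L₀ ≤ L n := hL.eventually_ge_atTop L₀
  have hWbig : ∀ᶠ n in atTop, 4 ≤ W n := by
    filter_upwards [hLpos, hW.eventually_ge_atTop 4] with n h1 h2
    have hL1 : (1 : ℝ) ≤ L n := by exact_mod_cast hL₀.trans h1
    have h3 : 1 ≤ (L n : ℝ) ^ α := Real.one_le_rpow hL1 hα0
    have h2' := (le_div_iff₀ (by positivity)).1 h2
    linarith
  have hRW : ∀ n, 4 ≤ W n → (R n : ℝ) ≤ W n / 2 ∧ W n / 4 ≤ R n := by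
    intro n h
    have h1 := Nat.floor_le (by linarith : 0 ≤ W n / 2)
    have h2 := Nat.lt_floor_add_one (W n / 2)
    exact ⟨h1, by simp only [hR]; linarith⟩
  have hqν : ∀ᶠ n in atTop, (q n / 4) ^ (e + 2) ≤ ν n := by
    filter_upwards [hLpos, hWbig] with n h1 h2
    have hL0 : (0 : ℝ) < L n := by exact_mod_cast hL₀.trans h1
    -- The exponent 2/(d - 4) is the one that turns the growth of W/L^α into that of R^{d-4}/L².
    have h3 : ((L n : ℝ) ^ α) ^ (e + 2) = (L n : ℝ) ^ 2 := by
      rw [← Real.rpow_natCast, ← Real.rpow_mul hL0.le, hαdef,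
        div_mul_cancel₀ _ (by positivity), Real.rpow_two]
    have h4 : q n / 4 = W n / 4 / (L n : ℝ) ^ α := by simp only [hq]; ring
    rw [h4, div_pow, h3]
    simp only [hν]
    have := (hRW n h2).2
    gcongr
  have hν_top : Tendsto ν atTop atTop := by
    refine tendsto_atTop_mono' _ hqν ?_
    exact (tendsto_pow_atTop (by omega)).comp (hW.atTop_div_const (by norm_num))
  -- The estimate needs a positive threshold, whereas `ε n` may vanish or be negative; the factor
  -- 4^{e+2} pays for replacing `W n` by `R n`.
  set η : ℕ → ℝ := fun n => 4 ^ (e + 2) * (|ε n| + 1 / ((n : ℝ) + 1)) with hη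
  have hη0 : Tendsto η atTop (𝓝 0) := by
    have := ((hε.abs.add tendsto_one_div_add_atTop_nhds_zero_nat).const_mul
      ((4 : ℝ) ^ (e + 2)))
    rwa [abs_zero, add_zero, mul_zero] at this
  have hg : Tendsto (fun n => C * (ν n)⁻¹ + C * η n) atTop (𝓝 0) := by
    simpa using ((tendsto_inv_atTop_zero.comp hν_top).const_mul C).add (hη0.const_mul C)
  refine tendsto_measureReal_of_compl hg ?_
  filter_upwards [hLpos, hWbig, hWL] with n h1 h2 h3
  obtain ⟨r1, r2⟩ := hRW n h2
  have hL0 : (0 : ℝ) < L n := by exact_mod_cast hL₀.trans h1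
  have hη_pos : 0 < η n := by
    have : 0 < 1 / ((n : ℝ) + 1) := by positivity
    have := abs_nonneg (ε n)
    simp only [hη]; positivity
  have hR1 : 1 ≤ R n := by
    have : (1 : ℝ) ≤ R n := by linarith
    exact_mod_cast this
  have hRL : 2 * R n ≤ L n := by
    have : 2 * (R n : ℝ) ≤ L n := by linarith
    exact_mod_cast this
  refine le_trans ?_ (main (L n) h1 (R n) hR1 hRL (W n) (by linarith) (η n) hη_pos)
  refine measureReal_mono fun ω hω hle => hω ?_
  rw [Set.mem_ofPred_eq]
  refine le_trans ?_ hle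
  have hWR : W n ^ (e + 2) ≤ 4 ^ (e + 2) * (R n : ℝ) ^ (e + 2) := by
    rw [← mul_pow]
    exact pow_le_pow_left₀ (by linarith) (by linarith) _
  have hpos : 0 < W n ^ (e + 2) / (L n : ℝ) ^ 2 := by
    have : 0 < W n := by linarith
    positivity
  have hεη : ε n ≤ |ε n| + 1 / ((n : ℝ) + 1) := by
    have := le_abs_self (ε n)
    have : 0 < 1 / ((n : ℝ) + 1) := by positivity
    linarith
  calc ε n * (W n ^ (e + 2) / (L n : ℝ) ^ 2)
      ≤ (|ε n| + 1 / ((n : ℝ) + 1)) * (W n ^ (e + 2) / (L n : ℝ) ^ 2) :=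
        mul_le_mul_of_nonneg_right hεη hpos.le
    _ ≤ (|ε n| + 1 / ((n : ℝ) + 1)) * (4 ^ (e + 2) * (R n : ℝ) ^ (e + 2) / (L n : ℝ) ^ 2) := by
        gcongr
    _ = η n * ((R n : ℝ) ^ (e + 2) / (L n : ℝ) ^ 2) := by
        simp only [hη]; ring

theorem spanningClustersSeen_mono [NeZero d] {L : ℕ} {W W' : ℝ} (h : W ≤ W') (ω : Config m d) :
    spanningClustersSeen L W ω ⊆ spanningClustersSeen L W' ω := by
  rintro C ⟨hC, x, hx, hxW⟩
  exact ⟨hC, x, hx, fun i => (hxW i).trans h⟩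

theorem spanningClustersSeen_self [NeZero d] (L : ℕ) (ω : Config m d) :
    spanningClustersSeen L L ω = spanningClusters L ω := by
  refine Set.Subset.antisymm (fun C hC => hC.1) fun C hC => ?_
  obtain ⟨-, ⟨x, hx, hxL⟩, -⟩ := id hC
  exact ⟨hC, x, hx, hxL.1⟩

/-- A spanning cluster is seen in a window. -/
theorem tendsto_law_spanningClustersSeen_nonempty [NeZero d] (he : 1 ≤ e) (hd : d = e + 6)
    (hτ : ∃ c₁ c₂ : ℝ, 0 < c₁ ∧ c₁ ≤ c₂ ∧ ∀ x y : Site d, x ≠ y →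
      c₁ / eDist x y ^ (d - 2) ≤ twoPoint m d x y ∧
      twoPoint m d x y ≤ c₂ / eDist x y ^ (d - 2))
    {L : ℕ → ℕ} {W : ℕ → ℝ} (hL : Tendsto L atTop atTop) (hWL : ∀ᶠ n in atTop, W n ≤ L n)
    (hW : Tendsto (fun n => W n / (L n : ℝ) ^ ((2 : ℝ) / ((d : ℝ) - 4))) atTop atTop) :
    Tendsto (fun n => (criticalLaw m d).real
      {ω | (spanningClustersSeen (L n) (W n) ω).Nonempty}) atTop (𝓝 1) := by
  -- Any positive sequence that tends to zero would do: a positive lower bound forces the number of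
  -- clusters to be nonzero.
  have h := tendsto_law_numSpanningSeen (m := m) he hd hτ hL hWL hW
    (tendsto_one_div_add_atTop_nhds_zero_nat (𝕜 := ℝ))
  refine tendsto_measureReal_of_subset h ?_
  filter_upwards [hL.eventually_ge_atTop 1, hW.eventually_gt_atTop 0] with n h1 h2 ω hω
  have hL0 : (0 : ℝ) < L n := by exact_mod_cast h1
  have hW0 : 0 < W n := (div_pos_iff_of_pos_right (by positivity)).1 h2
  have hpos : 0 < 1 / ((n : ℝ) + 1) * (W n ^ (d - 4) / (L n : ℝ) ^ 2) := by positivity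
  have hN : (0 : ℝ) < numSpanningSeen (L n) (W n) ω := hpos.trans_le hω
  have hN' : 0 < numSpanningSeen (L n) (W n) ω := by exact_mod_cast hN
  exact (Set.ncard_pos (finite_spanningClustersSeen _ _ ω)).1 hN'

/-- For d > 6 the exponent 2/(d - 4) is less than one, so the full cube W = L is an admissible
window. -/
theorem tendsto_self_div_rpow (hd : 6 < d) :
    Tendsto (fun L : ℕ => (L : ℝ) / (L : ℝ) ^ ((2 : ℝ) / ((d : ℝ) - 4))) atTop atTop := by
  have hd' : (6 : ℝ) < d := by exact_mod_cast hd
  have h : (2 : ℝ) / ((d : ℝ) - 4) < 1 := by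
    rw [div_lt_one (by linarith)]; linarith
  have := (tendsto_rpow_atTop (sub_pos.2 h)).comp tendsto_natCast_atTop_atTop
  refine this.congr' ?_
  filter_upwards [eventually_ge_atTop 1] with L hL
  have : (0 : ℝ) < L := by exact_mod_cast hL
  simp only [Function.comp]
  rw [Real.rpow_sub this, Real.rpow_one]

end Limits

end Percolation

end

theorem theorem4 (m : Percolation.Model) (d : ℕ) [NeZero d] (hd : 6 < d)
    (hτ : ∃ c₁ c₂ : ℝ, 0 < c₁ ∧ c₁ ≤ c₂ ∧ ∀ x y : Percolation.Site d, x ≠ y →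
      c₁ / Percolation.eDist x y ^ (d - 2) ≤ Percolation.twoPoint m d x y ∧
      Percolation.twoPoint m d x y ≤ c₂ / Percolation.eDist x y ^ (d - 2)) :
    -- the spanning probability tends to one
    Tendsto (fun L : ℕ => (Percolation.criticalLaw m d).real
        {ω | (Percolation.spanningClusters L ω).Nonempty}) atTop (𝓝 1) ∧
    -- a spanning cluster is seen in the window
    (∀ W : ℕ → ℝ,
      Tendsto (fun L : ℕ => W L / (L : ℝ) ^ ((2 : ℝ) / ((d : ℝ) - 4))) atTop atTop →
      Tendsto (fun L : ℕ => (Percolation.criticalLaw m d).real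
        {ω | (Percolation.spanningClustersSeen L (W L) ω).Nonempty}) atTop (𝓝 1)) ∧
    -- the number of spanning clusters
    (∀ ε : ℕ → ℝ, Tendsto ε atTop (𝓝 0) →
      Tendsto (fun L : ℕ => (Percolation.criticalLaw m d).real
        {ω | ε L * (L : ℝ) ^ (d - 6) ≤ (Percolation.numSpanning L ω : ℝ)}) atTop (𝓝 1)) ∧
    -- the number of spanning clusters seen in the window
    (∀ (L : ℕ → ℕ) (W ε : ℕ → ℝ), Tendsto L atTop atTop → (∀ n, W n ≤ L n) →
      Tendsto (fun n => W n / (L n : ℝ) ^ ((2 : ℝ) / ((d : ℝ) - 4))) atTop atTop →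
      Tendsto ε atTop (𝓝 0) →
      Tendsto (fun n => (Percolation.criticalLaw m d).real
        {ω | ε n * (W n ^ (d - 4) / (L n : ℝ) ^ 2) ≤
          (Percolation.numSpanningSeen (L n) (W n) ω : ℝ)}) atTop (𝓝 1)) := by
  obtain ⟨e, he, hde⟩ : ∃ e, 1 ≤ e ∧ d = e + 6 := ⟨d - 6, by omega, by omega⟩
  have hself : ∀ᶠ n : ℕ in atTop, ((n : ℕ) : ℝ) ≤ (n : ℝ) := Eventually.of_forall fun n => le_rfl
  have ratio := Percolation.tendsto_self_div_rpow hd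
  refine ⟨?_, fun W hW => ?_, fun ε hε => ?_, fun L W ε hL hWL hW hε =>
    Percolation.tendsto_law_numSpanningSeen he hde hτ hL (Eventually.of_forall hWL) hW hε⟩
  · have h := Percolation.tendsto_law_spanningClustersSeen_nonempty (L := fun n => n)
      (W := fun n => n) he hde hτ tendsto_id hself ratio
    simpa only [Percolation.spanningClustersSeen_self] using h
  -- The window may exceed the cube here, so it is first cut down to `min (W L) L`; clusters seen in
  -- the smaller window are seen in the larger one.
  · have hmin : Tendsto (fun L : ℕ => min (W L) L / (L : ℝ) ^ ((2 : ℝ) / ((d : ℝ) - 4)))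
        atTop atTop := by
      refine tendsto_atTop.2 fun b => ?_
      filter_upwards [hW.eventually_ge_atTop b, ratio.eventually_ge_atTop b] with L h1 h2
      rcases min_choice (W L) L with h | h <;> rw [h]
      · exact h1
      · exact h2
    have h := Percolation.tendsto_law_spanningClustersSeen_nonempty (L := fun n => n)
      he hde hτ tendsto_id (Eventually.of_forall fun n => min_le_right _ _) hmin
    exact Percolation.tendsto_measureReal_of_subset h (Eventually.of_forall fun n ω hω =>
      hω.mono (Percolation.spanningClustersSeen_mono (min_le_left _ _) ω))
  · have h := Percolation.tendsto_law_numSpanningSeen (L := fun n => n) (W := fun n => n)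
      he hde hτ tendsto_id hself ratio hε
    refine Percolation.tendsto_measureReal_of_subset h ?_
    filter_upwards [eventually_ge_atTop 1] with L hL ω hω
    have hL0 : (0 : ℝ) < L := by exact_mod_cast hL
    have hpow : (L : ℝ) ^ (d - 4) / (L : ℝ) ^ 2 = (L : ℝ) ^ (d - 6) := by
      rw [div_eq_iff (by positivity), ← pow_add]
      congr 1; omega
    rw [Set.mem_ofPred_eq, hpow, Percolation.numSpanningSeen,
      Percolation.spanningClustersSeen_self] at hω
    exact hω
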